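/- Let $\alpha\in[0,1)$, $a\in\mathbb C$, $\gamma\in\mathbb R$. Let $M=(\mathbb R\setminus\{0\})\times\mathbb S^1$ carry the Grushin metric $\mathrm dx^2+|x|^{-2\alpha}\mathrm dy^2$, with volume $\mu_\alpha=|x|^{-\alpha}\mathrm dx\,\mathrm dy$ and Laplace--Beltrami operator $\Delta_\alpha=\partial_x^2-\frac{\alpha}{x}\partial_x+|x|^{2\alpha}\partial_y^2$, and let $H_\alpha=-\Delta_\alpha$ on $C_c^\infty(M)\subset L^2(M,\mu_\alpha)$. For $u\in L^2(M,\mu_\alpha)$ and $k\in\mathbb Z$ set $u_k(x)=\int_0^{2\pi}\frac{e^{-iky}}{\sqrt{2\pi}}|x|^{-\alpha/2}u(x,y)\,\mathrm dy$. The type-$\mathrm{II}_a$ Hamiltonian $H_{\alpha,a}^{[\gamma]}$ is the restriction of $H_\alpha^*$ to those $u\in\mathcal D(H_\alpha^*)$ such that, for every $k\in\mathbb Z$, $g=u_k$ has the boundary values $g_0^\pm=\lim_{x\to0^\pm}|x|^{\alpha/2}g(x)$, $g_1^\pm=\lim_{x\to0^\pm}|x|^{-(1+\alpha/2)}(g(x)-g_0^\pm|x|^{-\alpha/2})$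 and they satisfy $g_0^+=a\,g_0^-$, $\;g_1^-+\overline a\,g_1^+=\gamma\,g_0^-$. For $E>0$, a generalised eigenfunction of $H_{\alpha,a}^{[\gamma]}$ at energy $E$ is an $f\in C^2(M)$ with $-\Delta_\alpha f=Ef$ which is locally in the domain, i.e. $\chi f\in\mathcal D(H_{\alpha,a}^{[\gamma]})$ for every $\chi=\chi(x)\in C_c^\infty(\mathbb R)$ that equals $1$ near $0$. It is a scattering state with flux injected from $\sigma\cdot\infty$, $\sigma\in\{+1,-1\}$, with amplitudes $c_{\mathrm{in}}\neq0,c_{\mathrm{ref}},c_{\mathrm{tr}}\in\mathbb C$, if, uniformly in $y$, as $s\to+\infty$, $$s^{-\alpha/2}f(\sigma s,y)=c_{\mathrm{in}}e^{-is\sqrt E}+c_{\mathrm{ref}}e^{is\sqrt E}+o(1),\qquad s^{-\alpha/2}f(-\sigma s,y)=c_{\mathrm{tr}}e^{is\sqrt E}+o(1).$$ Then for every $E>0$ scattering states exist from both ends, and the transmission and reflection coefficients $T_{\alpha,a,\gamma}(E)=|c_{\mathrm{tr}}|^2/|c_{\mathrm{in}}|^2$, $R_{\alpha,a,\gamma}(E)=|c_{\mathrm{ref}}|^2/|c_{\mathrm{in}}|^2$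 depend neither on the scattering state nor on $\sigma$. They are given by $$T_{\alpha,a,\gamma}(E)=\left|\frac{E^{\frac{1+\alpha}2}(1+e^{i\pi\alpha})\,\Gamma(\frac{1-\alpha}2)\,\overline a}{E^{\frac{1+\alpha}2}\Gamma(\frac{1-\alpha}2)(1+|a|^2)+i\gamma\,2^{1+\alpha}e^{i\frac\pi2\alpha}\Gamma(\frac{3+\alpha}2)}\right|^2,$$ $$R_{\alpha,a,\gamma}(E)=\left|\frac{E^{\frac{1+\alpha}2}\Gamma(\frac{1-\alpha}2)(1-|a|^2e^{i\pi\alpha})+i\gamma\,2^{1+\alpha}e^{i\frac\pi2\alpha}\Gamma(\frac{3+\alpha}2)}{E^{\frac{1+\alpha}2}\Gamma(\frac{1-\alpha}2)(1+|a|^2)+i\gamma\,2^{1+\alpha}e^{i\frac\pi2\alpha}\Gamma(\frac{3+\alpha}2)}\right|^2,$$ and $T_{\alpha,a,\gamma}(E)+R_{\alpha,a,\gamma}(E)=1$ for all $E>0$. If $\gamma=0$ they are independent of $E$. If $\alpha\in(0,1)$, $|a|=1$ and $\gamma>0$, the scattering is reflectionless, $R_{\alpha,a,\gamma}(E)=0$,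 at the energy $$E=E_*:=\left(\frac{2^{1+\alpha}\,\gamma\,\Gamma(\frac{3+\alpha}2)\sin\frac\pi2\alpha}{\Gamma(\frac{1-\alpha}2)(1-\cos\pi\alpha)}\right)^{\frac2{1+\alpha}}>0 .$$ This is the only reflectionless case apart from the trivial one: for $E>0$, $R_{\alpha,a,\gamma}(E)=0$ if and only if either $\alpha\in(0,1)$, $|a|=1$, $\gamma>0$ and $E=E_*$, or $\alpha=0$, $|a|=1$ and $\gamma=0$. Moreover $$\lim_{E\to+\infty}T_{\alpha,a,\gamma}(E)=\frac{2|a|^2(1+\cos\pi\alpha)}{(1+|a|^2)^2},\qquad\lim_{E\to+\infty}R_{\alpha,a,\gamma}(E)=\frac{1+|a|^4-2|a|^2\cos\pi\alpha}{(1+|a|^2)^2},$$ and, if $\gamma\neq0$, $\lim_{E\downarrow0}T_{\alpha,a,\gamma}(E)=0$ and $\lim_{E\downarrow0}R_{\alpha,a,\gamma}(E)=1$. -/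

import Mathlib

open MeasureTheory Filter Set Topology
open scoped ComplexConjugate ContDiff

noncomputable section

namespace Grushin

/-! ### The Grushin cylinder

`M = (ℝ ∖ {0}) × 𝕊¹`, with metric `dx² + |x|^(-2α) dy²`.  A function on `M` is represented by a
function `f : ℝ → ℝ → ℂ` of `(x, y)` that is `2π`-periodic in `y`; its values at `x = 0` never
matter. -/

/-- `f` is `2π`-periodic in the second variable, i.e. is a function on `ℝ × 𝕊¹`. -/
def IsPeriodic (f : ℝ → ℝ → ℂ) : Prop :=
  ∀ x y : ℝ, f x (y + 2 * Real.pi) = f x y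

/-- The Riemannian volume `μ_α = |x|^(-α) dx dy`, on the cell `{x ≠ 0} × (0, 2π]`. -/
def vol (α : ℝ) : Measure (ℝ × ℝ) :=
  (volume.restrict {p : ℝ × ℝ | p.1 ≠ 0 ∧ p.2 ∈ Ioc 0 (2 * Real.pi)}).withDensity
    (fun p => ENNReal.ofReal (|p.1| ^ (-α)))

/-- The Laplace–Beltrami operator of the metric `dx² + |x|^(-2α) dy²` on `{x ≠ 0}`:
`Δ_α = |x|^α ∂_x (|x|^(-α) ∂_x) + |x|^(2α) ∂_y² = ∂_x² - (α / x) ∂_x + |x|^(2α) ∂_y²`. -/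
def laplaceBeltrami (α : ℝ) (f : ℝ → ℝ → ℂ) (x y : ℝ) : ℂ :=
  deriv (deriv (fun s => f s y)) x - ((α / x : ℝ) : ℂ) * deriv (fun s => f s y) x
    + ((|x| ^ (2 * α) : ℝ) : ℂ) * deriv (deriv (fun s => f x s)) y

/-- Membership in `L²(M, μ_α)`. -/
def IsL2 (α : ℝ) (u : ℝ → ℝ → ℂ) : Prop :=
  IsPeriodic u ∧ MemLp (fun p : ℝ × ℝ => u p.1 p.2) 2 (vol α)

/-- `φ ∈ C_c^∞(M)`: the support is contained in some `{ε ≤ |x| ≤ R}`, `ε > 0`. -/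
def IsTestFunction (φ : ℝ → ℝ → ℂ) : Prop :=
  IsPeriodic φ ∧ ContDiff ℝ ∞ (fun p : ℝ × ℝ => φ p.1 p.2) ∧
    ∃ ε R : ℝ, 0 < ε ∧ ∀ x y : ℝ, φ x y ≠ 0 → ε ≤ |x| ∧ |x| ≤ R

/-- `u ∈ D(H_α^*)` and `H_α^* u = w`, where `H_α = -Δ_α` with domain `C_c^∞(M)` is the minimal
free Hamiltonian: `⟨H_α φ, u⟩ = ⟨φ, w⟩` for all `φ ∈ C_c^∞(M)`. -/
def AdjointGraph (α : ℝ) (u w : ℝ → ℝ → ℂ) : Prop :=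
  IsL2 α u ∧ IsL2 α w ∧ ∀ φ : ℝ → ℝ → ℂ, IsTestFunction φ →
    ∫ p : ℝ × ℝ, conj (-laplaceBeltrami α φ p.1 p.2) * u p.1 p.2 ∂(vol α)
      = ∫ p : ℝ × ℝ, conj (φ p.1 p.2) * w p.1 p.2 ∂(vol α)

/-- The `k`-th fibre component of `u`: the `k`-th Fourier coefficient in `y` (with respect to
`e_k(y) = e^{iky} / √(2π)`) of `|x|^(-α/2) u(x, y)`. -/
def fibre (α : ℝ) (k : ℤ) (u : ℝ → ℝ → ℂ) (x : ℝ) : ℂ :=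
  ∫ y in (0 : ℝ)..(2 * Real.pi),
    conj (Complex.exp (Complex.I * k * y) / (Real.sqrt (2 * Real.pi) : ℂ))
      * (((|x| ^ (-(α / 2)) : ℝ) : ℂ) * u x y)

/-- `g₀` and `g₁` are the boundary values of `g` at `0` along the filter `l`:
`g₀ = lim |x|^(α/2) g(x)` and `g₁ = lim |x|^(-(1+α/2)) (g(x) - g₀ |x|^(-α/2))`. -/
def HasBoundaryValues (α : ℝ) (g : ℝ → ℂ) (l : Filter ℝ) (g₀ g₁ : ℂ) : Prop :=
  Tendsto (fun x : ℝ => ((|x| ^ (α / 2) : ℝ) : ℂ) * g x) l (𝓝 g₀) ∧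
  Tendsto (fun x : ℝ => ((|x| ^ (-(1 + α / 2)) : ℝ) : ℂ)
    * (g x - g₀ * ((|x| ^ (-(α / 2)) : ℝ) : ℂ))) l (𝓝 g₁)

/-- The type-`II_a` boundary condition with parameter `γ` on a fibre:
`g₀⁺ = a g₀⁻` and `g₁⁻ + conj a g₁⁺ = γ g₀⁻`.  The one-sided limits at `0` are limits up to null
sets of `x`, since elements of `L²` are defined almost everywhere only; for functions that are
continuous away from `0` they are the ordinary one-sided limits. -/
def TypeIIBoundaryCondition (α : ℝ) (a : ℂ) (γ : ℝ) (g : ℝ → ℂ) : Prop :=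
  ∃ g₀m g₁m g₀p g₁p : ℂ,
    HasBoundaryValues α g (𝓝[<] 0 ⊓ ae volume) g₀m g₁m ∧
    HasBoundaryValues α g (𝓝[>] 0 ⊓ ae volume) g₀p g₁p ∧
    g₀p = a * g₀m ∧ g₁m + conj a * g₁p = γ * g₀m

/-- The graph of the type-`II_a` Hamiltonian `H_{α,a}^{[γ]}`: `u ∈ D(H_{α,a}^{[γ]})` and
`H_{α,a}^{[γ]} u = w`.  It is the restriction of `H_α^*` to the functions each of whose fibre
components satisfies the type-`II_a` boundary condition. -/
def HamiltonianGraph (α : ℝ) (a : ℂ) (γ : ℝ) (u w : ℝ → ℝ → ℂ) : Prop :=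
  AdjointGraph α u w ∧ ∀ k : ℤ, TypeIIBoundaryCondition α a γ (fibre α k u)

/-! ### Stationary scattering -/

/-- Generalised eigenfunctions of `H_{α,a}^{[γ]}` at energy `E`: solutions `f` of `-Δ_α f = E f`
on `M` that belong locally to the domain of `H_{α,a}^{[γ]}`, i.e. whose product with every smooth,
compactly supported cutoff `χ(x)` that equals `1` near the singularity lies in the domain. -/
structure IsGeneralisedEigenfunction (α : ℝ) (a : ℂ) (γ E : ℝ) (f : ℝ → ℝ → ℂ) : Prop where
  periodic : IsPeriodic f
  smooth : ContDiffOn ℝ 2 (fun p : ℝ × ℝ => f p.1 p.2) {p | p.1 ≠ 0}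
  eigen : ∀ x y : ℝ, x ≠ 0 → -laplaceBeltrami α f x y = E * f x y
  local_domain : ∀ χ : ℝ → ℝ, ContDiff ℝ ∞ χ → HasCompactSupport χ → (∀ᶠ x in 𝓝 0, χ x = 1) →
    HamiltonianGraph α a γ (fun x y => χ x * f x y)
      (fun x y => -laplaceBeltrami α (fun x' y' => χ x' * f x' y') x y)

/-- The plane wave `e^{i p s}`. -/
def planeWave (p s : ℝ) : ℂ := Complex.exp (Complex.I * p * s)

/-- Scattering states at energy `E` with flux injected from the end `σ · ∞` of the cylinder
(`σ = 1`: from `x = +∞`; `σ = -1`: from `x = -∞`).  Uniformly in `y`, with `s = |x| → +∞`,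
* `f ≈ |x|^(α/2) (cin e^{-i s √E} + cref e^{i s √E})` at the end where the flux is injected: an
  incident wave travelling towards the singularity and a reflected one travelling outwards;
* `f ≈ |x|^(α/2) ctr e^{i s √E}` at the opposite end: a transmitted wave travelling outwards, and
  no incident wave. -/
structure IsScatteringState (α : ℝ) (a : ℂ) (γ E σ : ℝ) (f : ℝ → ℝ → ℂ)
    (cin cref ctr : ℂ) : Prop where
  eigenfunction : IsGeneralisedEigenfunction α a γ E f
  incident_ne : cin ≠ 0
  near : Tendsto (fun p : ℝ × ℝ => ((p.1 ^ (-(α / 2)) : ℝ) : ℂ) * f (σ * p.1) p.2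
      - (cin * planeWave (-√E) p.1 + cref * planeWave √E p.1)) (atTop ×ˢ ⊤) (𝓝 0)
  far : Tendsto (fun p : ℝ × ℝ => ((p.1 ^ (-(α / 2)) : ℝ) : ℂ) * f (-σ * p.1) p.2
      - ctr * planeWave √E p.1) (atTop ×ˢ ⊤) (𝓝 0)

/-- `T` is the transmission coefficient at energy `E`: from either end there is a scattering
state, and for every scattering state, from either end, the density of the transmitted flux
divided by that of the incident flux is `T`. -/
def IsTransmissionCoefficient (α : ℝ) (a : ℂ) (γ E T : ℝ) : Prop :=
  ∀ σ : ℝ, σ = 1 ∨ σ = -1 →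
    (∃ f cin cref ctr, IsScatteringState α a γ E σ f cin cref ctr) ∧
    ∀ f cin cref ctr, IsScatteringState α a γ E σ f cin cref ctr → ‖ctr‖ ^ 2 / ‖cin‖ ^ 2 = T

/-- `R` is the reflection coefficient at energy `E`: the same with the reflected flux. -/
def IsReflectionCoefficient (α : ℝ) (a : ℂ) (γ E R : ℝ) : Prop :=
  ∀ σ : ℝ, σ = 1 ∨ σ = -1 →
    (∃ f cin cref ctr, IsScatteringState α a γ E σ f cin cref ctr) ∧
    ∀ f cin cref ctr, IsScatteringState α a γ E σ f cin cref ctr → ‖cref‖ ^ 2 / ‖cin‖ ^ 2 = R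

/-- The transmission coefficient `T_{α,a,γ}(E)`. -/
def transmission (α : ℝ) (a : ℂ) (γ E : ℝ) : ℝ :=
  Classical.epsilon (IsTransmissionCoefficient α a γ E)

/-- The reflection coefficient `R_{α,a,γ}(E)`. -/
def reflection (α : ℝ) (a : ℂ) (γ E : ℝ) : ℝ :=
  Classical.epsilon (IsReflectionCoefficient α a γ E)

/-- The energy
`(2^(1+α) γ Γ((3+α)/2) sin(πα/2) / (Γ((1-α)/2) (1 - cos πα)))^(2/(1+α))`. -/
def reflectionlessEnergy (α γ : ℝ) : ℝ :=
  ((2 : ℝ) ^ (1 + α) * γ * Real.Gamma ((3 + α) / 2) * Real.sin (Real.pi / 2 * α) /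
    (Real.Gamma ((1 - α) / 2) * (1 - Real.cos (Real.pi * α)))) ^ (2 / (1 + α))

end Grushin

end

/-!
The scattering coefficients are those of the zero Fourier mode.  The asymptotic conditions are
uniform in `y`, so they pass to the average over the circle (`tendsto_zeroMode`), and that average
solves `F'' - (α / s) F' + E F = 0` on either side of the singularity, because the angular second
derivative integrates to zero (`IsGeneralisedEigenfunction.zeroMode_eq`).

The radial equation has an outgoing solution `h`, given by the Laplace-type integral
`e^{is} ∫₀^∞ e^{-v} (v (v - 2is))^{α/2} dv` at energy one and by scaling in general; it plays the
role of `s^((1+α)/2)` times a Hankel function.  Dominated convergence gives its amplitude at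
infinity.  At the singularity `h = 1 + B s^(1+α) + o(s^(1+α))`, and the connection coefficient `B`
comes from a Beta integral with a purely imaginary shift, evaluated through Euler's Gamma integral
with a complex rate and simplified by the duplication formula (`exists_isOutgoing`, `outCoeff`).
Since `B` is not real, the weighted Wronskian of `h` and its conjugate does not vanish, so the two
span all solutions (`IsOutgoing.exists_coeff`).

Write the zero mode as `c h + d h̄` on the right and `c' h + d' h̄` on the left.  The type-`II_a`
condition becomes two linear equations in these four coefficients (`Matching`), and absence of an
incoming wave at one end sets `d` or `d'` to zero.  The flux ratios are then quotients by the
determinant `B (1 + |a|²) - γ` (`IsScatteringState.flux_ratios`).  Conversely, a radial function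
with matched coefficients is a scattering state.  The only point that needs an argument is that its
cutoffs lie in the domain of the adjoint; this is integration by parts on the cylinder
(`integral_laplaceBeltrami_mul`).  As `α < 1`, the weight `|x|^(-α)` is integrable at the
singularity, so boundedness of `h` there is enough for square integrability.

With `B = k (sin θ + i cos θ)`, where `θ = πα/2` and `k > 0` is a multiple of `E^((1+α)/2)`, both
coefficients become explicit real functions of `k` (`fluxT`, `fluxR`), from which the conservation
law, the reflectionless energies and the limits are read off.
-/

namespace Grushin

/-! ### Laplace-type integrals -/

/-- The integrand `e^{-v} v^p (v - 2is)^q` of `laplaceInt`. -/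
noncomputable def laplaceKernel (p q s v : ℝ) : ℂ :=
  ((Real.exp (-v) * v ^ p : ℝ) : ℂ) * ((v : ℂ) - 2 * Complex.I * s) ^ (q : ℂ)

/-- The integral `∫₀^∞ e^{-v} v^p (v - 2is)^q dv`.  For `p = q = α / 2` it is `e^{-is}` times an
outgoing solution of `F'' - (α / s) F' + F = 0`. -/
noncomputable def laplaceInt (p q s : ℝ) : ℂ := ∫ v in Ioi (0 : ℝ), laplaceKernel p q s v

lemma base_ne {v : ℝ} (s : ℝ) (hv : 0 < v) : (v : ℂ) - 2 * Complex.I * s ∈ Complex.slitPlane := by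
  left; simpa using hv

lemma base_norm_ge {v s : ℝ} (hs : 0 ≤ s) : 2 * s ≤ ‖(v : ℂ) - 2 * Complex.I * s‖ := by
  have := Complex.abs_im_le_norm ((v : ℂ) - 2 * Complex.I * s)
  simp at this
  rwa [abs_of_nonneg hs] at this

lemma base_norm_le {v s : ℝ} (hv : 0 ≤ v) (hs : 0 ≤ s) :
    ‖(v : ℂ) - 2 * Complex.I * s‖ ≤ v + 2 * s := by
  refine (norm_sub_le _ _).trans ?_
  simp [abs_of_nonneg hv, abs_of_nonneg hs]

/-- A bound for `x ^ q`, uniform for `x` between `l` and `v + c`, that works for both signs of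
`q`. -/
lemma rpow_le_of_between {l c v x q : ℝ} (hl : 0 < l) (hc : 0 ≤ c) (hv : 0 ≤ v)
    (h1 : l ≤ x) (h2 : x ≤ v + c) :
    x ^ q ≤ l ^ q + (2 * c) ^ |q| + 2 ^ |q| * v ^ |q| := by
  have hx : 0 < x := hl.trans_le h1
  have e1 : 0 ≤ l ^ q := by positivity
  have e2 : 0 ≤ (2 * c) ^ |q| := by positivity
  have e3 : (2 * v) ^ |q| = 2 ^ |q| * v ^ |q| := Real.mul_rpow (by norm_num) hv
  have e4 : 0 ≤ (2 * v) ^ |q| := by positivity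
  rw [← e3]
  rcases le_total q 0 with hq | hq
  · have := Real.rpow_le_rpow_of_nonpos hl h1 hq
    linarith
  · rw [abs_of_nonneg hq] at *
    rcases le_total v c with h | h
    · have := Real.rpow_le_rpow hx.le (show x ≤ 2 * c by linarith) hq
      linarith
    · have := Real.rpow_le_rpow hx.le (show x ≤ 2 * v by linarith) hq
      linarith

lemma integrableOn_exp_neg_mul_rpow {p : ℝ} (hp : -1 < p) :
    IntegrableOn (fun v : ℝ => Real.exp (-v) * v ^ p) (Ioi 0) := by
  have := Real.GammaIntegral_convergent (s := p + 1) (by linarith)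
  simpa using this

lemma integrableOn_exp_neg_mul_rpow_bound {p : ℝ} (hp : -1 < p) (C D q : ℝ) :
    IntegrableOn (fun v : ℝ => Real.exp (-v) * v ^ p * (C + D * v ^ |q|)) (Ioi 0) := by
  have h1 := (integrableOn_exp_neg_mul_rpow hp).mul_const C
  have h2 := (integrableOn_exp_neg_mul_rpow (p := p + |q|)
    (by have := abs_nonneg q; linarith)).mul_const D
  refine IntegrableOn.congr_fun (f := fun v => Real.exp (-v) * v ^ p * C
    + Real.exp (-v) * v ^ (p + |q|) * D) (h1.add h2) (fun v hv => ?_) measurableSet_Ioi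
  simp only
  rw [Real.rpow_add hv]; ring

lemma continuousOn_laplaceKernel (p q s : ℝ) : ContinuousOn (laplaceKernel p q s) (Ioi 0) := by
  refine ContinuousOn.mul ?_ (ContinuousOn.cpow_const (by fun_prop) fun v hv => base_ne s hv)
  refine Complex.continuous_ofReal.comp_continuousOn ?_
  exact (by fun_prop : ContinuousOn (fun v : ℝ => Real.exp (-v)) _).mul
    (continuousOn_id.rpow_const fun x hx => Or.inl (ne_of_gt hx))

lemma norm_laplaceKernel {p q s v : ℝ} (hv : 0 < v) :
    ‖laplaceKernel p q s v‖
      = Real.exp (-v) * v ^ p * ‖(v : ℂ) - 2 * Complex.I * s‖ ^ q := by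
  rw [laplaceKernel, norm_mul, Complex.norm_cpow_real, Complex.norm_real, Real.norm_eq_abs,
    abs_of_nonneg (by positivity)]

lemma norm_laplaceKernel_le {p q s v l c : ℝ} (hl : 0 < l) (hls : l ≤ 2 * s) (hsc : 2 * s ≤ c)
    (hv : 0 < v) :
    ‖laplaceKernel p q s v‖ ≤
      Real.exp (-v) * v ^ p * ((l ^ q + (2 * c) ^ |q|) + 2 ^ |q| * v ^ |q|) := by
  rw [norm_laplaceKernel hv]
  have hs : 0 ≤ s := by linarith
  exact mul_le_mul_of_nonneg_left (rpow_le_of_between hl (by linarith) hv.le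
    (hls.trans (base_norm_ge hs)) ((base_norm_le hv.le hs).trans (by linarith))) (by positivity)

lemma integrableOn_laplaceKernel {p : ℝ} (hp : -1 < p) (q : ℝ) {s : ℝ} (hs : 0 < s) :
    IntegrableOn (laplaceKernel p q s) (Ioi 0) := by
  refine Integrable.mono' (integrableOn_exp_neg_mul_rpow_bound hp
      ((2 * s) ^ q + (2 * (2 * s)) ^ |q|) (2 ^ |q|) q)
    ((continuousOn_laplaceKernel p q s).aestronglyMeasurable measurableSet_Ioi)
    ((ae_restrict_iff' measurableSet_Ioi).2 (Eventually.of_forall fun v hv => ?_))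
  exact norm_laplaceKernel_le (l := 2 * s) (c := 2 * s) (by linarith) le_rfl le_rfl hv

lemma hasDerivAt_cpow_const_of_real {z : ℝ → ℂ} {z' : ℂ} {t : ℝ} (q : ℂ) (hz : HasDerivAt z z' t)
    (h : z t ∈ Complex.slitPlane) :
    HasDerivAt (fun x => z x ^ q) (q * z t ^ (q - 1) * z') t := by
  have h1 : HasDerivAt (fun w : ℂ => w ^ q) (q * z t ^ (q - 1)) (z t) := by
    simpa using (hasDerivAt_id (z t)).cpow_const (c := q) h
  exact h1.comp t hz

lemma hasDerivAt_laplaceKernel (p q : ℝ) (s : ℝ) {v : ℝ} (hv : 0 < v) :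
    HasDerivAt (fun t => laplaceKernel p q t v)
      (-2 * Complex.I * q * laplaceKernel p (q - 1) s v) s := by
  have h1 : HasDerivAt (fun t : ℝ => (v : ℂ) - 2 * Complex.I * t) (-(2 * Complex.I * 1)) s := by
    simpa using ((Complex.ofRealCLM.hasDerivAt (x := s)).const_mul (2 * Complex.I)).const_sub (v : ℂ)
  have h2 := (hasDerivAt_cpow_const_of_real (q : ℂ) h1 (base_ne s hv)).const_mul
    ((Real.exp (-v) * v ^ p : ℝ) : ℂ)
  unfold laplaceKernel
  refine h2.congr_deriv ?_
  push_cast; ring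

/-- Differentiation under the integral sign. -/
lemma hasDerivAt_laplaceInt {p : ℝ} (hp : -1 < p) (q : ℝ) {s : ℝ} (hs : 0 < s) :
    HasDerivAt (laplaceInt p q) (-2 * Complex.I * q * laplaceInt p (q - 1) s) s := by
  have hmem : Ioo (s / 2) (2 * s) ∈ 𝓝 s := Ioo_mem_nhds (by linarith) (by linarith)
  have key := (hasDerivAt_integral_of_dominated_loc_of_deriv_le (μ := volume.restrict (Ioi (0:ℝ)))
    (F := fun t v => laplaceKernel p q t v)
    (F' := fun t v => -2 * Complex.I * q * laplaceKernel p (q - 1) t v)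
    (bound := fun v => 2 * |q| * (Real.exp (-v) * v ^ p *
      ((s ^ (q - 1) + (2 * (4 * s)) ^ |q - 1|) + 2 ^ |q - 1| * v ^ |q - 1|)))
    hmem
    (Eventually.of_forall fun t =>
      (continuousOn_laplaceKernel p q t).aestronglyMeasurable measurableSet_Ioi)
    (integrableOn_laplaceKernel hp q hs)
    (((continuousOn_laplaceKernel p (q - 1) s).aestronglyMeasurable measurableSet_Ioi).const_mul _)
    ((ae_restrict_iff' measurableSet_Ioi).2 (Eventually.of_forall fun v hv t ht => ?_))
    ((integrableOn_exp_neg_mul_rpow_bound hp _ _ (q - 1)).const_mul _)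
    ((ae_restrict_iff' measurableSet_Ioi).2 (Eventually.of_forall fun v hv t ht => ?_))).2
  · rw [integral_const_mul] at key
    exact key
  · rw [norm_mul]
    refine mul_le_mul (by simp) (norm_laplaceKernel_le hs ?_ ?_ hv) (norm_nonneg _)
      (by positivity) <;> linarith [ht.1, ht.2]
  · exact hasDerivAt_laplaceKernel p q t hv

lemma laplaceKernel_add_one (p q s : ℝ) {v : ℝ} (hv : 0 < v) :
    laplaceKernel (p + 1) q s v
      = laplaceKernel p (q + 1) s v + 2 * Complex.I * s * laplaceKernel p q s v := by
  have h0 := Complex.slitPlane_ne_zero (base_ne s hv)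
  simp only [laplaceKernel]
  rw [Real.rpow_add_one hv.ne']
  push_cast
  rw [Complex.cpow_add _ _ h0, Complex.cpow_one]
  ring

lemma laplaceInt_add_one {p : ℝ} (hp : -1 < p) (q : ℝ) {s : ℝ} (hs : 0 < s) :
    laplaceInt (p + 1) q s = laplaceInt p (q + 1) s + 2 * Complex.I * s * laplaceInt p q s := by
  unfold laplaceInt
  rw [← integral_const_mul, ← integral_add (integrableOn_laplaceKernel hp _ hs)
    ((integrableOn_laplaceKernel hp _ hs).const_mul _)]
  exact setIntegral_congr_fun measurableSet_Ioi fun v hv => laplaceKernel_add_one p q s hv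

/-- Integration by parts. -/
lemma laplaceInt_parts {p : ℝ} (hp : 0 < p) (q : ℝ) {s : ℝ} (hs : 0 < s) :
    laplaceInt p q s = p * laplaceInt (p - 1) q s + q * laplaceInt p (q - 1) s := by
  have i0 := integrableOn_laplaceKernel (p := p) (by linarith) q hs
  have i1 := integrableOn_laplaceKernel (p := p - 1) (by linarith) q hs
  have i2 := integrableOn_laplaceKernel (p := p) (by linarith) (q - 1) hs
  have hd : ∀ v ∈ Ioi (0 : ℝ), HasDerivAt (laplaceKernel p q s)
      (-laplaceKernel p q s v + p * laplaceKernel (p - 1) q s v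
        + q * laplaceKernel p (q - 1) s v) v := by
    intro v hv
    have hv' : 0 < v := hv
    have h1 : HasDerivAt (fun t : ℝ => (t : ℂ) - 2 * Complex.I * s) 1 v := by
      simpa using (Complex.ofRealCLM.hasDerivAt (x := v)).sub_const (2 * Complex.I * s)
    have h2 := hasDerivAt_cpow_const_of_real (q : ℂ) h1 (base_ne s hv)
    have h3 : HasDerivAt (fun t : ℝ => Real.exp (-t) * t ^ p)
        (-Real.exp (-v) * v ^ p + Real.exp (-v) * (p * v ^ (p - 1))) v := by
      have := ((hasDerivAt_neg v).exp).mul (Real.hasDerivAt_rpow_const (p := p) (Or.inl hv'.ne'))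
      refine this.congr_deriv (by ring)
    refine (h3.ofReal_comp.mul h2).congr_deriv ?_
    simp only [laplaceKernel]
    push_cast
    ring
  have i3 : IntegrableOn (fun v => -laplaceKernel p q s v + p * laplaceKernel (p - 1) q s v
        + q * laplaceKernel p (q - 1) s v) (Ioi 0) :=
    (i0.neg.add (i1.const_mul _)).add (i2.const_mul _)
  have hc : ContinuousWithinAt (laplaceKernel p q s) (Ici 0) 0 := by
    refine ContinuousAt.continuousWithinAt ?_
    have h1 : (((0 : ℝ) : ℂ) - 2 * Complex.I * s) ∈ Complex.slitPlane := by
      right; simpa using hs.ne'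
    refine ContinuousAt.mul ?_ (ContinuousAt.cpow (by fun_prop) continuousAt_const h1)
    refine Complex.continuous_ofReal.continuousAt.comp ?_
    exact (by fun_prop : ContinuousAt (fun v : ℝ => Real.exp (-v)) 0).mul
      (Real.continuousAt_rpow_const _ _ (Or.inr hp.le))
  have key := integral_Ioi_of_hasDerivAt_of_tendsto hc hd i3
    (tendsto_zero_of_hasDerivAt_of_integrableOn_Ioi hd i3 i0)
  have h0 : laplaceKernel p q s 0 = 0 := by simp [laplaceKernel, Real.zero_rpow hp.ne']
  have hi : ∫ v in Ioi (0 : ℝ), (-laplaceKernel p q s v + p * laplaceKernel (p - 1) q s v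
        + q * laplaceKernel p (q - 1) s v)
      = -laplaceInt p q s + p * laplaceInt (p - 1) q s + q * laplaceInt p (q - 1) s := by
    unfold laplaceInt
    rw [← integral_neg, ← integral_const_mul, ← integral_const_mul]
    have e1 := integral_add i0.neg (i1.const_mul (p : ℂ))
    have e2 := integral_add (i0.neg.add (i1.const_mul (p : ℂ))) (i2.const_mul (q : ℂ))
    simp only [Pi.add_apply, Pi.neg_apply] at e1 e2
    rw [e2, e1]
  rw [hi, h0] at key
  linear_combination -key

/-! ### The outgoing solution for energy one -/

/-- The outgoing solution `e^{is} ∫₀^∞ e^{-v} (v (v - 2is))^b dv` of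
`F'' - (2b / s) F' + F = 0`. -/
noncomputable def outWave (b s : ℝ) : ℂ := Complex.exp (Complex.I * s) * laplaceInt b b s

/-- The derivative of `outWave`. -/
noncomputable def outWave' (b s : ℝ) : ℂ :=
  Complex.exp (Complex.I * s) * (Complex.I * laplaceInt b b s
    - 2 * Complex.I * b * laplaceInt b (b - 1) s)

lemma hasDerivAt_exp_I_mul (s : ℝ) :
    HasDerivAt (fun t : ℝ => Complex.exp (Complex.I * t))
      (Complex.I * Complex.exp (Complex.I * s)) s := by
  have := ((Complex.ofRealCLM.hasDerivAt (x := s)).const_mul Complex.I).cexp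
  refine this.congr_deriv ?_
  simp; ring

lemma hasDerivAt_outWave {b : ℝ} (hb : 0 ≤ b) {s : ℝ} (hs : 0 < s) :
    HasDerivAt (outWave b) (outWave' b s) s := by
  refine ((hasDerivAt_exp_I_mul s).mul (hasDerivAt_laplaceInt (p := b) (by linarith) b hs)).congr_deriv ?_
  simp only [outWave']; ring

/-- The contiguous relation that turns the second derivative of the Laplace-type integral into the
radial equation. -/
lemma laplaceInt_diag {b : ℝ} (hb : 0 ≤ b) {s : ℝ} (hs : 0 < s) :
    laplaceInt b b s - 2 * b * laplaceInt b (b - 1) s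
      = 2 * Complex.I * s * ((b - 1) * laplaceInt b (b - 2) s - laplaceInt b (b - 1) s) := by
  have e1 := laplaceInt_add_one (p := b) (by linarith) (b - 1) hs
  have e2 := laplaceInt_parts (p := b + 1) (by linarith) (b - 1) hs
  have e3 := laplaceInt_add_one (p := b) (by linarith) (b - 2) hs
  rw [show b - 1 + 1 = b by ring] at e1
  rw [show b + 1 - 1 = b by ring, show b - 1 - 1 = b - 2 by ring] at e2
  rw [show b - 2 + 1 = b - 1 by ring] at e3
  push_cast at e2
  linear_combination -e1 + e2 + (b - 1) * e3

lemma hasDerivAt_outWave' {b : ℝ} (hb : 0 ≤ b) {s : ℝ} (hs : 0 < s) :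
    HasDerivAt (outWave' b) ((2 * b / s : ℝ) * outWave' b s - outWave b s) s := by
  have hb' : -1 < b := by linarith
  have h := (hasDerivAt_exp_I_mul s).mul (((hasDerivAt_laplaceInt hb' b hs).const_mul Complex.I).sub
    ((hasDerivAt_laplaceInt hb' (b - 1) hs).const_mul (2 * Complex.I * b)))
  refine h.congr_deriv ?_
  simp only [Pi.sub_apply]
  have key := laplaceInt_diag hb hs
  have hs' : (s : ℂ) ≠ 0 := by exact_mod_cast hs.ne'
  rw [show b - 1 - 1 = b - 2 by ring]
  simp only [outWave', outWave]
  have e : laplaceInt b b s = 2 * b * laplaceInt b (b - 1) s + 2 * Complex.I * s * ((b - 1) * laplaceInt b (b - 2) s - laplaceInt b (b - 1) s) := by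
    linear_combination key
  rw [e]
  push_cast
  field_simp
  ring_nf
  simp only [Complex.I_sq, show Complex.I ^ 3 = -Complex.I by rw [pow_succ, Complex.I_sq]; ring]
  ring

/-- The derivative of the outgoing solution with its leading behaviour `s^{2b}` at the singularity
made visible: the remaining integral diverges only like `s^{2b-1}`. -/
lemma outWave'_eq {b : ℝ} (hb : 0 < b) {s : ℝ} (hs : 0 < s) :
    outWave' b s = Complex.exp (Complex.I * s) * (2 * b * s * laplaceInt (b - 1) (b - 1) s) := by
  have key := laplaceInt_diag hb.le hs
  have e := laplaceInt_parts hb (b - 1) hs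
  rw [show b - 1 - 1 = b - 2 by ring] at e
  push_cast at e
  rw [outWave']
  linear_combination (Complex.exp (Complex.I * s)) * Complex.I * key
    - Complex.exp (Complex.I * s) * 2 * Complex.I ^ 2 * s * e
    - Complex.exp (Complex.I * s) * 2 * s * (b * laplaceInt (b - 1) (b - 1) s) * Complex.I_sq

/-! ### Gamma integrals with a complex rate -/

lemma norm_rpow_mul_cexp {a : ℝ} (r : ℂ) {t : ℝ} (ht : 0 < t) :
    ‖((t ^ a : ℝ) : ℂ) * Complex.exp (-r * t)‖ = t ^ a * Real.exp (-r.re * t) := by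
  rw [norm_mul, Complex.norm_real, Complex.norm_exp, Real.norm_eq_abs,
    abs_of_pos (Real.rpow_pos_of_pos ht a)]
  simp

lemma continuousOn_rpow_mul_cexp (a : ℝ) (r : ℂ) :
    ContinuousOn (fun t : ℝ => ((t ^ a : ℝ) : ℂ) * Complex.exp (-r * t)) (Ioi 0) := by
  refine ContinuousOn.mul (Complex.continuous_ofReal.comp_continuousOn ?_) (by fun_prop)
  exact continuousOn_id.rpow_const fun x hx => Or.inl (ne_of_gt hx)

lemma integrableOn_rpow_mul_exp {a r : ℝ} (ha : -1 < a) (hr : 0 < r) :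
    IntegrableOn (fun t : ℝ => t ^ a * Real.exp (-r * t)) (Ioi 0) := by
  have := integrableOn_rpow_mul_exp_neg_mul_rpow (p := 1) ha one_pos hr
  simpa using this

lemma integrableOn_rpow_mul_cexp {a : ℝ} {r : ℂ} (ha : -1 < a) (hr : 0 < r.re) :
    IntegrableOn (fun t : ℝ => ((t ^ a : ℝ) : ℂ) * Complex.exp (-r * t)) (Ioi 0) := by
  refine Integrable.mono' (integrableOn_rpow_mul_exp ha hr)
    ((continuousOn_rpow_mul_cexp a r).aestronglyMeasurable measurableSet_Ioi)
    ((ae_restrict_iff' measurableSet_Ioi).2 (Eventually.of_forall fun v hv => ?_))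
  rw [norm_rpow_mul_cexp r hv]

lemma hasDerivAt_rpow_mul_cexp {a : ℝ} (ha : 0 < a) {r : ℂ} (hr : 0 < r.re) :
    HasDerivAt (fun z : ℂ => ∫ t in Ioi (0 : ℝ), ((t ^ (a - 1) : ℝ) : ℂ) * Complex.exp (-z * t))
      (-∫ t in Ioi (0 : ℝ), ((t ^ a : ℝ) : ℂ) * Complex.exp (-r * t)) r := by
  have hmem : {z : ℂ | r.re / 2 < z.re} ∈ 𝓝 r :=
    (isOpen_lt continuous_const Complex.continuous_re).mem_nhds (by simp; linarith)
  have key := (hasDerivAt_integral_of_dominated_loc_of_deriv_le (μ := volume.restrict (Ioi (0:ℝ)))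
    (F := fun (z : ℂ) (t : ℝ) => ((t ^ (a - 1) : ℝ) : ℂ) * Complex.exp (-z * t))
    (F' := fun z t => -(((t ^ a : ℝ) : ℂ) * Complex.exp (-z * t)))
    (bound := fun t => t ^ a * Real.exp (-(r.re / 2) * t))
    hmem
    (Eventually.of_forall fun z =>
      (continuousOn_rpow_mul_cexp _ z).aestronglyMeasurable measurableSet_Ioi)
    (integrableOn_rpow_mul_cexp (by linarith) hr)
    ((continuousOn_rpow_mul_cexp _ r).aestronglyMeasurable measurableSet_Ioi).neg
    ((ae_restrict_iff' measurableSet_Ioi).2 (Eventually.of_forall fun v hv t ht => ?_))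
    (integrableOn_rpow_mul_exp (by linarith) (by linarith))
    ((ae_restrict_iff' measurableSet_Ioi).2 (Eventually.of_forall fun v hv t ht => ?_))).2
  · rw [integral_neg] at key
    exact key
  · have hv' : (0 : ℝ) < v := hv
    have ht' : r.re / 2 < t.re := ht
    rw [norm_neg, norm_rpow_mul_cexp t hv]
    gcongr
  · have hv' : (0 : ℝ) < v := hv
    have h1 : HasDerivAt (fun z : ℂ => -z * (v : ℂ)) (-1 * v) t :=
      (hasDerivAt_neg t).mul_const (v : ℂ)
    refine (h1.cexp.const_mul _).congr_deriv ?_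
    have : v ^ a = v ^ (a - 1) * v := by
      rw [← Real.rpow_add_one hv'.ne', sub_add_cancel]
    rw [this]; push_cast; ring

lemma mul_integral_rpow_mul_cexp {a : ℝ} (ha : 0 < a) {r : ℂ} (hr : 0 < r.re) :
    r * ∫ t in Ioi (0 : ℝ), ((t ^ a : ℝ) : ℂ) * Complex.exp (-r * t)
      = a * ∫ t in Ioi (0 : ℝ), ((t ^ (a - 1) : ℝ) : ℂ) * Complex.exp (-r * t) := by
  have i0 := integrableOn_rpow_mul_cexp (a := a) (by linarith) hr
  have i1 := integrableOn_rpow_mul_cexp (a := a - 1) (by linarith) hr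
  have hd : ∀ v ∈ Ioi (0 : ℝ),
      HasDerivAt (fun t : ℝ => ((t ^ a : ℝ) : ℂ) * Complex.exp (-r * t))
      (a * (((v ^ (a - 1) : ℝ) : ℂ) * Complex.exp (-r * v))
        - r * (((v ^ a : ℝ) : ℂ) * Complex.exp (-r * v))) v := by
    intro v hv
    have h1 : HasDerivAt (fun t : ℝ => -r * (t : ℂ)) (-r) v := by
      simpa using (Complex.ofRealCLM.hasDerivAt (x := v)).const_mul (-r)
    have h3 := (Real.hasDerivAt_rpow_const (p := a) (Or.inl (ne_of_gt hv))).ofReal_comp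
    refine (h3.mul h1.cexp).congr_deriv ?_
    push_cast; ring
  have i3 := (i1.const_mul (a : ℂ)).sub (i0.const_mul r)
  have hc : ContinuousWithinAt (fun t : ℝ => ((t ^ a : ℝ) : ℂ) * Complex.exp (-r * t))
      (Ici 0) 0 := by
    refine ContinuousAt.continuousWithinAt ?_
    refine ContinuousAt.mul ?_ (by fun_prop)
    exact Complex.continuous_ofReal.continuousAt.comp
      (Real.continuousAt_rpow_const _ _ (Or.inr ha.le))
  have key := integral_Ioi_of_hasDerivAt_of_tendsto hc hd i3
    (tendsto_zero_of_hasDerivAt_of_integrableOn_Ioi hd i3 i0)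
  rw [integral_sub (i1.const_mul (a : ℂ)) (i0.const_mul r), integral_const_mul,
    integral_const_mul, Real.zero_rpow ha.ne'] at key
  simp only [Complex.ofReal_zero, zero_mul, sub_zero] at key
  linear_combination -key

/-- Euler's integral for the Gamma function with a complex rate `r`: both sides satisfy
`r G'(r) = -a G(r)` on the right half-plane, and they agree at `r = 1`. -/
theorem integral_rpow_mul_cexp {a : ℝ} (ha : 0 < a) {r : ℂ} (hr : 0 < r.re) :
    ∫ t in Ioi (0 : ℝ), ((t ^ (a - 1) : ℝ) : ℂ) * Complex.exp (-r * t)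
      = r ^ (-a : ℂ) * Real.Gamma a := by
  set G : ℂ → ℂ := fun z => ∫ t in Ioi (0 : ℝ), ((t ^ (a - 1) : ℝ) : ℂ) * Complex.exp (-z * t)
    with hG
  set U : Set ℂ := {z | 0 < z.re} with hU
  have hUo : IsOpen U := isOpen_lt continuous_const Complex.continuous_re
  have hUc : Convex ℝ U := convex_halfSpace_re_gt 0
  have hd : ∀ z ∈ U, HasDerivAt (fun z => z ^ (a : ℂ) * G z) 0 z := by
    intro z hz
    have hz0 : z ≠ 0 := by rintro rfl; simp [hU] at hz
    have h1 := (hasDerivAt_id z).cpow_const (c := (a : ℂ)) (Or.inl hz)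
    refine (h1.mul (hasDerivAt_rpow_mul_cexp ha hz)).congr_deriv ?_
    have h2 := mul_integral_rpow_mul_cexp ha hz
    have h3 : z ^ (a : ℂ) = z ^ ((a : ℂ) - 1) * z := by
      nth_rewrite 3 [← Complex.cpow_one z]
      rw [← Complex.cpow_add _ _ hz0]
      simp
    simp only [id]
    rw [h3]
    linear_combination -(z ^ ((a : ℂ) - 1)) * h2
  have hconst := hUo.is_const_of_deriv_eq_zero hUc.isPreconnected
    (fun z hz => (hd z hz).differentiableAt.differentiableWithinAt)
    (fun z hz => (hd z hz).deriv) (x := r) (y := 1) hr (by simp [hU])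
  have h1 : G 1 = Real.Gamma a := by
    have : ∫ t in Ioi (0 : ℝ), ((t ^ (a - 1) : ℝ) : ℂ) * Complex.exp (-1 * t)
        = ∫ t in Ioi (0 : ℝ), ((Real.exp (-t) * t ^ (a - 1) : ℝ) : ℂ) :=
      integral_congr_ae (Eventually.of_forall fun t => by simp [mul_comm])
    simp only [hG]
    rw [this, integral_complex_ofReal, ← Real.Gamma_eq_integral ha]
  have hr0 : r ≠ 0 := by rintro rfl; simp at hr
  simp only [Complex.one_cpow, one_mul, h1] at hconst
  rw [← hconst, ← mul_assoc, ← Complex.cpow_add _ _ hr0, neg_add_cancel, Complex.cpow_zero,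
    one_mul]

/-- The Beta integral `∫₀^∞ w^{p-1} (w + c)^{p-1} dw` for `Re c > 0`, from Fubini's theorem for
`w^{p-1} t^{-p} e^{-t(w+c)}`. -/
lemma integral_rpow_mul_cpow_of_re_pos {p : ℝ} (hp : 0 < p) (hp2 : p < 1 / 2) {c : ℂ}
    (hc : 0 < c.re) :
    ∫ w in Ioi (0 : ℝ), ((w ^ (p - 1) : ℝ) : ℂ) * ((w : ℂ) + c) ^ ((p - 1 : ℝ) : ℂ)
      = Real.Gamma p * Real.Gamma (1 - 2 * p) / Real.Gamma (1 - p) * c ^ ((2 * p - 1 : ℝ) : ℂ) := by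
  set μ : Measure ℝ := volume.restrict (Ioi (0 : ℝ)) with hμ
  set f : ℝ → ℝ → ℂ := fun t w =>
    ((t ^ (-p) : ℝ) : ℂ) * Complex.exp (-c * t) *
      (((w ^ (p - 1) : ℝ) : ℂ) * Complex.exp (-(t : ℂ) * w)) with hf
  have hgp : 0 < Real.Gamma p := Real.Gamma_pos_of_pos hp
  have hg1p : 0 < Real.Gamma (1 - p) := Real.Gamma_pos_of_pos (by linarith)
  have hmeas : AEStronglyMeasurable (Function.uncurry f) (μ.prod μ) := by
    rw [hμ, Measure.prod_restrict]
    refine ContinuousOn.aestronglyMeasurable ?_ (measurableSet_Ioi.prod measurableSet_Ioi)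
    have c1 := (continuousOn_rpow_mul_cexp (-p) c).comp (continuousOn_fst (s := Ioi (0:ℝ) ×ˢ Ioi (0:ℝ)))
      (fun x hx => hx.1)
    have c2 : ContinuousOn (fun x : ℝ × ℝ => ((x.2 ^ (p - 1) : ℝ) : ℂ)) (Ioi (0:ℝ) ×ˢ Ioi (0:ℝ)) :=
      Complex.continuous_ofReal.comp_continuousOn
        (continuousOn_snd.rpow_const fun x hx => Or.inl (ne_of_gt hx.2))
    exact c1.mul (c2.mul (by fun_prop))
  have hinner : ∀ t ∈ Ioi (0 : ℝ), ∫ w, f t w ∂μ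
      = ((t ^ ((1 - 2 * p) - 1) : ℝ) : ℂ) * Complex.exp (-c * t) * Real.Gamma p := by
    intro t ht
    have ht' : 0 < t := ht
    simp only [hf]
    rw [integral_const_mul, integral_rpow_mul_cexp hp (r := (t : ℂ)) (by simpa using ht')]
    have : ((t : ℂ) ^ (-p : ℂ)) = ((t ^ (-p) : ℝ) : ℂ) := by
      rw [Complex.ofReal_cpow ht'.le]; simp
    rw [this, show (1 - 2 * p) - 1 = -p + -p by ring, Real.rpow_add ht']
    push_cast; ring
  have hnorm : ∀ t ∈ Ioi (0 : ℝ), ∫ w, ‖f t w‖ ∂μ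
      = t ^ ((1 - 2 * p) - 1) * Real.exp (-c.re * t) * Real.Gamma p := by
    intro t ht
    have ht' : 0 < t := ht
    have : ∫ w, ‖f t w‖ ∂μ = ∫ w in Ioi (0 : ℝ), t ^ (-p) * Real.exp (-c.re * t) *
        (w ^ (p - 1) * Real.exp (-(t * w))) := by
      refine setIntegral_congr_fun measurableSet_Ioi fun w hw => ?_
      simp only [hf]
      rw [norm_mul, norm_rpow_mul_cexp c ht, norm_rpow_mul_cexp _ hw]
      simp
    rw [this, integral_const_mul, Real.integral_rpow_mul_exp_neg_mul_Ioi hp ht',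
      show (1 - 2 * p) - 1 = -p + -p by ring, Real.rpow_add ht', one_div,
      Real.inv_rpow ht'.le, Real.rpow_neg ht'.le]
    ring
  have hint : Integrable (Function.uncurry f) (μ.prod μ) := by
    rw [integrable_prod_iff hmeas]
    constructor
    · refine (ae_restrict_iff' measurableSet_Ioi).2 (Eventually.of_forall fun t ht => ?_)
      exact (integrableOn_rpow_mul_cexp (a := p - 1) (r := (t : ℂ)) (by linarith)
        (by simpa using ht)).const_mul (((t ^ (-p) : ℝ) : ℂ) * Complex.exp (-c * t))
    · refine IntegrableOn.congr_fun (f := fun t : ℝ => t ^ ((1 - 2 * p) - 1) *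
        Real.exp (-c.re * t) * Real.Gamma p) ?_ (fun t ht => (hnorm t ht).symm) measurableSet_Ioi
      exact (integrableOn_rpow_mul_exp (by linarith) hc).mul_const _
  have hswap := integral_integral_swap hint
  have hL : ∫ t, ∫ w, f t w ∂μ ∂μ
      = c ^ ((2 * p - 1 : ℝ) : ℂ) * Real.Gamma (1 - 2 * p) * Real.Gamma p := by
    rw [setIntegral_congr_fun measurableSet_Ioi hinner, integral_mul_const,
      integral_rpow_mul_cexp (by linarith) hc]
    congr 3
    push_cast; ring
  have hR : ∫ w, ∫ t, f t w ∂μ ∂μ = Real.Gamma (1 - p) *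
      ∫ w in Ioi (0 : ℝ), ((w ^ (p - 1) : ℝ) : ℂ) * ((w : ℂ) + c) ^ ((p - 1 : ℝ) : ℂ) := by
    rw [← integral_const_mul]
    refine setIntegral_congr_fun measurableSet_Ioi fun w hw => ?_
    have hw' : 0 < w := hw
    have h1 := integral_rpow_mul_cexp (a := 1 - p) (r := (w : ℂ) + c) (by linarith)
      (by simp; linarith)
    have h2 : ∫ t, f t w ∂μ = ((w ^ (p - 1) : ℝ) : ℂ) * ∫ t in Ioi (0 : ℝ),
        ((t ^ (1 - p - 1) : ℝ) : ℂ) * Complex.exp (-((w : ℂ) + c) * t) := by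
      rw [← integral_const_mul]
      refine integral_congr_ae (Eventually.of_forall fun t => ?_)
      simp only [hf]
      rw [show 1 - p - 1 = -p by ring, show -((w : ℂ) + c) * t = -c * t + -(t : ℂ) * w by ring,
        Complex.exp_add]
      ring
    rw [h2, h1, show (-((1 - p : ℝ) : ℂ)) = ((p - 1 : ℝ) : ℂ) by push_cast; ring]
    ring
  rw [hL, hR] at hswap
  have : (Real.Gamma (1 - p) : ℂ) ≠ 0 := by exact_mod_cast hg1p.ne'
  rw [div_mul_eq_mul_div, eq_div_iff this]
  linear_combination -hswap

/-! ### Behaviour of the outgoing solution at infinity and at the singularity -/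

lemma ofReal_mul_cpow {s : ℝ} (hs : 0 < s) {z : ℂ} (hz : z ≠ 0) (q : ℝ) :
    ((s : ℂ) * z) ^ (q : ℂ) = ((s ^ q : ℝ) : ℂ) * z ^ (q : ℂ) := by
  have hs' : (s : ℂ) ≠ 0 := by exact_mod_cast hs.ne'
  rw [Complex.cpow_def_of_ne_zero (mul_ne_zero hs' hz), Complex.cpow_def_of_ne_zero hz,
    Complex.log_ofReal_mul hs hz, Complex.ofReal_cpow hs.le, Complex.cpow_def_of_ne_zero hs',
    ← Complex.exp_add, Complex.ofReal_log hs.le]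
  congr 1; ring

lemma integral_exp_neg_mul_rpow {b : ℝ} (hb : -1 < b) :
    ∫ v in Ioi (0 : ℝ), Real.exp (-v) * v ^ b = Real.Gamma (b + 1) := by
  rw [Real.Gamma_eq_integral (by linarith)]; simp

lemma neg_two_I_mem_slitPlane : (-2 * Complex.I : ℂ) ∈ Complex.slitPlane := by
  right; simp

lemma tendsto_laplaceInt_atTop {b : ℝ} (hb : 0 ≤ b) :
    Tendsto (fun s : ℝ => ((s ^ (-b) : ℝ) : ℂ) * laplaceInt b b s) atTop
      (𝓝 (Real.Gamma (b + 1) * (-2 * Complex.I) ^ (b : ℂ))) := by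
  have key : Tendsto (fun s : ℝ => ∫ v in Ioi (0 : ℝ), ((s ^ (-b) : ℝ) : ℂ) * laplaceKernel b b s v)
      atTop (𝓝 (∫ v in Ioi (0 : ℝ), ((Real.exp (-v) * v ^ b : ℝ) : ℂ)
        * (-2 * Complex.I) ^ (b : ℂ))) := by
    refine tendsto_integral_filter_of_dominated_convergence
      (fun v => Real.exp (-v) * v ^ b * ((2 ^ b + (2 * 2) ^ |b|) + 2 ^ |b| * v ^ |b|))
      (Eventually.of_forall fun s => ((continuousOn_laplaceKernel b b s).aestronglyMeasurable
        measurableSet_Ioi).const_mul _) ?_ (integrableOn_exp_neg_mul_rpow_bound (by linarith) _ _ b)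
      ((ae_restrict_iff' measurableSet_Ioi).2 (Eventually.of_forall fun v hv => ?_))
    · filter_upwards [eventually_ge_atTop 1] with s hs
      refine (ae_restrict_iff' measurableSet_Ioi).2 (Eventually.of_forall fun v hv => ?_)
      have hv' : 0 < v := hv
      have hs0 : 0 < s := by linarith
      rw [norm_mul, norm_laplaceKernel hv, Complex.norm_real, Real.norm_eq_abs,
        abs_of_nonneg (by positivity)]
      have h1 : s ^ (-b) * ‖(v : ℂ) - 2 * Complex.I * s‖ ^ b
          = (s⁻¹ * ‖(v : ℂ) - 2 * Complex.I * s‖) ^ b := by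
        rw [Real.mul_rpow (by positivity) (by positivity), Real.rpow_neg hs0.le, Real.inv_rpow hs0.le]
      have h2 := rpow_le_of_between (l := 2) (c := 2) (v := v)
        (x := s⁻¹ * ‖(v : ℂ) - 2 * Complex.I * s‖) (q := b) (by norm_num) (by norm_num) hv'.le
        (by rw [inv_mul_eq_div, le_div_iff₀ hs0]; exact base_norm_ge hs0.le)
        (by
          rw [inv_mul_eq_div, div_le_iff₀ hs0]
          refine (base_norm_le hv'.le hs0.le).trans ?_
          nlinarith)
      calc s ^ (-b) * (Real.exp (-v) * v ^ b * ‖(v : ℂ) - 2 * Complex.I * s‖ ^ b)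
          = Real.exp (-v) * v ^ b * (s ^ (-b) * ‖(v : ℂ) - 2 * Complex.I * s‖ ^ b) := by ring
        _ ≤ _ := by rw [h1]; exact mul_le_mul_of_nonneg_left h2 (by positivity)
    · have hlim : Tendsto (fun s : ℝ => ((v / s : ℝ) : ℂ) - 2 * Complex.I) atTop
          (𝓝 (-2 * Complex.I)) := by
        have h0 : Tendsto (fun s : ℝ => v / s) atTop (𝓝 0) := tendsto_const_nhds.div_atTop tendsto_id
        have := (Complex.continuous_ofReal.tendsto 0).comp h0
        simpa using this.sub_const (2 * Complex.I)
      have h1 := (hlim.cpow (tendsto_const_nhds (x := (b : ℂ))) neg_two_I_mem_slitPlane).const_mul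
        ((Real.exp (-v) * v ^ b : ℝ) : ℂ)
      refine h1.congr' ?_
      filter_upwards [eventually_gt_atTop 0] with s hs
      have hz : ((v / s : ℝ) : ℂ) - 2 * Complex.I ≠ 0 := by
        intro h
        have := congrArg Complex.im h
        simp at this
      have hs' : (s : ℂ) ≠ 0 := by exact_mod_cast hs.ne'
      have h2 : (v : ℂ) - 2 * Complex.I * s = (s : ℂ) * (((v / s : ℝ) : ℂ) - 2 * Complex.I) := by
        push_cast; field_simp
      have h3 : ((s ^ (-b) : ℝ) : ℂ) * ((s ^ b : ℝ) : ℂ) = 1 := by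
        rw [← Complex.ofReal_mul, ← Real.rpow_add hs]; simp
      rw [laplaceKernel, h2, ofReal_mul_cpow hs hz]
      linear_combination -(((Real.exp (-v) * v ^ b : ℝ) : ℂ) *
        (((v / s : ℝ) : ℂ) - 2 * Complex.I) ^ (b : ℂ)) * h3
  rw [integral_mul_const, integral_complex_ofReal, integral_exp_neg_mul_rpow (by linarith)] at key
  simpa only [integral_const_mul, laplaceInt] using key

lemma tendsto_laplaceInt_zero {b : ℝ} (hb : 0 ≤ b) :
    Tendsto (laplaceInt b b) (𝓝[>] 0) (𝓝 (Real.Gamma (2 * b + 1))) := by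
  have key : Tendsto (fun s : ℝ => ∫ v in Ioi (0 : ℝ), laplaceKernel b b s v)
      (𝓝[>] 0) (𝓝 (∫ v in Ioi (0 : ℝ), ((Real.exp (-v) * v ^ (2 * b) : ℝ) : ℂ))) := by
    refine tendsto_integral_filter_of_dominated_convergence
      (fun v => Real.exp (-v) * v ^ b * ((2 ^ b + (2 * 2) ^ |b|) + 2 ^ |b| * v ^ |b|))
      (Eventually.of_forall fun s => ((continuousOn_laplaceKernel b b s).aestronglyMeasurable
        measurableSet_Ioi)) ?_ (integrableOn_exp_neg_mul_rpow_bound (by linarith) _ _ b)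
      ((ae_restrict_iff' measurableSet_Ioi).2 (Eventually.of_forall fun v hv => ?_))
    · filter_upwards [Ioo_mem_nhdsGT (one_pos : (0 : ℝ) < 1)] with s hs
      refine (ae_restrict_iff' measurableSet_Ioi).2 (Eventually.of_forall fun v hv => ?_)
      have hv' : 0 < v := hv
      rw [norm_laplaceKernel hv]
      refine mul_le_mul_of_nonneg_left ?_ (by positivity)
      refine (Real.rpow_le_rpow (norm_nonneg _) ((base_norm_le hv'.le hs.1.le).trans
        (by linarith [hs.2] : _ ≤ v + 2)) hb).trans ?_
      exact rpow_le_of_between (by norm_num) (by norm_num) hv'.le (by linarith) le_rfl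
    · have hv' : 0 < v := hv
      have hlim : Tendsto (fun s : ℝ => (v : ℂ) - 2 * Complex.I * s) (𝓝[>] 0) (𝓝 (v : ℂ)) := by
        have : Continuous (fun s : ℝ => (v : ℂ) - 2 * Complex.I * s) := by fun_prop
        simpa using (this.tendsto 0).mono_left nhdsWithin_le_nhds
      have h1 := (hlim.cpow (tendsto_const_nhds (x := (b : ℂ)))
        (Or.inl (by simpa using hv'))).const_mul ((Real.exp (-v) * v ^ b : ℝ) : ℂ)
      have h2 : ((Real.exp (-v) * v ^ (2 * b) : ℝ) : ℂ)
          = ((Real.exp (-v) * v ^ b : ℝ) : ℂ) * (v : ℂ) ^ (b : ℂ) := by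
        rw [two_mul, Real.rpow_add hv', ← Complex.ofReal_cpow hv'.le]
        push_cast; ring
      rw [h2]
      exact h1
  rw [integral_complex_ofReal, integral_exp_neg_mul_rpow (by linarith)] at key
  exact key

lemma norm_shift_ge {w ε : ℝ} (hw : 0 < w) (hε : 0 ≤ ε) :
    max w 1 ≤ ‖(w : ℂ) + (ε - 2 * Complex.I)‖ := by
  have h1 := Complex.abs_im_le_norm ((w : ℂ) + (ε - 2 * Complex.I))
  have h2 := Complex.abs_re_le_norm ((w : ℂ) + (ε - 2 * Complex.I))
  simp at h1 h2
  rw [abs_of_nonneg (by linarith)] at h2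
  exact max_le (by linarith) (by linarith)

lemma integrableOn_rpow_mul_max {p : ℝ} (hp : 0 < p) (hp2 : p < 1 / 2) :
    IntegrableOn (fun w : ℝ => w ^ (p - 1) * max w 1 ^ (p - 1)) (Ioi 0) := by
  rw [← Ioc_union_Ioi_eq_Ioi (zero_le_one (α := ℝ)), integrableOn_union]
  constructor
  · have h := (intervalIntegral.intervalIntegrable_rpow' (a := 0) (b := 1) (r := p - 1)
      (by linarith))
    rw [intervalIntegrable_iff_integrableOn_Ioc_of_le zero_le_one] at h
    refine h.congr_fun (fun w hw => ?_) measurableSet_Ioc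
    simp [max_eq_right hw.2]
  · refine (integrableOn_Ioi_rpow_of_lt (a := 2 * p - 2) (by linarith) one_pos).congr_fun
      (fun w hw => ?_) measurableSet_Ioi
    have hw' : (1 : ℝ) < w := hw
    simp only [max_eq_left hw'.le]
    rw [← Real.rpow_add (by linarith)]
    congr 1; ring

lemma norm_betaKernel_le {p w ε : ℝ} (hp2 : p < 1 / 2) (hw : 0 < w) (hε : 0 ≤ ε) :
    ‖((w ^ (p - 1) : ℝ) : ℂ) * ((w : ℂ) + (ε - 2 * Complex.I)) ^ ((p - 1 : ℝ) : ℂ)‖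
      ≤ w ^ (p - 1) * max w 1 ^ (p - 1) := by
  rw [norm_mul, Complex.norm_cpow_real, Complex.norm_real, Real.norm_eq_abs,
    abs_of_pos (Real.rpow_pos_of_pos hw _)]
  refine mul_le_mul_of_nonneg_left ?_ (by positivity)
  exact Real.rpow_le_rpow_of_nonpos (by positivity) (norm_shift_ge hw hε) (by linarith)

lemma shift_mem_slitPlane {w : ℝ} (ε : ℝ) (hε : 0 ≤ ε) (hw : 0 < w) :
    (w : ℂ) + (ε - 2 * Complex.I) ∈ Complex.slitPlane := by
  left; simp; linarith

lemma continuousOn_betaKernel (p : ℝ) {ε : ℝ} (hε : 0 ≤ ε) :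
    ContinuousOn (fun w : ℝ => ((w ^ (p - 1) : ℝ) : ℂ) *
      ((w : ℂ) + (ε - 2 * Complex.I)) ^ ((p - 1 : ℝ) : ℂ)) (Ioi 0) := by
  refine ContinuousOn.mul (Complex.continuous_ofReal.comp_continuousOn ?_)
    (ContinuousOn.cpow_const (by fun_prop) fun w hw => shift_mem_slitPlane ε hε hw)
  exact continuousOn_id.rpow_const fun x hx => Or.inl (ne_of_gt hx)

/-- The Beta integral at the boundary point `c = -2i` of the right half-plane, as a limit from
inside. -/
lemma integral_rpow_mul_cpow_neg_two_I {p : ℝ} (hp : 0 < p) (hp2 : p < 1 / 2) :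
    ∫ w in Ioi (0 : ℝ), ((w ^ (p - 1) : ℝ) : ℂ) * ((w : ℂ) - 2 * Complex.I) ^ ((p - 1 : ℝ) : ℂ)
      = Real.Gamma p * Real.Gamma (1 - 2 * p) / Real.Gamma (1 - p)
        * (-2 * Complex.I) ^ ((2 * p - 1 : ℝ) : ℂ) := by
  have key : Tendsto (fun ε : ℝ => ∫ w in Ioi (0 : ℝ), ((w ^ (p - 1) : ℝ) : ℂ) *
      ((w : ℂ) + (ε - 2 * Complex.I)) ^ ((p - 1 : ℝ) : ℂ)) (𝓝[>] 0)
      (𝓝 (∫ w in Ioi (0 : ℝ), ((w ^ (p - 1) : ℝ) : ℂ) *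
        ((w : ℂ) - 2 * Complex.I) ^ ((p - 1 : ℝ) : ℂ))) := by
    refine tendsto_integral_filter_of_dominated_convergence
      (fun w => w ^ (p - 1) * max w 1 ^ (p - 1)) ?_ ?_ (integrableOn_rpow_mul_max hp hp2)
      ((ae_restrict_iff' measurableSet_Ioi).2 (Eventually.of_forall fun v hv => ?_))
    · filter_upwards [self_mem_nhdsWithin] with ε hε
      exact (continuousOn_betaKernel p (le_of_lt hε)).aestronglyMeasurable measurableSet_Ioi
    · filter_upwards [self_mem_nhdsWithin] with ε hε
      exact (ae_restrict_iff' measurableSet_Ioi).2 (Eventually.of_forall fun w hw =>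
        norm_betaKernel_le hp2 hw (le_of_lt hε))
    · have hlim : Tendsto (fun ε : ℝ => (v : ℂ) + (ε - 2 * Complex.I)) (𝓝[>] 0)
          (𝓝 ((v : ℂ) - 2 * Complex.I)) := by
        have : Continuous (fun ε : ℝ => (v : ℂ) + (ε - 2 * Complex.I)) := by fun_prop
        simpa [sub_eq_add_neg] using (this.tendsto 0).mono_left nhdsWithin_le_nhds
      exact (hlim.cpow (tendsto_const_nhds (x := ((p - 1 : ℝ) : ℂ)))
        (by simpa [sub_eq_add_neg] using shift_mem_slitPlane 0 le_rfl hv)).const_mul _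
  have key2 : Tendsto (fun ε : ℝ => (Real.Gamma p * Real.Gamma (1 - 2 * p) / Real.Gamma (1 - p) : ℂ)
      * ((ε : ℂ) - 2 * Complex.I) ^ ((2 * p - 1 : ℝ) : ℂ)) (𝓝[>] 0)
      (𝓝 (Real.Gamma p * Real.Gamma (1 - 2 * p) / Real.Gamma (1 - p)
        * (-2 * Complex.I) ^ ((2 * p - 1 : ℝ) : ℂ))) := by
    have hlim : Tendsto (fun ε : ℝ => (ε : ℂ) - 2 * Complex.I) (𝓝[>] 0)
          (𝓝 (-2 * Complex.I)) := by
      have : Continuous (fun ε : ℝ => (ε : ℂ) - 2 * Complex.I) := by fun_prop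
      simpa using (this.tendsto 0).mono_left nhdsWithin_le_nhds
    exact (hlim.cpow tendsto_const_nhds neg_two_I_mem_slitPlane).const_mul _
  refine tendsto_nhds_unique key (key2.congr' ?_)
  filter_upwards [self_mem_nhdsWithin] with ε hε
  exact (integral_rpow_mul_cpow_of_re_pos hp hp2 (by simpa using hε)).symm

/-- After the substitution `v = s w` the integral tends to the Beta integral at `-2i`. -/
lemma tendsto_laplaceInt_sub_one {b : ℝ} (hb : 0 < b) (hb2 : b < 1 / 2) :
    Tendsto (fun s : ℝ => ((s ^ (1 - 2 * b) : ℝ) : ℂ) * laplaceInt (b - 1) (b - 1) s) (𝓝[>] 0)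
      (𝓝 (Real.Gamma b * Real.Gamma (1 - 2 * b) / Real.Gamma (1 - b)
        * (-2 * Complex.I) ^ ((2 * b - 1 : ℝ) : ℂ))) := by
  rw [← integral_rpow_mul_cpow_neg_two_I hb hb2]
  have key : Tendsto (fun s : ℝ => ∫ w in Ioi (0 : ℝ), ((Real.exp (-(s * w)) : ℝ) : ℂ) *
      (((w ^ (b - 1) : ℝ) : ℂ) * ((w : ℂ) - 2 * Complex.I) ^ ((b - 1 : ℝ) : ℂ))) (𝓝[>] 0)
      (𝓝 (∫ w in Ioi (0 : ℝ), ((w ^ (b - 1) : ℝ) : ℂ) *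
        ((w : ℂ) - 2 * Complex.I) ^ ((b - 1 : ℝ) : ℂ))) := by
    have hcont := continuousOn_betaKernel b (ε := 0) le_rfl
    simp only [Complex.ofReal_zero, zero_sub, ← sub_eq_add_neg] at hcont
    refine tendsto_integral_filter_of_dominated_convergence
      (fun w => w ^ (b - 1) * max w 1 ^ (b - 1)) ?_ ?_ (integrableOn_rpow_mul_max hb hb2)
      ((ae_restrict_iff' measurableSet_Ioi).2 (Eventually.of_forall fun v hv => ?_))
    · exact Eventually.of_forall fun s =>
        (ContinuousOn.mul (by fun_prop) hcont).aestronglyMeasurable measurableSet_Ioi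
    · filter_upwards [self_mem_nhdsWithin] with s hs
      refine (ae_restrict_iff' measurableSet_Ioi).2 (Eventually.of_forall fun w hw => ?_)
      have hs' : 0 < s := hs
      have hw' : 0 < w := hw
      have h1 := norm_betaKernel_le (ε := 0) hb2 hw le_rfl
      simp only [Complex.ofReal_zero, zero_sub, ← sub_eq_add_neg] at h1
      rw [norm_mul, Complex.norm_real, Real.norm_eq_abs, abs_of_pos (Real.exp_pos _)]
      have h2 : Real.exp (-(s * w)) ≤ 1 := Real.exp_le_one_iff.2 (by nlinarith)
      calc _ ≤ 1 * _ := mul_le_mul h2 h1 (norm_nonneg _) zero_le_one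
        _ = _ := one_mul _
    · have hc : Continuous (fun s : ℝ => ((Real.exp (-(s * v)) : ℝ) : ℂ) *
        (((v ^ (b - 1) : ℝ) : ℂ) * ((v : ℂ) - 2 * Complex.I) ^ ((b - 1 : ℝ) : ℂ))) :=
        Continuous.mul (by fun_prop) continuous_const
      simpa using (hc.tendsto 0).mono_left nhdsWithin_le_nhds
  refine key.congr' ?_
  filter_upwards [self_mem_nhdsWithin] with s hs
  have hs' : 0 < s := hs
  have hsc : (s : ℂ) ≠ 0 := by exact_mod_cast hs'.ne'
  have h1 := integral_comp_mul_left_Ioi (laplaceKernel (b - 1) (b - 1) s) 0 hs'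
  rw [mul_zero] at h1
  have h2 : ∫ x in Ioi (0 : ℝ), laplaceKernel (b - 1) (b - 1) s (s * x)
      = ((s ^ (2 * b - 2) : ℝ) : ℂ) * ∫ w in Ioi (0 : ℝ), ((Real.exp (-(s * w)) : ℝ) : ℂ) *
      (((w ^ (b - 1) : ℝ) : ℂ) * ((w : ℂ) - 2 * Complex.I) ^ ((b - 1 : ℝ) : ℂ)) := by
    rw [← integral_const_mul]
    refine setIntegral_congr_fun measurableSet_Ioi fun w hw => ?_
    have hw' : 0 < w := hw
    have hz := Complex.slitPlane_ne_zero (shift_mem_slitPlane 0 le_rfl hw')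
    simp only [Complex.ofReal_zero, zero_sub, ← sub_eq_add_neg] at hz
    simp only [laplaceKernel]
    rw [show ((s * w : ℝ) : ℂ) - 2 * Complex.I * s = (s : ℂ) * ((w : ℂ) - 2 * Complex.I) by
      push_cast; ring, ofReal_mul_cpow hs' hz, Real.mul_rpow hs'.le hw'.le,
      show 2 * b - 2 = (b - 1) + (b - 1) by ring, Real.rpow_add hs']
    push_cast; ring
  rw [h2] at h1
  have h3 : laplaceInt (b - 1) (b - 1) s = (s : ℂ) * (((s ^ (2 * b - 2) : ℝ) : ℂ) *
      ∫ w in Ioi (0 : ℝ), ((Real.exp (-(s * w)) : ℝ) : ℂ) *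
      (((w ^ (b - 1) : ℝ) : ℂ) * ((w : ℂ) - 2 * Complex.I) ^ ((b - 1 : ℝ) : ℂ))) := by
    rw [h1, laplaceInt, Complex.real_smul]
    push_cast
    field_simp
  have h4 : ((s ^ (1 - 2 * b) : ℝ) : ℂ) * (s * ((s ^ (2 * b - 2) : ℝ) : ℂ)) = 1 := by
    rw [← Complex.ofReal_mul, ← Complex.ofReal_mul]
    nth_rewrite 2 [← Real.rpow_one s]
    rw [← Real.rpow_add hs', ← Real.rpow_add hs']
    ring_nf; simp
  rw [h3]
  linear_combination -(∫ w in Ioi (0 : ℝ), ((Real.exp (-(s * w)) : ℝ) : ℂ) *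
      (((w ^ (b - 1) : ℝ) : ℂ) * ((w : ℂ) - 2 * Complex.I) ^ ((b - 1 : ℝ) : ℂ))) * h4

lemma tendsto_exp_I_mul_zero :
    Tendsto (fun s : ℝ => Complex.exp (Complex.I * s)) (𝓝[>] 0) (𝓝 1) := by
  have : Continuous (fun s : ℝ => Complex.exp (Complex.I * s)) := by fun_prop
  simpa using (this.tendsto 0).mono_left nhdsWithin_le_nhds

lemma laplaceInt_zero_zero (s : ℝ) : laplaceInt 0 0 s = 1 := by
  simp only [laplaceInt, laplaceKernel]
  have := integral_exp_neg_Ioi_zero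
  simp only [Real.rpow_zero, mul_one, Complex.ofReal_zero, Complex.cpow_zero]
  rw [integral_complex_ofReal, this]; simp

lemma tendsto_outWave_zero {b : ℝ} (hb : 0 ≤ b) :
    Tendsto (outWave b) (𝓝[>] 0) (𝓝 (Real.Gamma (2 * b + 1))) := by
  have h := tendsto_exp_I_mul_zero.mul (tendsto_laplaceInt_zero hb)
  rw [one_mul] at h
  exact h

lemma tendsto_outWave'_zero {b : ℝ} (hb : 0 ≤ b) (hb2 : b < 1 / 2) :
    Tendsto (fun s : ℝ => ((s ^ (-(2 * b)) : ℝ) : ℂ) * outWave' b s) (𝓝[>] 0)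
      (𝓝 (2 * Real.Gamma (1 + b) * Real.Gamma (1 - 2 * b) / Real.Gamma (1 - b)
        * (-2 * Complex.I) ^ ((2 * b - 1 : ℝ) : ℂ))) := by
  rcases hb.eq_or_lt with rfl | hb
  · have h : ∀ s : ℝ, ((s ^ (-(2 * (0 : ℝ))) : ℝ) : ℂ) * outWave' 0 s
        = Complex.exp (Complex.I * s) * Complex.I := by
      intro s; simp [outWave', laplaceInt_zero_zero]
    simp only [h]
    have := tendsto_exp_I_mul_zero.mul_const Complex.I
    convert this using 2
    simp [Complex.cpow_neg_one]
    ring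
  · have h := (tendsto_exp_I_mul_zero.mul (tendsto_laplaceInt_sub_one hb hb2)).const_mul
      (2 * b : ℂ)
    have hg : (Real.Gamma (1 + b) : ℂ) = b * Real.Gamma b := by
      rw [add_comm, Real.Gamma_add_one hb.ne']; push_cast; ring
    rw [hg]
    have e : (2 * (b * Real.Gamma b) * Real.Gamma (1 - 2 * b) / Real.Gamma (1 - b)
        * (-2 * Complex.I) ^ ((2 * b - 1 : ℝ) : ℂ) : ℂ) = 2 * b * (1 * (Real.Gamma b *
        Real.Gamma (1 - 2 * b) / Real.Gamma (1 - b) * (-2 * Complex.I) ^ ((2 * b - 1 : ℝ) : ℂ))) := by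
      ring
    rw [e]
    refine h.congr' ?_
    filter_upwards [self_mem_nhdsWithin] with s hs
    have hs' : 0 < s := hs
    rw [outWave'_eq hb hs', show 1 - 2 * b = -(2 * b) + 1 by ring, Real.rpow_add_one hs'.ne']
    push_cast; ring

lemma tendsto_outWave_atTop {b : ℝ} (hb : 0 ≤ b) :
    Tendsto (fun s : ℝ => ((s ^ (-b) : ℝ) : ℂ) * outWave b s
      - Real.Gamma (b + 1) * (-2 * Complex.I) ^ (b : ℂ) * Complex.exp (Complex.I * s)) atTop
      (𝓝 0) := by
  have h := tendsto_sub_nhds_zero_iff.2 (tendsto_laplaceInt_atTop hb)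
  rw [tendsto_zero_iff_norm_tendsto_zero] at h ⊢
  refine h.congr fun s => ?_
  have : ‖Complex.exp (Complex.I * s)‖ = 1 := by rw [mul_comm]; exact Complex.norm_exp_ofReal_mul_I s
  rw [← mul_one ‖_ - _‖, ← this, ← norm_mul, outWave]
  congr 1; ring

/-! ### Outgoing solutions of the radial equation -/

/-- `h` is an outgoing solution, normalised by `h(0+) = 1`, of the radial equation
`h'' - (α / s) h' + E h = 0` on `(0, ∞)`, with derivative `h'`.  The number `B` is the coefficient
of `s^(1+α)` in its expansion at the singularity, and `N` its amplitude at infinity: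
`h(s) = 1 + B s^(1+α) + o(s^(1+α))` as `s → 0`, and `h(s) ≈ N s^(α/2) e^{is√E}` as `s → ∞`. -/
structure IsOutgoing (α E : ℝ) (h h' : ℝ → ℂ) (N B : ℂ) : Prop where
  deriv : ∀ s : ℝ, 0 < s → HasDerivAt h (h' s) s
  deriv' : ∀ s : ℝ, 0 < s → HasDerivAt h' ((α / s : ℝ) * h' s - E * h s) s
  zero : Tendsto h (𝓝[>] 0) (𝓝 1)
  deriv_zero : Tendsto (fun s : ℝ => ((s ^ (-α) : ℝ) : ℂ) * h' s) (𝓝[>] 0) (𝓝 ((1 + α) * B))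
  infty : Tendsto (fun s : ℝ => ((s ^ (-(α / 2)) : ℝ) : ℂ) * h s - N * planeWave √E s) atTop (𝓝 0)
  amplitude_ne : N ≠ 0

/-- The connection coefficient `B` of the outgoing solution at energy `E`, i.e.
`i e^{-iπα/2} E^((1+α)/2) Γ((1-α)/2) / (2^(1+α) Γ((3+α)/2))`. -/
noncomputable def outCoeff (α E : ℝ) : ℂ :=
  Complex.I * Complex.exp (-(Complex.I * (Real.pi / 2 * α : ℝ))) *
    ((E ^ ((1 + α) / 2) * Real.Gamma ((1 - α) / 2)
      / (2 ^ (1 + α) * Real.Gamma ((3 + α) / 2)) : ℝ) : ℂ)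

lemma neg_two_I_cpow (q : ℝ) :
    (-2 * Complex.I) ^ (q : ℂ)
      = ((2 ^ q : ℝ) : ℂ) * Complex.exp (-(Complex.I * (Real.pi / 2 * q : ℝ))) := by
  have h : (-2 * Complex.I : ℂ) = ((2 : ℝ) : ℂ) * (-Complex.I) := by push_cast; ring
  rw [h, ofReal_mul_cpow (by norm_num) (by simp), Complex.cpow_def_of_ne_zero (by simp),
    Complex.log_neg_I]
  congr 2
  push_cast; ring

/-- The duplication formula, applied at `(1-α)/2` and at `1 + α/2`, brings the connection
coefficient into the form of `outCoeff`. -/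
lemma gamma_quotient {α : ℝ} (hα0 : 0 ≤ α) (hα1 : α < 1) :
    2 * Real.Gamma (1 + α / 2) * Real.Gamma (1 - α) / Real.Gamma (1 - α / 2) * 2 ^ (α - 1)
        / ((1 + α) * Real.Gamma (α + 1))
      = Real.Gamma ((1 - α) / 2) / (2 ^ (1 + α) * Real.Gamma ((3 + α) / 2)) := by
  have d1 := Real.Gamma_mul_Gamma_add_half ((1 - α) / 2)
  have d2 := Real.Gamma_mul_Gamma_add_half (1 + α / 2)
  rw [show (1 - α) / 2 + 1 / 2 = 1 - α / 2 by ring, show 2 * ((1 - α) / 2) = 1 - α by ring,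
    show 1 - (1 - α) = α by ring] at d1
  rw [show 1 + α / 2 + 1 / 2 = (3 + α) / 2 by ring, show 2 * (1 + α / 2) = (α + 1) + 1 by ring,
    Real.Gamma_add_one (by linarith), show 1 - (α + 1 + 1) = -(1 + α) by ring,
    Real.rpow_neg (by norm_num)] at d2
  have p1 : 0 < Real.Gamma (1 - α / 2) := Real.Gamma_pos_of_pos (by linarith)
  have p2 : 0 < Real.Gamma ((3 + α) / 2) := Real.Gamma_pos_of_pos (by linarith)
  have p3 : 0 < Real.Gamma (α + 1) := Real.Gamma_pos_of_pos (by linarith)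
  have p4 : 0 < (2 : ℝ) ^ (1 + α) := by positivity
  have p5 : 0 < (2 : ℝ) ^ α := by positivity
  have p6 : (2 : ℝ) ^ (α - 1) = 2 ^ α / 2 := by rw [Real.rpow_sub_one (by norm_num)]
  have p7 : 0 < √Real.pi := Real.sqrt_pos.2 Real.pi_pos
  rw [p6, div_eq_div_iff (by positivity) (by positivity)]
  have d2' : Real.Gamma (1 + α / 2) * Real.Gamma ((3 + α) / 2) * 2 ^ (1 + α)
      = (α + 1) * Real.Gamma (α + 1) * √Real.pi := by
    rw [d2]; field_simp
  rw [div_mul_eq_mul_div, div_mul_eq_mul_div, div_eq_iff p1.ne']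
  apply mul_right_cancel₀ p7.ne'
  linear_combination (Real.Gamma (1 - α) * 2 ^ α * √Real.pi) * d2' - (1 + α) * Real.Gamma (α + 1) * √Real.pi * d1

/-- The outgoing solution at energy `E` is `outWave (α / 2) (√E s)`, normalised at the
singularity. -/
theorem exists_isOutgoing {α E : ℝ} (hα0 : 0 ≤ α) (hα1 : α < 1) (hE : 0 < E) :
    ∃ h h' N, IsOutgoing α E h h' N (outCoeff α E) := by
  set b := α / 2 with hb
  set k := √E with hk
  have hb0 : 0 ≤ b := by rw [hb]; linarith
  have hb2 : b < 1 / 2 := by rw [hb]; linarith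
  have hαb : α = 2 * b := by rw [hb]; ring
  have hk0 : 0 < k := Real.sqrt_pos.2 hE
  have hkk : k * k = E := Real.mul_self_sqrt hE.le
  have hA : 0 < Real.Gamma (2 * b + 1) := Real.Gamma_pos_of_pos (by linarith)
  set A : ℂ := (Real.Gamma (2 * b + 1) : ℂ) with hAdef
  have hAc : A ≠ 0 := by rw [hAdef]; exact_mod_cast hA.ne'
  have hscale : Tendsto (fun s : ℝ => k * s) (𝓝[>] 0) (𝓝[>] 0) := by
    refine tendsto_nhdsWithin_iff.2 ⟨?_, ?_⟩
    · have : Continuous (fun s : ℝ => k * s) := by fun_prop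
      simpa using (this.tendsto 0).mono_left nhdsWithin_le_nhds
    · filter_upwards [self_mem_nhdsWithin] with s hs
      exact mul_pos hk0 hs
  have hmul : ∀ s : ℝ, HasDerivAt (fun s : ℝ => k * s) k s := fun s => by
    simpa using (hasDerivAt_id s).const_mul k
  refine ⟨fun s => A⁻¹ * outWave b (k * s), fun s => A⁻¹ * (k * outWave' b (k * s)),
    A⁻¹ * (((k ^ b : ℝ) : ℂ) * (Real.Gamma (b + 1) * (-2 * Complex.I) ^ (b : ℂ))), ?_, ?_, ?_, ?_,
    ?_, ?_⟩
  · intro s hs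
    have := ((hasDerivAt_outWave hb0 (mul_pos hk0 hs)).scomp s (hmul s)).const_mul A⁻¹
    simpa using this
  · intro s hs
    have := (((hasDerivAt_outWave' hb0 (mul_pos hk0 hs)).scomp s (hmul s)).const_mul (k : ℂ)).const_mul A⁻¹
    refine this.congr_deriv ?_
    have hs' : (s : ℂ) ≠ 0 := by exact_mod_cast hs.ne'
    have hk' : (k : ℂ) ≠ 0 := by exact_mod_cast hk0.ne'
    rw [← hkk, hαb, Complex.real_smul]
    push_cast
    field_simp
  · have := ((tendsto_outWave_zero hb0).comp hscale).const_mul A⁻¹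
    rw [inv_mul_cancel₀ hAc] at this
    exact this
  · have h1 := ((tendsto_outWave'_zero hb0 hb2).comp hscale).const_mul
      (A⁻¹ * ((k ^ (1 + α) : ℝ) : ℂ))
    have h2 : (1 + α) * outCoeff α E = A⁻¹ * ((k ^ (1 + α) : ℝ) : ℂ) *
        (2 * Real.Gamma (1 + b) * Real.Gamma (1 - 2 * b) / Real.Gamma (1 - b)
        * (-2 * Complex.I) ^ ((2 * b - 1 : ℝ) : ℂ)) := by
      have h3 := gamma_quotient hα0 hα1
      rw [← hb] at h3
      have h4 : k ^ (1 + α) = E ^ ((1 + α) / 2) := by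
        rw [hk, Real.sqrt_eq_rpow, ← Real.rpow_mul hE.le]; congr 1; ring
      have h5 : Complex.exp (-(Complex.I * (Real.pi / 2 * (α - 1) : ℝ)))
          = Complex.I * Complex.exp (-(Complex.I * (Real.pi / 2 * α : ℝ))) := by
        rw [show -(Complex.I * (Real.pi / 2 * (α - 1) : ℝ)) = (Real.pi / 2 : ℝ) * Complex.I
          + -(Complex.I * (Real.pi / 2 * α : ℝ)) by push_cast; ring, Complex.exp_add]
        push_cast
        rw [Complex.exp_pi_div_two_mul_I]
      rw [neg_two_I_cpow, ← hαb, h5, h4, outCoeff, hAdef, ← hαb, mul_div_assoc (E ^ _), ← h3]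
      have : (1 + α : ℂ) ≠ 0 := by
        have : (1 + α) ≠ 0 := by linarith
        exact_mod_cast this
      have hA' : (Real.Gamma (α + 1) : ℂ) ≠ 0 := by
        rw [hAdef, ← hαb] at hAc; exact hAc
      push_cast
      field_simp
    rw [h2]
    refine h1.congr' ?_
    filter_upwards [self_mem_nhdsWithin] with s hs
    have hs' : 0 < s := hs
    simp only [Function.comp_apply]
    rw [← hαb, Real.mul_rpow hk0.le hs'.le]
    have h6 : ((k ^ (1 + α) : ℝ) : ℂ) * ((k ^ (-α) : ℝ) : ℂ) = k := by
      rw [← Complex.ofReal_mul, ← Real.rpow_add hk0]; simp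
    rw [Complex.ofReal_mul]
    linear_combination (A⁻¹ * ((s ^ (-α) : ℝ) : ℂ) * outWave' b (k * s)) * h6
  · have h1 := ((tendsto_outWave_atTop hb0).comp (tendsto_id.const_mul_atTop hk0)).const_mul
      (A⁻¹ * ((k ^ b : ℝ) : ℂ))
    rw [mul_zero] at h1
    refine h1.congr' ?_
    filter_upwards [eventually_gt_atTop 0] with s hs
    simp only [Function.comp_apply, id, planeWave]
    rw [Real.mul_rpow hk0.le hs.le]
    have h6 : ((k ^ b : ℝ) : ℂ) * ((k ^ (-b) : ℝ) : ℂ) = 1 := by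
      rw [← Complex.ofReal_mul, ← Real.rpow_add hk0]; simp
    push_cast at h6 ⊢
    rw [← mul_assoc Complex.I]
    linear_combination (A⁻¹ * ((s ^ (-b) : ℝ) : ℂ) * outWave b (k * s)) * h6
  · have h1 : (-2 * Complex.I) ^ (b : ℂ) ≠ 0 := by
      simp [Complex.cpow_eq_zero_iff]
    have h2 : (Real.Gamma (b + 1) : ℂ) ≠ 0 := by
      exact_mod_cast (Real.Gamma_pos_of_pos (by linarith : 0 < b + 1)).ne'
    have h3 : ((k ^ b : ℝ) : ℂ) ≠ 0 := by exact_mod_cast (Real.rpow_pos_of_pos hk0 b).ne'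
    exact mul_ne_zero (inv_ne_zero hAc) (mul_ne_zero h3 (mul_ne_zero h2 h1))

/-! ### Solutions of the radial equation -/

/-- `f` solves `f'' - (α / s) f' + E f = 0` on `(0, ∞)`, with derivative `f'`. -/
def IsRadialSolution (α E : ℝ) (f f' : ℝ → ℂ) : Prop :=
  ∀ s : ℝ, 0 < s → HasDerivAt f (f' s) s ∧ HasDerivAt f' ((α / s : ℝ) * f' s - E * f s) s

lemma IsRadialSolution.conj {α E : ℝ} {f f' : ℝ → ℂ} (h : IsRadialSolution α E f f') :
    IsRadialSolution α E (fun s => conj (f s)) (fun s => conj (f' s)) := by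
  intro s hs
  refine ⟨(h s hs).1.star, (h s hs).2.star.congr_deriv ?_⟩
  simp

lemma IsRadialSolution.linear {α E : ℝ} {f f' g g' : ℝ → ℂ} (hf : IsRadialSolution α E f f')
    (hg : IsRadialSolution α E g g') (c d : ℂ) :
    IsRadialSolution α E (fun s => c * f s + d * g s) (fun s => c * f' s + d * g' s) := by
  intro s hs
  refine ⟨((hf s hs).1.const_mul c).add ((hg s hs).1.const_mul d),
    (((hf s hs).2.const_mul c).add ((hg s hs).2.const_mul d)).congr_deriv ?_⟩
  ring

lemma IsOutgoing.isRadialSolution {α E : ℝ} {h h' : ℝ → ℂ} {N B : ℂ}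
    (H : IsOutgoing α E h h' N B) : IsRadialSolution α E h h' :=
  fun s hs => ⟨H.deriv s hs, H.deriv' s hs⟩

/-- The Wronskian of two functions with respect to the weight `s^(-α)`. -/
noncomputable def wronskian (α : ℝ) (f f' g g' : ℝ → ℂ) (s : ℝ) : ℂ :=
  ((s ^ (-α) : ℝ) : ℂ) * (f s * g' s - f' s * g s)

lemma hasDerivAt_rpow_ofReal {s : ℝ} (r : ℝ) (hs : 0 < s) :
    HasDerivAt (fun t : ℝ => ((t ^ r : ℝ) : ℂ)) ((r / s : ℝ) * ((s ^ r : ℝ) : ℂ)) s := by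
  refine (Real.hasDerivAt_rpow_const (p := r) (Or.inl hs.ne')).ofReal_comp.congr_deriv ?_
  rw [Real.rpow_sub_one hs.ne']
  push_cast; ring

lemma wronskian_const {α E : ℝ} {f f' g g' : ℝ → ℂ} (hf : IsRadialSolution α E f f')
    (hg : IsRadialSolution α E g g') {s t : ℝ} (hs : 0 < s) (ht : 0 < t) :
    wronskian α f f' g g' s = wronskian α f f' g g' t := by
  have hd : ∀ s ∈ Ioi (0 : ℝ), HasDerivAt (wronskian α f f' g g') 0 s := by
    intro s hs
    refine ((hasDerivAt_rpow_ofReal (-α) hs).mul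
      (((hf s hs).1.mul (hg s hs).2).sub ((hf s hs).2.mul (hg s hs).1))).congr_deriv ?_
    simp only [Pi.sub_apply, Pi.mul_apply]
    have hs' : (s : ℂ) ≠ 0 := by exact_mod_cast (ne_of_gt hs)
    push_cast; field_simp; ring
  exact isOpen_Ioi.is_const_of_deriv_eq_zero isPreconnected_Ioi
    (fun z hz => (hd z hz).differentiableAt.differentiableWithinAt)
    (fun z hz => (hd z hz).deriv) hs ht

/-- The real case of `tendsto_rpow_mul_sub`, by l'Hôpital's rule. -/
lemma tendsto_rpow_mul_sub_real {r A B : ℝ} {u u' : ℝ → ℝ} (hr : 0 < r)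
    (hd : ∀ s : ℝ, 0 < s → HasDerivAt u (u' s) s) (h0 : Tendsto u (𝓝[>] 0) (𝓝 A))
    (h1 : Tendsto (fun s : ℝ => s ^ (-(r - 1)) * u' s) (𝓝[>] 0) (𝓝 (r * B))) :
    Tendsto (fun s : ℝ => s ^ (-r) * (u s - A)) (𝓝[>] 0) (𝓝 B) := by
  have key : Tendsto (fun s : ℝ => (u s - A) / s ^ r) (𝓝[>] 0) (𝓝 B) := by
    refine HasDerivAt.lhopital_zero_nhdsGT (f' := u') (g' := fun s => r * s ^ (r - 1)) ?_ ?_ ?_ ?_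
      ?_ ?_
    · filter_upwards [self_mem_nhdsWithin] with s hs
      exact (hd s hs).sub_const A
    · filter_upwards [self_mem_nhdsWithin] with s hs
      exact Real.hasDerivAt_rpow_const (Or.inl (ne_of_gt hs))
    · filter_upwards [self_mem_nhdsWithin] with s hs
      exact mul_ne_zero hr.ne' (Real.rpow_pos_of_pos hs _).ne'
    · simpa using h0.sub_const A
    · have := (Real.continuousAt_rpow_const 0 r (Or.inr hr.le)).tendsto
      rw [Real.zero_rpow hr.ne'] at this
      exact this.mono_left nhdsWithin_le_nhds
    · have h2 := h1.const_mul r⁻¹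
      rw [← mul_assoc, inv_mul_cancel₀ hr.ne', one_mul] at h2
      refine h2.congr' ?_
      filter_upwards [self_mem_nhdsWithin] with s hs
      have : 0 < s ^ (r - 1) := Real.rpow_pos_of_pos hs _
      rw [Real.rpow_neg (le_of_lt hs)]
      field_simp
  refine key.congr' ?_
  filter_upwards [self_mem_nhdsWithin] with s hs
  rw [Real.rpow_neg (le_of_lt hs), div_eq_inv_mul]

lemma tendsto_complex_iff {ι : Type*} {l : Filter ι} {f : ι → ℂ} {z : ℂ} :
    Tendsto f l (𝓝 z) ↔ Tendsto (fun i => (f i).re) l (𝓝 z.re) ∧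
      Tendsto (fun i => (f i).im) l (𝓝 z.im) := by
  refine ⟨fun h => ⟨(Complex.continuous_re.tendsto z).comp h,
    (Complex.continuous_im.tendsto z).comp h⟩, fun h => ?_⟩
  have h1 := ((Complex.continuous_ofReal.tendsto _).comp h.1).add
    (((Complex.continuous_ofReal.tendsto _).comp h.2).mul_const Complex.I)
  simpa [Function.comp_def] using h1

/-- Integrated form of a one-sided expansion: `s^(-(r-1)) u' → r B` gives
`s^(-r) (u - u(0+)) → B`. -/
lemma tendsto_rpow_mul_sub {r : ℝ} {A B : ℂ} {u u' : ℝ → ℂ} (hr : 0 < r)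
    (hd : ∀ s : ℝ, 0 < s → HasDerivAt u (u' s) s) (h0 : Tendsto u (𝓝[>] 0) (𝓝 A))
    (h1 : Tendsto (fun s : ℝ => ((s ^ (-(r - 1)) : ℝ) : ℂ) * u' s) (𝓝[>] 0) (𝓝 (r * B))) :
    Tendsto (fun s : ℝ => ((s ^ (-r) : ℝ) : ℂ) * (u s - A)) (𝓝[>] 0) (𝓝 B) := by
  rw [tendsto_complex_iff] at h0 h1 ⊢
  simp only [Complex.re_ofReal_mul, Complex.im_ofReal_mul, Complex.sub_re, Complex.sub_im] at h1 ⊢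
  exact ⟨tendsto_rpow_mul_sub_real hr
      (fun s hs => (Complex.reCLM.hasFDerivAt.comp_hasDerivAt s (hd s hs))) h0.1 h1.1,
    tendsto_rpow_mul_sub_real hr
      (fun s hs => (Complex.imCLM.hasFDerivAt.comp_hasDerivAt s (hd s hs))) h0.2 h1.2⟩

lemma planeWave_conj (k s : ℝ) : conj (planeWave k s) = planeWave (-k) s := by
  simp only [planeWave, ← Complex.exp_conj]
  simp

section Outgoing

variable {α E : ℝ} {h h' : ℝ → ℂ} {N B : ℂ}

/-- Any solution of the radial equation is a combination of the outgoing solution and of its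
complex conjugate, the incoming one. -/
lemma IsOutgoing.exists_coeff (H : IsOutgoing α E h h' N B) (hα0 : 0 ≤ α) (hB : conj B ≠ B)
    {f f' : ℝ → ℂ} (hf : IsRadialSolution α E f f') :
    ∃ c d : ℂ, ∀ s : ℝ, 0 < s → f s = c * h s + d * conj (h s) := by
  have hs := H.isRadialSolution
  have hc := hs.conj
  set w := wronskian α h h' (fun s => conj (h s)) (fun s => conj (h' s)) with hw
  have hlim : Tendsto w (𝓝[>] 0) (𝓝 ((1 + α) * conj B - (1 + α) * B)) := by
    have h1 : Tendsto (fun s => conj (h s)) (𝓝[>] 0) (𝓝 (conj (1 : ℂ))) :=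
      (Complex.continuous_conj.tendsto _).comp H.zero
    have h2 : Tendsto (fun s : ℝ => conj (((s ^ (-α) : ℝ) : ℂ) * h' s)) (𝓝[>] 0)
        (𝓝 (conj ((1 + α) * B))) := (Complex.continuous_conj.tendsto _).comp H.deriv_zero
    have h3 := (H.zero.mul h2).sub (H.deriv_zero.mul h1)
    simp only [map_one, map_mul, map_add, Complex.conj_ofReal, one_mul, mul_one] at h3
    refine h3.congr fun s => ?_
    simp only [hw, wronskian]
    ring
  have hw1 : w 1 = (1 + α) * conj B - (1 + α) * B := by
    refine tendsto_nhds_unique (tendsto_const_nhds.congr' ?_) hlim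
    filter_upwards [self_mem_nhdsWithin] with s hs'
    exact wronskian_const hs hc one_pos hs'
  have hw0 : w 1 ≠ 0 := by
    rw [hw1, ← mul_sub]
    refine mul_ne_zero ?_ (sub_ne_zero.2 hB)
    have : (1 + α) ≠ 0 := by linarith
    exact_mod_cast this
  refine ⟨wronskian α f f' (fun s => conj (h s)) (fun s => conj (h' s)) 1 / w 1,
    -wronskian α f f' h h' 1 / w 1, fun s hs' => ?_⟩
  rw [wronskian_const hf hc one_pos hs', wronskian_const hf hs one_pos hs']
  have h0 : w s = w 1 := wronskian_const hs hc hs' one_pos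
  rw [← h0] at hw0 ⊢
  field_simp
  simp only [hw, wronskian]
  ring

lemma IsOutgoing.tendsto_zero (H : IsOutgoing α E h h' N B) (c d : ℂ) :
    Tendsto (fun s => c * h s + d * conj (h s)) (𝓝[>] 0) (𝓝 (c + d)) := by
  have h1 : Tendsto (fun s => conj (h s)) (𝓝[>] 0) (𝓝 (conj (1 : ℂ))) :=
    (Complex.continuous_conj.tendsto _).comp H.zero
  simpa using (H.zero.const_mul c).add (h1.const_mul d)

lemma IsOutgoing.tendsto_expansion (H : IsOutgoing α E h h' N B) (hα0 : 0 ≤ α) (c d : ℂ) :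
    Tendsto (fun s : ℝ => ((s ^ (-(1 + α)) : ℝ) : ℂ) * (c * h s + d * conj (h s) - (c + d)))
      (𝓝[>] 0) (𝓝 (c * B + d * conj B)) := by
  refine tendsto_rpow_mul_sub (u' := fun s => c * h' s + d * conj (h' s)) (by linarith)
    (fun s hs => ((H.isRadialSolution.linear H.isRadialSolution.conj c d) s hs).1)
    (H.tendsto_zero c d) ?_
  have h2 : Tendsto (fun s : ℝ => conj (((s ^ (-α) : ℝ) : ℂ) * h' s)) (𝓝[>] 0)
      (𝓝 (conj ((1 + α) * B))) := (Complex.continuous_conj.tendsto _).comp H.deriv_zero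
  have h3 := (H.deriv_zero.const_mul c).add (h2.const_mul d)
  simp only [map_one, map_mul, map_add, Complex.conj_ofReal] at h3
  rw [show 1 + α - 1 = α by ring]
  convert h3 using 2
  · ring
  · push_cast; ring

lemma IsOutgoing.tendsto_infty (H : IsOutgoing α E h h' N B) (c d : ℂ) :
    Tendsto (fun s : ℝ => ((s ^ (-(α / 2)) : ℝ) : ℂ) * (c * h s + d * conj (h s))
      - (d * conj N * planeWave (-√E) s + c * N * planeWave √E s)) atTop (𝓝 0) := by
  have h2 := (Complex.continuous_conj.tendsto _).comp H.infty
  have h3 := (H.infty.const_mul c).add (h2.const_mul d)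
  simp only [map_zero, mul_zero, add_zero] at h3
  refine h3.congr fun s => ?_
  simp only [Function.comp_apply, map_sub, map_mul, Complex.conj_ofReal]
  rw [planeWave_conj]
  ring

end Outgoing

/-- The two plane waves of a given frequency are asymptotically independent. -/
lemma planeWave_independent {k : ℝ} (hk : 0 < k) {p q : ℂ}
    (h : Tendsto (fun s => q * planeWave (-k) s + p * planeWave k s) atTop (𝓝 0)) :
    q = 0 ∧ p = 0 := by
  have h1 : Tendsto (fun n : ℕ => (2 * Real.pi / k) * (n : ℝ)) atTop atTop :=
    tendsto_natCast_atTop_atTop.const_mul_atTop (by positivity)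
  have h2 : Tendsto (fun n : ℕ => (2 * Real.pi / k) * (n : ℝ) + Real.pi / (2 * k)) atTop atTop :=
    tendsto_atTop_add_const_right _ _ h1
  have hk' : (k : ℂ) ≠ 0 := by exact_mod_cast hk.ne'
  have e1 : q + p = 0 := by
    refine tendsto_nhds_unique (tendsto_const_nhds.congr fun n => ?_) (h.comp h1)
    have a1 : planeWave k ((2 * Real.pi / k) * (n : ℝ)) = 1 := by
      rw [planeWave, Complex.exp_eq_one_iff]
      exact ⟨n, by push_cast; field_simp⟩
    have a2 : planeWave (-k) ((2 * Real.pi / k) * (n : ℝ)) = 1 := by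
      rw [planeWave, Complex.exp_eq_one_iff]
      exact ⟨-n, by push_cast; field_simp⟩
    simp [a1, a2]
  have e2 : q * -Complex.I + p * Complex.I = 0 := by
    refine tendsto_nhds_unique (tendsto_const_nhds.congr fun n => ?_) (h.comp h2)
    have a1 : planeWave k ((2 * Real.pi / k) * (n : ℝ) + Real.pi / (2 * k)) = Complex.I := by
      rw [planeWave, show Complex.I * k * (((2 * Real.pi / k) * (n : ℝ) + Real.pi / (2 * k) : ℝ) : ℂ)
        = Real.pi / 2 * Complex.I + n * (2 * Real.pi * Complex.I) by push_cast; field_simp; ring,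
        Complex.exp_add, Complex.exp_nat_mul_two_pi_mul_I, Complex.exp_pi_div_two_mul_I, mul_one]
    have a2 : planeWave (-k) ((2 * Real.pi / k) * (n : ℝ) + Real.pi / (2 * k)) = -Complex.I := by
      rw [← planeWave_conj, a1, Complex.conj_I]
    simp [a1, a2]
  have hI := Complex.I_ne_zero
  have e3 : p - q = 0 := by
    apply mul_left_cancel₀ hI; linear_combination e2
  constructor
  · linear_combination (e1 - e3) / 2
  · linear_combination (e1 + e3) / 2

/-! ### The zero mode of a generalised eigenfunction -/

lemma isOpen_fst_ne_zero : IsOpen {p : ℝ × ℝ | p.1 ≠ 0} :=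
  isOpen_ne_fun continuous_fst continuous_const

section PartialDerivatives

variable {g : ℝ × ℝ → ℂ}

lemma hasDerivAt_fst {p : ℝ × ℝ} (hg : DifferentiableAt ℝ g p) :
    HasDerivAt (fun s => g (s, p.2)) (fderiv ℝ g p (1, 0)) p.1 := by
  have h1 : HasDerivAt (fun s : ℝ => (s, p.2)) ((1 : ℝ), (0 : ℝ)) p.1 :=
    (hasDerivAt_id p.1).prodMk (hasDerivAt_const p.1 p.2)
  exact hg.hasFDerivAt.comp_hasDerivAt p.1 h1

lemma hasDerivAt_snd {p : ℝ × ℝ} (hg : DifferentiableAt ℝ g p) :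
    HasDerivAt (fun s => g (p.1, s)) (fderiv ℝ g p (0, 1)) p.2 := by
  have h1 : HasDerivAt (fun s : ℝ => (p.1, s)) ((0 : ℝ), (1 : ℝ)) p.2 :=
    (hasDerivAt_const p.2 p.1).prodMk (hasDerivAt_id p.2)
  exact hg.hasFDerivAt.comp_hasDerivAt p.2 h1

lemma contDiffOn_fderiv_apply {m n : WithTop ℕ∞} {U : Set (ℝ × ℝ)} (hU : IsOpen U)
    (hg : ContDiffOn ℝ n g U) (hmn : m + 1 ≤ n) (v : ℝ × ℝ) :
    ContDiffOn ℝ m (fun p => fderiv ℝ g p v) U :=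
  (hg.fderiv_of_isOpen hU hmn).clm_apply contDiffOn_const

lemma differentiableAt_of_contDiffOn {n : WithTop ℕ∞} {U : Set (ℝ × ℝ)} (hU : IsOpen U)
    (hg : ContDiffOn ℝ n g U) (hn : n ≠ 0) {p : ℝ × ℝ} (hp : p ∈ U) : DifferentiableAt ℝ g p :=
  (hg.contDiffAt (hU.mem_nhds hp)).differentiableAt hn

lemma intervalIntegrable_slice (hg : ContinuousOn g {p | p.1 ≠ 0}) {x : ℝ} (hx : x ≠ 0)
    (a b : ℝ) : IntervalIntegrable (fun y => g (x, y)) volume a b := by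
  refine ContinuousOn.intervalIntegrable ?_
  exact hg.comp (by fun_prop) fun y _ => hx

lemma hasDerivAt_integral_slice (hg : ContDiffOn ℝ 1 g {p | p.1 ≠ 0}) {x : ℝ} (hx : x ≠ 0)
    (b : ℝ) :
    HasDerivAt (fun s => ∫ y in (0 : ℝ)..b, g (s, y))
      (∫ y in (0 : ℝ)..b, fderiv ℝ g (x, y) (1, 0)) x := by
  have hU := isOpen_fst_ne_zero
  have hg' : ContinuousOn (fun p => fderiv ℝ g p (1, 0)) {p : ℝ × ℝ | p.1 ≠ 0} :=
    (contDiffOn_fderiv_apply (m := 0) hU hg (by simp) (1, 0)).continuousOn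
  have hx2 : 0 < |x| / 2 := by positivity
  have hball : ∀ t ∈ Metric.closedBall x (|x| / 2), t ≠ 0 := by
    rintro t ht rfl
    rw [Metric.mem_closedBall, Real.dist_eq, zero_sub, abs_neg] at ht
    linarith
  obtain ⟨C, hC⟩ := ((isCompact_closedBall x (|x| / 2)).prod
    (isCompact_uIcc (a := (0 : ℝ)) (b := b))).exists_bound_of_continuousOn
    (hg'.mono fun p hp => hball p.1 hp.1)
  have key := intervalIntegral.hasDerivAt_integral_of_dominated_loc_of_deriv_le (μ := volume)
    (F := fun s y => g (s, y)) (F' := fun s y => fderiv ℝ g (s, y) (1, 0)) (x₀ := x)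
    (a := 0) (b := b) (bound := fun _ => C)
    (Metric.closedBall_mem_nhds x hx2)
    ?_ (intervalIntegrable_slice hg.continuousOn hx 0 b)
    (intervalIntegrable_iff.1 (intervalIntegrable_slice hg' hx 0 b)).aestronglyMeasurable
    (Eventually.of_forall fun y hy t ht => hC (t, y) ⟨ht, uIoc_subset_uIcc hy⟩)
    intervalIntegrable_const
    (Eventually.of_forall fun y hy t ht => hasDerivAt_fst (p := (t, y))
      (differentiableAt_of_contDiffOn hU hg (by simp) (hball t ht)))
  · exact key.2
  · filter_upwards [Metric.closedBall_mem_nhds x hx2] with t ht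
    exact (intervalIntegrable_iff.1
      (intervalIntegrable_slice hg.continuousOn (hball t ht) 0 b)).aestronglyMeasurable

end PartialDerivatives

/-- The zero mode of `f`, i.e. its integral over the circle. -/
noncomputable def zeroMode (f : ℝ → ℝ → ℂ) (x : ℝ) : ℂ := ∫ y in (0 : ℝ)..(2 * Real.pi), f x y

/-- The zero mode of a generalised eigenfunction solves the radial equation. -/
lemma IsGeneralisedEigenfunction.zeroMode_eq {α : ℝ} {a : ℂ} {γ E : ℝ} {f : ℝ → ℝ → ℂ}
    (hf : IsGeneralisedEigenfunction α a γ E f) :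
    ∃ F' : ℝ → ℂ, ∀ x : ℝ, x ≠ 0 → HasDerivAt (zeroMode f) (F' x) x ∧
      HasDerivAt F' ((α / x : ℝ) * F' x - E * zeroMode f x) x := by
  have hU := isOpen_fst_ne_zero
  set g : ℝ × ℝ → ℂ := fun p => f p.1 p.2 with hg
  have hg2 : ContDiffOn ℝ 2 g {p | p.1 ≠ 0} := hf.smooth
  set gx : ℝ × ℝ → ℂ := fun p => fderiv ℝ g p (1, 0) with hgx
  set gy : ℝ × ℝ → ℂ := fun p => fderiv ℝ g p (0, 1) with hgy
  have hgx1 : ContDiffOn ℝ 1 gx {p | p.1 ≠ 0} :=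
    contDiffOn_fderiv_apply hU hg2 (by norm_num) _
  have hgy1 : ContDiffOn ℝ 1 gy {p | p.1 ≠ 0} :=
    contDiffOn_fderiv_apply hU hg2 (by norm_num) _
  have dg : ∀ p : ℝ × ℝ, p.1 ≠ 0 → DifferentiableAt ℝ g p := fun p hp =>
    differentiableAt_of_contDiffOn hU hg2 (by simp) hp
  have dgx : ∀ p : ℝ × ℝ, p.1 ≠ 0 → DifferentiableAt ℝ gx p := fun p hp =>
    differentiableAt_of_contDiffOn hU hgx1 (by simp) hp
  have dgy : ∀ p : ℝ × ℝ, p.1 ≠ 0 → DifferentiableAt ℝ gy p := fun p hp =>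
    differentiableAt_of_contDiffOn hU hgy1 (by simp) hp
  have hgxx : ContinuousOn (fun p => fderiv ℝ gx p (1, 0)) {p : ℝ × ℝ | p.1 ≠ 0} :=
    (contDiffOn_fderiv_apply (m := 0) hU hgx1 (by simp) _).continuousOn
  have hgyy : ContinuousOn (fun p => fderiv ℝ gy p (0, 1)) {p : ℝ × ℝ | p.1 ≠ 0} :=
    (contDiffOn_fderiv_apply (m := 0) hU hgy1 (by simp) _).continuousOn
  refine ⟨fun x => ∫ y in (0 : ℝ)..(2 * Real.pi), gx (x, y), fun x hx => ⟨?_, ?_⟩⟩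
  · exact hasDerivAt_integral_slice (hg2.of_le (by norm_num)) hx _
  · refine (hasDerivAt_integral_slice hgx1 hx _).congr_deriv ?_
    -- the eigenvalue equation in terms of the total derivatives
    have hpt : ∀ y, fderiv ℝ gx (x, y) (1, 0) = (α / x : ℝ) * gx (x, y) - E * g (x, y)
        - ((|x| ^ (2 * α) : ℝ) : ℂ) * fderiv ℝ gy (x, y) (0, 1) := by
      intro y
      have h1 := hf.eigen x y hx
      have e1 : deriv (fun s => f s y) x = gx (x, y) := (hasDerivAt_fst (dg (x, y) hx)).deriv
      have e2 : deriv (deriv (fun s => f s y)) x = fderiv ℝ gx (x, y) (1, 0) := by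
        have : deriv (fun s => f s y) =ᶠ[𝓝 x] fun s => gx (s, y) := by
          filter_upwards [isOpen_ne.mem_nhds hx] with s hs
          exact (hasDerivAt_fst (dg (s, y) hs)).deriv
        rw [this.deriv_eq]
        exact (hasDerivAt_fst (dgx (x, y) hx)).deriv
      have e3 : deriv (deriv (fun s => f x s)) y = fderiv ℝ gy (x, y) (0, 1) := by
        have : deriv (fun s => f x s) = fun s => gy (x, s) := by
          ext s
          exact (hasDerivAt_snd (dg (x, s) hx)).deriv
        rw [this]
        exact (hasDerivAt_snd (dgy (x, y) hx)).deriv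
      rw [laplaceBeltrami, e1, e2, e3] at h1
      simp only [hg]
      linear_combination -h1
    -- the integral of the second angular derivative vanishes by periodicity
    have hper : ∫ y in (0 : ℝ)..(2 * Real.pi), fderiv ℝ gy (x, y) (0, 1) = 0 := by
      rw [intervalIntegral.integral_eq_sub_of_hasDerivAt (f := fun y => gy (x, y))
        (fun y _ => hasDerivAt_snd (dgy (x, y) hx)) (intervalIntegrable_slice hgyy hx _ _)]
      have h1 := (hasDerivAt_snd (dg (x, 0 + 2 * Real.pi) hx)).comp_add_const 0 (2 * Real.pi)
      have h2 := hasDerivAt_snd (dg (x, 0) hx)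
      have h3 : (fun s => g (x, s + 2 * Real.pi)) = fun s => g (x, s) := by
        ext s; exact hf.periodic x s
      simp only [h3] at h1
      rw [sub_eq_zero]
      simpa [hgy] using h1.unique h2
    simp only [hpt]
    rw [intervalIntegral.integral_sub, intervalIntegral.integral_sub,
      intervalIntegral.integral_const_mul, intervalIntegral.integral_const_mul,
      intervalIntegral.integral_const_mul, hper, mul_zero, sub_zero]
    · rfl
    · exact (intervalIntegrable_slice hgx1.continuousOn hx _ _).const_mul _
    · exact (intervalIntegrable_slice hg2.continuousOn hx _ _).const_mul _
    · exact ((intervalIntegrable_slice hgx1.continuousOn hx _ _).const_mul _).sub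
        ((intervalIntegrable_slice hg2.continuousOn hx _ _).const_mul _)
    · exact (intervalIntegrable_slice hgyy hx _ _).const_mul _

lemma IsGeneralisedEigenfunction.isRadialSolution {α : ℝ} {a : ℂ} {γ E : ℝ} {f : ℝ → ℝ → ℂ}
    (hf : IsGeneralisedEigenfunction α a γ E f) {σ : ℝ} (hσ : σ = 1 ∨ σ = -1) :
    ∃ F', IsRadialSolution α E (fun s => zeroMode f (σ * s)) F' := by
  obtain ⟨F', hF⟩ := hf.zeroMode_eq
  have hσσ : σ * σ = 1 := by rcases hσ with rfl | rfl <;> norm_num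
  refine ⟨fun s => σ * F' (σ * s), fun s hs => ?_⟩
  have hσ0 : σ ≠ 0 := by rintro rfl; simp at hσσ
  obtain ⟨h1, h2⟩ := hF (σ * s) (mul_ne_zero hσ0 hs.ne')
  have hm : HasDerivAt (fun s : ℝ => σ * s) σ s := by simpa using (hasDerivAt_id s).const_mul σ
  refine ⟨(h1.scomp s hm).congr_deriv (Complex.real_smul ..), ?_⟩
  refine ((h2.scomp s hm).const_mul (σ : ℂ)).congr_deriv ?_
  have hs' : (s : ℂ) ≠ 0 := by exact_mod_cast hs.ne'
  have hσ' : (σ : ℂ) ≠ 0 := by exact_mod_cast hσ0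
  have hσσ' : (σ : ℂ) ^ 2 = 1 := by rw [sq]; exact_mod_cast hσσ
  rw [Complex.real_smul]
  push_cast
  field_simp
  linear_combination (-(E : ℂ) * s * zeroMode f (σ * s)) * hσσ'

/-- Averaging over the circle an asymptotic formula that is uniform in `y`. -/
lemma tendsto_zeroMode {r σ : ℝ} {f : ℝ → ℝ → ℂ} {w : ℝ → ℂ} (hσ : σ ≠ 0)
    (hf : ContinuousOn (fun p : ℝ × ℝ => f p.1 p.2) {p | p.1 ≠ 0})
    (h : Tendsto (fun p : ℝ × ℝ => ((p.1 ^ r : ℝ) : ℂ) * f (σ * p.1) p.2 - w p.1)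
      (atTop ×ˢ ⊤) (𝓝 0)) :
    Tendsto (fun s : ℝ => ((s ^ r : ℝ) : ℂ) * zeroMode f (σ * s) - 2 * Real.pi * w s)
      atTop (𝓝 0) := by
  rw [Metric.tendsto_nhds] at h ⊢
  intro ε hε
  have hπ := Real.pi_pos
  have h1 := h (ε / (2 * Real.pi) / 2) (by positivity)
  rw [Filter.eventually_prod_iff] at h1
  obtain ⟨pa, ha, pb, hb, hab⟩ := h1
  filter_upwards [ha, eventually_gt_atTop 0] with s hs hs0
  have hb' : ∀ y, pb y := by simpa using hb
  have hi : IntervalIntegrable (fun y => f (σ * s) y) volume 0 (2 * Real.pi) :=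
    intervalIntegrable_slice hf (mul_ne_zero hσ hs0.ne') 0 (2 * Real.pi)
  have e : ((s ^ r : ℝ) : ℂ) * zeroMode f (σ * s) - 2 * Real.pi * w s
      = ∫ y in (0 : ℝ)..(2 * Real.pi), (((s ^ r : ℝ) : ℂ) * f (σ * s) y - w s) := by
    rw [intervalIntegral.integral_sub (hi.const_mul _) intervalIntegrable_const,
      intervalIntegral.integral_const_mul, intervalIntegral.integral_const, zeroMode,
      Complex.real_smul]
    push_cast; ring
  rw [dist_zero_right, e]
  have := intervalIntegral.norm_integral_le_of_norm_le_const (a := (0 : ℝ)) (b := 2 * Real.pi)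
    (f := fun y => ((s ^ r : ℝ) : ℂ) * f (σ * s) y - w s) (C := ε / (2 * Real.pi) / 2)
    (fun y _ => by simpa using (hab hs (hb' y)).le)
  refine this.trans_lt ?_
  rw [sub_zero, abs_of_pos (by positivity)]
  field_simp
  norm_num

/-! ### Matching at the singularity -/

/-- The type-`II_a` condition for a function that is `c h + d (conj h)` to the right of the
singularity and `c' h + d' (conj h)` to its left, in terms of these coefficients; `B` is the
coefficient of `s^(1+α)` of the outgoing solution `h`. -/
structure Matching (a : ℂ) (γ : ℝ) (B c d c' d' : ℂ) : Prop where
  value : c + d = a * (c' + d')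
  flux : c' * B + d' * conj B + conj a * (c * B + d * conj B) = γ * (c' + d')

/-- The determinant of the matching conditions for the two outgoing coefficients. -/
noncomputable def matchDet (a : ℂ) (γ : ℝ) (B : ℂ) : ℂ := B * (1 + (‖a‖ : ℂ) ^ 2) - γ

lemma mul_conj_eq_norm_sq (a : ℂ) : a * conj a = (‖a‖ : ℂ) ^ 2 := by
  rw [Complex.mul_conj, Complex.normSq_eq_norm_sq]; push_cast; rfl

lemma Matching.right {a : ℂ} {γ : ℝ} {B c d c' : ℂ} (h : Matching a γ B c d c' 0) :
    c' * matchDet a γ B = d * (conj a * (B - conj B)) ∧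
      c * matchDet a γ B = d * (γ - (‖a‖ : ℂ) ^ 2 * conj B - B) := by
  have h1 := h.value
  have h2 := h.flux
  have hc : c = a * c' - d := by linear_combination h1
  subst hc
  simp only [matchDet, ← mul_conj_eq_norm_sq]
  have h3 : c' * (B * (1 + a * conj a) - γ) = d * (conj a * (B - conj B)) := by
    linear_combination h2
  exact ⟨h3, by linear_combination a * h3⟩

lemma Matching.left {a : ℂ} {γ : ℝ} {B c c' d' : ℂ} (h : Matching a γ B c 0 c' d') :
    c * matchDet a γ B = d' * (a * (B - conj B)) ∧
      c' * matchDet a γ B = d' * (γ - conj B - (‖a‖ : ℂ) ^ 2 * B) := by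
  have h1 := h.value
  have h2 := h.flux
  have hc : c = a * (c' + d') := by linear_combination h1
  subst hc
  simp only [matchDet, ← mul_conj_eq_norm_sq]
  have h3 : c' * (B * (1 + a * conj a) - γ) = d' * (γ - conj B - (a * conj a) * B) := by
    linear_combination h2
  exact ⟨by linear_combination a * h3, h3⟩

lemma matching_right {a : ℂ} {γ : ℝ} {B : ℂ} (hD : matchDet a γ B ≠ 0) :
    Matching a γ B ((γ - (‖a‖ : ℂ) ^ 2 * conj B - B) / matchDet a γ B) 1
      (conj a * (B - conj B) / matchDet a γ B) 0 := by
  constructor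
  · field_simp
    simp only [matchDet, ← mul_conj_eq_norm_sq]; ring
  · field_simp
    simp only [matchDet, ← mul_conj_eq_norm_sq]; ring

lemma matching_left {a : ℂ} {γ : ℝ} {B : ℂ} (hD : matchDet a γ B ≠ 0) :
    Matching a γ B (a * (B - conj B) / matchDet a γ B) 0
      ((γ - conj B - (‖a‖ : ℂ) ^ 2 * B) / matchDet a γ B) 1 := by
  constructor
  · field_simp
    simp only [matchDet, ← mul_conj_eq_norm_sq]; ring
  · field_simp
    simp only [matchDet, ← mul_conj_eq_norm_sq]; ring

/-- The reflected amplitudes from the two ends are, up to the common factor, conjugate. -/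
lemma norm_reflected_left (a : ℂ) (γ : ℝ) (B : ℂ) :
    ‖(γ - conj B - (‖a‖ : ℂ) ^ 2 * B : ℂ)‖ = ‖(γ - (‖a‖ : ℂ) ^ 2 * conj B - B : ℂ)‖ := by
  rw [← Complex.norm_conj]
  congr 1
  simp only [map_sub, map_mul, map_pow, Complex.conj_ofReal, Complex.conj_conj]
  ring

/-! ### Boundary values -/

lemma HasBoundaryValues.unique {α : ℝ} {g : ℝ → ℂ} {l : Filter ℝ} [l.NeBot] {g₀ g₁ k₀ k₁ : ℂ}
    (h : HasBoundaryValues α g l g₀ g₁) (h' : HasBoundaryValues α g l k₀ k₁) :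
    g₀ = k₀ ∧ g₁ = k₁ := by
  have h0 := tendsto_nhds_unique h.1 h'.1
  subst h0
  exact ⟨rfl, tendsto_nhds_unique h.2 h'.2⟩

lemma IsOutgoing.hasBoundaryValues {α E : ℝ} {h h' : ℝ → ℂ} {N B : ℂ}
    (H : IsOutgoing α E h h' N B) (hα0 : 0 ≤ α) {l : Filter ℝ}
    (hl : Tendsto (fun x : ℝ => |x|) l (𝓝[>] 0)) {g : ℝ → ℂ} {κ c d : ℂ}
    (hg : ∀ᶠ x in l, g x
      = κ * ((|x| ^ (-(α / 2)) : ℝ) : ℂ) * (c * h |x| + d * conj (h |x|))) :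
    HasBoundaryValues α g l (κ * (c + d)) (κ * (c * B + d * conj B)) := by
  have hpos : ∀ᶠ x in l, 0 < |x| := (tendsto_nhdsWithin_iff.1 hl).2
  constructor
  · refine (((H.tendsto_zero c d).comp hl).const_mul κ).congr' ?_
    filter_upwards [hg, hpos] with x hx hx0
    rw [hx]
    have : ((|x| ^ (α / 2) : ℝ) : ℂ) * ((|x| ^ (-(α / 2)) : ℝ) : ℂ) = 1 := by
      rw [← Complex.ofReal_mul, ← Real.rpow_add hx0]; simp
    simp only [Function.comp_apply]
    linear_combination (-κ * (c * h |x| + d * conj (h |x|))) * this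
  · refine (((H.tendsto_expansion hα0 c d).comp hl).const_mul κ).congr' ?_
    filter_upwards [hg, hpos] with x hx hx0
    rw [hx]
    have : ((|x| ^ (-(1 + α / 2)) : ℝ) : ℂ) * ((|x| ^ (-(α / 2)) : ℝ) : ℂ)
        = ((|x| ^ (-(1 + α)) : ℝ) : ℂ) := by
      rw [← Complex.ofReal_mul, ← Real.rpow_add hx0]
      congr 2; ring
    simp only [Function.comp_apply]
    rw [← this]
    ring

lemma tendsto_abs_nhdsGT : Tendsto (fun x : ℝ => |x|) (𝓝[>] 0) (𝓝[>] 0) := by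
  refine tendsto_nhdsWithin_iff.2 ⟨?_, ?_⟩
  · simpa using (continuous_abs.tendsto (0 : ℝ)).mono_left nhdsWithin_le_nhds
  · filter_upwards [self_mem_nhdsWithin] with x hx
    exact abs_pos.2 (show (0 : ℝ) < x from hx).ne'

lemma tendsto_abs_nhdsLT : Tendsto (fun x : ℝ => |x|) (𝓝[<] 0) (𝓝[>] 0) := by
  refine tendsto_nhdsWithin_iff.2 ⟨?_, ?_⟩
  · simpa using (continuous_abs.tendsto (0 : ℝ)).mono_left nhdsWithin_le_nhds
  · filter_upwards [self_mem_nhdsWithin] with x hx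
    exact abs_pos.2 (show x < (0 : ℝ) from hx).ne

lemma nhdsGT_inf_ae_neBot : (𝓝[>] (0 : ℝ) ⊓ ae volume).NeBot := by
  rw [inf_neBot_iff]
  intro s hs t ht
  obtain ⟨u, hu, hsu⟩ := mem_nhdsGT_iff_exists_Ioo_subset.1 hs
  have hu0 : (0 : ℝ) < u := hu
  by_contra hne
  have h1 : Ioo 0 u ⊆ tᶜ := fun x hx hxt => hne ⟨x, hsu hx, hxt⟩
  have h2 : volume (Ioo 0 u) = 0 := measure_mono_null h1 ht
  simp at h2
  linarith

lemma nhdsLT_inf_ae_neBot : (𝓝[<] (0 : ℝ) ⊓ ae volume).NeBot := by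
  rw [inf_neBot_iff]
  intro s hs t ht
  obtain ⟨u, hu, hsu⟩ := mem_nhdsLT_iff_exists_Ioo_subset.1 hs
  have hu0 : u < (0 : ℝ) := hu
  by_contra hne
  have h1 : Ioo u 0 ⊆ tᶜ := fun x hx hxt => hne ⟨x, hsu hx, hxt⟩
  have h2 : volume (Ioo u 0) = 0 := measure_mono_null h1 ht
  simp at h2
  linarith

/-- The normalisation `1 / √(2π)` of the Fourier modes. -/
noncomputable def fourierConst : ℂ := 1 / (√(2 * Real.pi) : ℂ)

lemma fourierConst_ne : fourierConst ≠ 0 := by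
  have : √(2 * Real.pi) ≠ 0 := (Real.sqrt_pos.2 (by positivity)).ne'
  exact one_div_ne_zero (by exact_mod_cast this)

lemma fibre_zero (α : ℝ) (χ : ℝ → ℝ) (f : ℝ → ℝ → ℂ) (x : ℝ) :
    fibre α 0 (fun x y => χ x * f x y) x
      = fourierConst * ((|x| ^ (-(α / 2)) : ℝ) : ℂ) * (χ x * zeroMode f x) := by
  simp only [fibre, zeroMode, fourierConst]
  rw [← intervalIntegral.integral_const_mul, ← intervalIntegral.integral_const_mul]
  refine intervalIntegral.integral_congr fun y _ => ?_
  simp only [Int.cast_zero, mul_zero, zero_mul, Complex.exp_zero, map_div₀, map_one,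
    Complex.conj_ofReal]
  ring

lemma exists_cutoff : ∃ χ : ℝ → ℝ, ContDiff ℝ ∞ χ ∧ HasCompactSupport χ ∧ ∀ᶠ x in 𝓝 0, χ x = 1 := by
  let χ : ContDiffBump (0 : ℝ) := ⟨1, 2, one_pos, one_lt_two⟩
  exact ⟨χ, χ.contDiff, χ.hasCompactSupport, χ.eventuallyEq_one⟩

/-- On each half of the cylinder the zero mode of a generalised eigenfunction is a combination of
the outgoing and the incoming solution, and the boundary condition links the coefficients. -/
lemma IsGeneralisedEigenfunction.exists_matching {α : ℝ} {a : ℂ} {γ E : ℝ} {f : ℝ → ℝ → ℂ}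
    (hf : IsGeneralisedEigenfunction α a γ E f) {h h' : ℝ → ℂ} {N B : ℂ}
    (H : IsOutgoing α E h h' N B) (hα0 : 0 ≤ α) (hB : conj B ≠ B) :
    ∃ c d c' d' : ℂ, (∀ s : ℝ, 0 < s → zeroMode f s = c * h s + d * conj (h s)) ∧
      (∀ s : ℝ, 0 < s → zeroMode f (-s) = c' * h s + d' * conj (h s)) ∧
      Matching a γ B c d c' d' := by
  obtain ⟨F', hF⟩ := hf.isRadialSolution (Or.inl rfl)
  obtain ⟨G', hG⟩ := hf.isRadialSolution (Or.inr rfl)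
  obtain ⟨c, d, hcd⟩ := H.exists_coeff hα0 hB hF
  obtain ⟨c', d', hcd'⟩ := H.exists_coeff hα0 hB hG
  simp only [one_mul] at hcd
  simp only [neg_mul, one_mul] at hcd'
  refine ⟨c, d, c', d', hcd, hcd', ?_⟩
  obtain ⟨χ, hχ1, hχ2, hχ3⟩ := exists_cutoff
  obtain ⟨g0m, g1m, g0p, g1p, hm, hp, e0, e1⟩ := (hf.local_domain χ hχ1 hχ2 hχ3).2 0
  have := nhdsGT_inf_ae_neBot
  have := nhdsLT_inf_ae_neBot
  have bp := H.hasBoundaryValues hα0 (l := 𝓝[>] 0 ⊓ ae volume) (c := c) (d := d)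
    (κ := fourierConst) (g := fibre α 0 (fun x y => χ x * f x y))
    (tendsto_abs_nhdsGT.mono_left inf_le_left) (by
      refine Filter.Eventually.filter_mono inf_le_left ?_
      filter_upwards [self_mem_nhdsWithin, hχ3.filter_mono nhdsWithin_le_nhds] with x hx hx1
      have hx0 : 0 < x := hx
      rw [fibre_zero, hx1, abs_of_pos hx0, hcd x hx0]; simp)
  have bm := H.hasBoundaryValues hα0 (l := 𝓝[<] 0 ⊓ ae volume) (c := c') (d := d')
    (κ := fourierConst) (g := fibre α 0 (fun x y => χ x * f x y))
    (tendsto_abs_nhdsLT.mono_left inf_le_left) (by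
      refine Filter.Eventually.filter_mono inf_le_left ?_
      filter_upwards [self_mem_nhdsWithin, hχ3.filter_mono nhdsWithin_le_nhds] with x hx hx1
      have hx0 : x < 0 := hx
      rw [fibre_zero, hx1, abs_of_neg hx0, ← hcd' (-x) (by linarith), neg_neg]; simp)
  obtain ⟨rfl, rfl⟩ := hp.unique bp
  obtain ⟨rfl, rfl⟩ := hm.unique bm
  have hκ := fourierConst_ne
  constructor
  · apply mul_left_cancel₀ hκ; linear_combination e0
  · apply mul_left_cancel₀ hκ; linear_combination e1

/-- The coefficients of a radial solution are its amplitudes at infinity, up to the amplitude `N` of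
the outgoing solution. -/
lemma IsOutgoing.coeff_eq {α E : ℝ} {h h' : ℝ → ℂ} {N B : ℂ} (H : IsOutgoing α E h h' N B)
    (hE : 0 < E) {F : ℝ → ℂ} {c d p q : ℂ}
    (hF : ∀ s : ℝ, 0 < s → F s = c * h s + d * conj (h s))
    (hlim : Tendsto (fun s : ℝ => ((s ^ (-(α / 2)) : ℝ) : ℂ) * F s
      - 2 * Real.pi * (p * planeWave (-√E) s + q * planeWave √E s)) atTop (𝓝 0)) :
    d * conj N = 2 * Real.pi * p ∧ c * N = 2 * Real.pi * q := by
  have h1 := hlim.sub (H.tendsto_infty c d)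
  rw [sub_zero] at h1
  have h2 := planeWave_independent (Real.sqrt_pos.2 hE) (q := d * conj N - 2 * Real.pi * p)
    (p := c * N - 2 * Real.pi * q) (h1.congr' (by
      filter_upwards [eventually_gt_atTop 0] with s hs
      rw [hF s hs]; ring))
  exact ⟨sub_eq_zero.1 h2.1, sub_eq_zero.1 h2.2⟩

lemma norm_ratio {N d c p q D X : ℂ} (hN : N ≠ 0) (hD : D ≠ 0) (hp : p ≠ 0)
    (h1 : d * conj N = 2 * Real.pi * p) (h2 : c * N = 2 * Real.pi * q) (h3 : c * D = d * X) :
    ‖q‖ ^ 2 / ‖p‖ ^ 2 = ‖X / D‖ ^ 2 := by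
  have hπ := Real.pi_pos
  have n1 := congrArg norm h1
  have n2 := congrArg norm h2
  have n3 := congrArg norm h3
  simp only [norm_mul, Complex.norm_conj, Complex.norm_ofNat, Complex.norm_real,
    Real.norm_of_nonneg hπ.le] at n1 n2 n3
  have hN' : 0 < ‖N‖ := norm_pos_iff.2 hN
  have hD' : 0 < ‖D‖ := norm_pos_iff.2 hD
  have hp' : 0 < ‖p‖ := norm_pos_iff.2 hp
  rw [norm_div, ← div_pow]
  congr 1
  rw [div_eq_div_iff hp'.ne' hD'.ne']
  apply mul_left_cancel₀ (mul_pos two_pos hπ).ne'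
  linear_combination ‖N‖ * n3 - ‖D‖ * n2 + ‖X‖ * n1

/-- The flux ratios of a scattering state, in terms of the coefficient `B` of the outgoing
solution. -/
lemma IsScatteringState.flux_ratios {α : ℝ} {a : ℂ} {γ E σ : ℝ} {f : ℝ → ℝ → ℂ}
    {cin cref ctr : ℂ} (hs : IsScatteringState α a γ E σ f cin cref ctr) (hσ : σ = 1 ∨ σ = -1)
    (hα0 : 0 ≤ α) (hE : 0 < E) {h h' : ℝ → ℂ} {N B : ℂ} (H : IsOutgoing α E h h' N B)
    (hB : conj B ≠ B) (hD : matchDet a γ B ≠ 0) :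
    ‖ctr‖ ^ 2 / ‖cin‖ ^ 2 = ‖conj a * (B - conj B) / matchDet a γ B‖ ^ 2 ∧
    ‖cref‖ ^ 2 / ‖cin‖ ^ 2 = ‖(γ - (‖a‖ : ℂ) ^ 2 * conj B - B) / matchDet a γ B‖ ^ 2 := by
  obtain ⟨c, d, c', d', hp, hm, M⟩ := hs.eigenfunction.exists_matching H hα0 hB
  have hcont := hs.eigenfunction.smooth.continuousOn
  have hσ0 : σ ≠ 0 := by rcases hσ with rfl | rfl <;> norm_num
  have hnear := tendsto_zeroMode
    (w := fun s => cin * planeWave (-√E) s + cref * planeWave √E s) hσ0 hcont hs.near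
  have hfar := tendsto_zeroMode (w := fun s => 0 * planeWave (-√E) s + ctr * planeWave √E s)
    (neg_ne_zero.2 hσ0) hcont (by simpa only [zero_mul, zero_add] using hs.far)
  have hN := H.amplitude_ne
  have hN' : conj N ≠ 0 := by simpa using hN
  rcases hσ with rfl | rfl
  · simp only [one_mul, neg_mul] at hnear hfar
    obtain ⟨i1, i2⟩ := H.coeff_eq hE hp hnear
    obtain ⟨j1, j2⟩ := H.coeff_eq hE hm (by simpa only [neg_mul, one_mul] using hfar)
    have hd' : d' = 0 := by simpa [hN'] using j1
    subst hd'
    exact ⟨norm_ratio hN hD hs.incident_ne i1 j2 M.right.1,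
      norm_ratio hN hD hs.incident_ne i1 i2 M.right.2⟩
  · simp only [neg_neg, one_mul, neg_mul] at hnear hfar
    obtain ⟨i1, i2⟩ := H.coeff_eq hE hm hnear
    obtain ⟨j1, j2⟩ := H.coeff_eq hE hp hfar
    have hd : d = 0 := by simpa [hN'] using j1
    subst hd
    refine ⟨?_, ?_⟩
    · rw [norm_ratio hN hD hs.incident_ne i1 j2 M.left.1]
      simp only [norm_div, norm_mul, Complex.norm_conj]
    · rw [norm_ratio hN hD hs.incident_ne i1 i2 M.left.2, norm_div, norm_div, norm_reflected_left]

/-! ### Integration on the Grushin cylinder -/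

/-- The weighted measure `|x|^(-α) dx` on the line. -/
noncomputable def lineVol (α : ℝ) : Measure ℝ :=
  volume.withDensity (fun x => ENNReal.ofReal (|x| ^ (-α)))

lemma measurable_weight (α : ℝ) : Measurable (fun x : ℝ => ENNReal.ofReal (|x| ^ (-α))) := by
  fun_prop

instance (α : ℝ) : SFinite (lineVol α) := by unfold lineVol; infer_instance

lemma vol_eq_prod (α : ℝ) :
    vol α = (lineVol α).prod (volume.restrict (Ioc 0 (2 * Real.pi))) := by
  rw [lineVol, prod_withDensity_left (measurable_weight α), vol]
  congr 1
  have : {p : ℝ × ℝ | p.1 ≠ 0 ∧ p.2 ∈ Ioc 0 (2 * Real.pi)} = ({0}ᶜ : Set ℝ) ×ˢ Ioc 0 (2 * Real.pi) := by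
    ext p; simp
  rw [this, Measure.volume_eq_prod, ← Measure.prod_restrict,
    Measure.restrict_eq_self_of_ae_mem (s := ({0}ᶜ : Set ℝ)) (compl_mem_ae_iff.2 (by simp))]

lemma locallyIntegrable_weight {α : ℝ} (hα1 : α < 1) :
    LocallyIntegrable (fun x : ℝ => |x| ^ (-α)) := by
  refine locallyIntegrable_of_norm_le_rpow (C := 1) (α := α) (by simp) (by simpa using hα1) ?_
    (by fun_prop : Measurable _).aestronglyMeasurable
  refine Eventually.of_forall fun x => ?_
  rw [Real.norm_of_nonneg (by positivity), one_mul, Real.norm_eq_abs]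

lemma lineVol_Icc_lt_top {α : ℝ} (hα1 : α < 1) (R : ℝ) : lineVol α (Icc (-R) R) < ⊤ := by
  rw [lineVol, withDensity_apply _ measurableSet_Icc]
  have h := (locallyIntegrable_weight hα1).integrableOn_isCompact (isCompact_Icc (a := -R) (b := R))
  exact h.lintegral_lt_top

lemma ae_vol (α : ℝ) : ∀ᵐ p ∂(vol α), p.1 ≠ 0 ∧ p.2 ∈ Ioc 0 (2 * Real.pi) := by
  refine (withDensity_absolutelyContinuous _ _).ae_le (ae_restrict_mem ?_)
  have : {p : ℝ × ℝ | p.1 ≠ 0 ∧ p.2 ∈ Ioc 0 (2 * Real.pi)} = ({0}ᶜ : Set ℝ) ×ˢ Ioc 0 (2 * Real.pi) := by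
    ext p; simp
  rw [this]
  exact (measurableSet_singleton 0).compl.prod measurableSet_Ioc

lemma aestronglyMeasurable_vol {α : ℝ} {g : ℝ × ℝ → ℂ} (hg : ContinuousOn g {p | p.1 ≠ 0}) :
    AEStronglyMeasurable g (vol α) := by
  have h1 : AEStronglyMeasurable g (volume.restrict {p : ℝ × ℝ | p.1 ≠ 0}) :=
    hg.aestronglyMeasurable isOpen_fst_ne_zero.measurableSet
  exact (h1.mono_measure (Measure.restrict_mono (fun p hp => hp.1) le_rfl)).mono_ac
    (withDensity_absolutelyContinuous _ _)

/-- Functions that are continuous off the singularity, bounded, and supported in a bounded part of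
the cylinder belong to every `L^q`. -/
lemma memLp_vol {α : ℝ} (hα1 : α < 1) {g : ℝ × ℝ → ℂ} (hg : ContinuousOn g {p | p.1 ≠ 0})
    {R C : ℝ} (hC : ∀ p : ℝ × ℝ, p.1 ≠ 0 → p.2 ∈ Ioc 0 (2 * Real.pi) → ‖g p‖ ≤ C)
    (hR : ∀ p : ℝ × ℝ, R < |p.1| → g p = 0) (q : ENNReal) : MemLp g q (vol α) := by
  set S : Set (ℝ × ℝ) := Icc (-R) R ×ˢ univ with hS
  have hSm : MeasurableSet S := measurableSet_Icc.prod MeasurableSet.univ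
  have hind : S.indicator g = g := by
    refine indicator_eq_self.2 fun p hp => ⟨?_, mem_univ _⟩
    by_contra h
    refine hp (hR p ?_)
    rw [mem_Icc, ← abs_le, not_le] at h
    exact h
  rw [← hind, memLp_indicator_iff_restrict hSm]
  have : IsFiniteMeasure ((vol α).restrict S) := by
    refine ⟨?_⟩
    rw [Measure.restrict_apply_univ, vol_eq_prod, hS, Measure.prod_prod]
    exact ENNReal.mul_lt_top (lineVol_Icc_lt_top hα1 R) (measure_lt_top _ _)
  refine MemLp.of_bound (aestronglyMeasurable_vol hg).restrict C ?_
  filter_upwards [ae_restrict_of_ae (ae_vol α)] with p hp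
  exact hC p hp.1 hp.2

lemma isCompact_annulus (ε R : ℝ) : IsCompact {x : ℝ | ε ≤ |x| ∧ |x| ≤ R} := by
  refine (isCompact_Icc (a := -R) (b := R)).of_isClosed_subset ?_ fun x hx => abs_le.1 hx.2
  exact (isClosed_le continuous_const continuous_abs).inter
    (isClosed_le continuous_abs continuous_const)

lemma integrable_vol_of_support {α : ℝ} (hα1 : α < 1) {g : ℝ × ℝ → ℂ}
    (hg : ContinuousOn g {p | p.1 ≠ 0}) {ε R : ℝ} (hε : 0 < ε)
    (hs : ∀ p : ℝ × ℝ, g p ≠ 0 → ε ≤ |p.1| ∧ |p.1| ≤ R) : Integrable g (vol α) := by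
  obtain ⟨C, hC⟩ := ((isCompact_annulus ε R).prod
    (isCompact_Icc (a := (0 : ℝ)) (b := 2 * Real.pi))).exists_bound_of_continuousOn
    (hg.mono fun p hp => by
      have := hp.1.1
      exact abs_pos.1 (hε.trans_le this))
  rw [← memLp_one_iff_integrable]
  refine memLp_vol hα1 hg (C := max C 0) (R := R) (fun p hp hp2 => ?_) (fun p hp => ?_) 1
  · by_cases h : g p = 0
    · simp [h]
    · exact (hC p ⟨hs p h, Ioc_subset_Icc_self hp2⟩).trans (le_max_left _ _)
  · by_contra h
    exact absurd (hs p h).2 (not_le.2 hp)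

lemma integrable_line_of_support {g : ℝ → ℂ} (hg : ContinuousOn g {0}ᶜ) {ε R : ℝ} (hε : 0 < ε)
    (hs : ∀ x : ℝ, g x ≠ 0 → ε ≤ |x| ∧ |x| ≤ R) : Integrable g := by
  rw [← integrableOn_iff_integrable_of_support_subset (s := {x : ℝ | ε ≤ |x| ∧ |x| ≤ R}) hs]
  refine ContinuousOn.integrableOn_compact (isCompact_annulus ε R) (hg.mono fun x hx => ?_)
  exact abs_pos.1 (hε.trans_le hx.1)

lemma integral_lineVol (α : ℝ) (g : ℝ → ℂ) :
    ∫ x, g x ∂(lineVol α) = ∫ x, ((|x| ^ (-α) : ℝ) : ℂ) * g x := by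
  rw [lineVol, integral_withDensity_eq_integral_toReal_smul (measurable_weight α) (by simp)]
  refine integral_congr_ae (Eventually.of_forall fun x => ?_)
  simp only
  rw [ENNReal.toReal_ofReal (by positivity), Complex.real_smul]

/-! ### Test functions -/

section TestFunction

variable {φ : ℝ × ℝ → ℂ} {ε R : ℝ}

lemma support_fderiv_apply (hs : ∀ p : ℝ × ℝ, φ p ≠ 0 → ε ≤ |p.1| ∧ |p.1| ≤ R) (v : ℝ × ℝ)
    (p : ℝ × ℝ) (hp : fderiv ℝ φ p v ≠ 0) : ε ≤ |p.1| ∧ |p.1| ≤ R := by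
  have hc : IsClosed {p : ℝ × ℝ | ε ≤ |p.1| ∧ |p.1| ≤ R} :=
    (isClosed_le continuous_const continuous_fst.abs).inter
      (isClosed_le continuous_fst.abs continuous_const)
  have h1 : p ∈ Function.support (fderiv ℝ φ) := fun h => hp (by rw [h]; rfl)
  exact closure_minimal (fun q hq => hs q hq) hc (support_fderiv_subset ℝ h1)

lemma contDiff_fderiv_apply (hφ : ContDiff ℝ ∞ φ) (v : ℝ × ℝ) :
    ContDiff ℝ ∞ (fun p => fderiv ℝ φ p v) :=
  (hφ.fderiv_right (by simp)).clm_apply contDiff_const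

lemma laplaceBeltrami_eq {α : ℝ} {f : ℝ → ℝ → ℂ} (hφ : ContDiff ℝ ∞ (fun p : ℝ × ℝ => f p.1 p.2))
    (x y : ℝ) :
    laplaceBeltrami α f x y
      = fderiv ℝ (fun p => fderiv ℝ (fun p : ℝ × ℝ => f p.1 p.2) p (1, 0)) (x, y) (1, 0)
        - ((α / x : ℝ) : ℂ) * fderiv ℝ (fun p : ℝ × ℝ => f p.1 p.2) (x, y) (1, 0)
        + ((|x| ^ (2 * α) : ℝ) : ℂ) *
          fderiv ℝ (fun p => fderiv ℝ (fun p : ℝ × ℝ => f p.1 p.2) p (0, 1)) (x, y) (0, 1) := by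
  have hd : Differentiable ℝ (fun p : ℝ × ℝ => f p.1 p.2) := hφ.differentiable (by simp)
  have h1 : ∀ v, Differentiable ℝ (fun p => fderiv ℝ (fun p : ℝ × ℝ => f p.1 p.2) p v) :=
    fun v => (contDiff_fderiv_apply hφ v).differentiable (by simp)
  have e1 : deriv (fun s => f s y) = fun s => fderiv ℝ (fun p : ℝ × ℝ => f p.1 p.2) (s, y) (1, 0) := by
    ext s; exact (hasDerivAt_fst (hd (s, y))).deriv
  have e2 : deriv (fun s => f x s) = fun s => fderiv ℝ (fun p : ℝ × ℝ => f p.1 p.2) (x, s) (0, 1) := by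
    ext s; exact (hasDerivAt_snd (hd (x, s))).deriv
  rw [laplaceBeltrami, e1, e2, (hasDerivAt_fst (h1 (1, 0) (x, y))).deriv,
    (hasDerivAt_snd (h1 (0, 1) (x, y))).deriv]

end TestFunction

lemma hasDerivAt_abs_rpow_of_ne {x : ℝ} (hx : x ≠ 0) (r : ℝ) :
    HasDerivAt (fun t : ℝ => ((|t| ^ r : ℝ) : ℂ)) ((r / x : ℝ) * ((|x| ^ r : ℝ) : ℂ)) x := by
  have h1 := ((hasDerivAt_abs hx).rpow_const (p := r) (Or.inl (abs_pos.2 hx).ne')).ofReal_comp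
  refine h1.congr_deriv ?_
  rw [Real.rpow_sub_one (abs_pos.2 hx).ne']
  have h2 : SignType.sign x / |x| = 1 / x := by
    rcases lt_or_gt_of_ne hx with h | h
    · rw [abs_of_neg h, sign_neg h]; field_simp; simp
    · rw [abs_of_pos h, sign_pos h]; simp
  rw [← Complex.ofReal_mul]
  congr 1
  calc _ = r * |x| ^ r * ((SignType.sign x : ℝ) / |x|) := by ring
    _ = _ := by rw [h2]; ring

/-- Radial functions are tested against by parts: the difference of the two sides is the integral
of the `x`-derivative of `|x|^(-α) (φ̄ u' - φ̄_x u)` minus that of `|x|^(2α) φ̄_yy u`, which vanishes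
by periodicity. -/
lemma integral_laplaceBeltrami_mul {α : ℝ} (hα1 : α < 1) {φ : ℝ → ℝ → ℂ} (hφ : IsTestFunction φ)
    {u u1 u2 w : ℝ → ℂ} (h1 : ∀ x, x ≠ 0 → HasDerivAt u (u1 x) x)
    (h2 : ∀ x, x ≠ 0 → HasDerivAt u1 (u2 x) x) (hu2 : ContinuousOn u2 {0}ᶜ)
    (hw : ∀ x, x ≠ 0 → w x = -(u2 x - ((α / x : ℝ) : ℂ) * u1 x)) :
    ∫ p : ℝ × ℝ, conj (-laplaceBeltrami α φ p.1 p.2) * u p.1 ∂(vol α)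
      = ∫ p : ℝ × ℝ, conj (φ p.1 p.2) * w p.1 ∂(vol α) := by
  obtain ⟨hper, hsm, ε, R, hε, hsupp⟩ := hφ
  set g : ℝ × ℝ → ℂ := fun p => φ p.1 p.2 with hg
  have hsg : ∀ p : ℝ × ℝ, g p ≠ 0 → ε ≤ |p.1| ∧ |p.1| ≤ R := fun p hp => hsupp _ _ hp
  set gx : ℝ × ℝ → ℂ := fun p => fderiv ℝ g p (1, 0) with hgx
  set gy : ℝ × ℝ → ℂ := fun p => fderiv ℝ g p (0, 1) with hgy
  set gxx : ℝ × ℝ → ℂ := fun p => fderiv ℝ gx p (1, 0) with hgxx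
  set gyy : ℝ × ℝ → ℂ := fun p => fderiv ℝ gy p (0, 1) with hgyy
  have sgx := support_fderiv_apply hsg (1, 0)
  have sgy := support_fderiv_apply hsg (0, 1)
  have sgxx := support_fderiv_apply sgx (1, 0)
  have sgyy := support_fderiv_apply sgy (0, 1)
  have cgx : ContDiff ℝ ∞ gx := contDiff_fderiv_apply hsm _
  have cgy : ContDiff ℝ ∞ gy := contDiff_fderiv_apply hsm _
  have cgxx : ContDiff ℝ ∞ gxx := contDiff_fderiv_apply cgx _
  have cgyy : ContDiff ℝ ∞ gyy := contDiff_fderiv_apply cgy _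
  have hΔ : ∀ x y, laplaceBeltrami α φ x y = gxx (x, y) - ((α / x : ℝ) : ℂ) * gx (x, y)
      + ((|x| ^ (2 * α) : ℝ) : ℂ) * gyy (x, y) := laplaceBeltrami_eq hsm
  have cu : ContinuousOn u {0}ᶜ := fun x hx => (h1 x hx).continuousAt.continuousWithinAt
  have cu1 : ContinuousOn u1 {0}ᶜ := fun x hx => (h2 x hx).continuousAt.continuousWithinAt
  have cdiv : ContinuousOn (fun x : ℝ => ((α / x : ℝ) : ℂ)) {0}ᶜ :=
    Complex.continuous_ofReal.comp_continuousOn (continuousOn_const.div continuousOn_id fun x hx => hx)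
  have cpow : ∀ r : ℝ, ContinuousOn (fun x : ℝ => ((|x| ^ r : ℝ) : ℂ)) {0}ᶜ := fun r x hx =>
    (hasDerivAt_abs_rpow_of_ne hx r).continuousAt.continuousWithinAt
  have cw : ContinuousOn w {0}ᶜ :=
    (hu2.sub (cdiv.mul cu1)).neg.congr fun x hx => hw x hx
  have toP : ∀ {v : ℝ → ℂ}, ContinuousOn v {0}ᶜ →
      ContinuousOn (fun p : ℝ × ℝ => v p.1) {p | p.1 ≠ 0} := fun hv =>
    hv.comp continuousOn_fst fun p hp => hp
  -- the radial and the angular part of the difference of the two sides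
  set D1 : ℝ × ℝ → ℂ := fun p =>
    conj (-(gxx p - ((α / p.1 : ℝ) : ℂ) * gx p)) * u p.1 - conj (g p) * w p.1 with hD1
  set D2 : ℝ × ℝ → ℂ := fun p => ((|p.1| ^ (2 * α) : ℝ) : ℂ) * conj (gyy p) * u p.1 with hD2
  have conjC : ∀ {v : ℝ × ℝ → ℂ} {s : Set (ℝ × ℝ)}, ContinuousOn v s →
      ContinuousOn (fun p => conj (v p)) s := fun hv => Complex.continuous_conj.comp_continuousOn hv
  have cD1 : ContinuousOn D1 {p | p.1 ≠ 0} :=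
    ((conjC ((cgxx.continuous.continuousOn.sub ((toP cdiv).mul cgx.continuous.continuousOn)).neg)).mul
      (toP cu)).sub ((conjC hsm.continuous.continuousOn).mul (toP cw))
  have cD2 : ContinuousOn D2 {p | p.1 ≠ 0} :=
    ((toP (cpow (2 * α))).mul (conjC cgyy.continuous.continuousOn)).mul (toP cu)
  have sD1 : ∀ p : ℝ × ℝ, D1 p ≠ 0 → ε ≤ |p.1| ∧ |p.1| ≤ R := by
    intro p hp
    by_contra hn
    have z1 : g p = 0 := by by_contra h; exact hn (hsg p h)
    have z2 : gx p = 0 := by by_contra h; exact hn (sgx p h)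
    have z3 : gxx p = 0 := by by_contra h; exact hn (sgxx p h)
    exact hp (by simp [hD1, z1, z2, z3])
  have sD2 : ∀ p : ℝ × ℝ, D2 p ≠ 0 → ε ≤ |p.1| ∧ |p.1| ≤ R := by
    intro p hp
    by_contra hn
    have z1 : gyy p = 0 := by by_contra h; exact hn (sgyy p h)
    exact hp (by simp [hD2, z1])
  have iD1 : Integrable D1 (vol α) := integrable_vol_of_support hα1 cD1 hε sD1
  have iD2 : Integrable D2 (vol α) := integrable_vol_of_support hα1 cD2 hε sD2
  have iφw : Integrable (fun p : ℝ × ℝ => conj (g p) * w p.1) (vol α) := by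
    refine integrable_vol_of_support (R := R) hα1 ((conjC hsm.continuous.continuousOn).mul (toP cw)) hε ?_
    intro p hp
    exact hsg p fun h => hp (by simp [h])
  have hI1 : ∫ p, D1 p ∂(vol α) = 0 := by
    rw [vol_eq_prod] at iD1 ⊢
    rw [integral_prod_symm _ iD1]
    have : ∀ y : ℝ, ∫ x, D1 (x, y) ∂(lineVol α) = 0 := by
      intro y
      rw [integral_lineVol]
      set Q : ℝ → ℂ := fun x =>
        ((|x| ^ (-α) : ℝ) : ℂ) * (conj (g (x, y)) * u1 x - conj (gx (x, y)) * u x) with hQ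
      have hslice : ContinuousOn (fun x : ℝ => (x, y)) ({0}ᶜ : Set ℝ) := by fun_prop
      have hQd : ∀ x, HasDerivAt Q (((|x| ^ (-α) : ℝ) : ℂ) * D1 (x, y)) x := by
        intro x
        by_cases hx : x = 0
        · subst hx
          have z : D1 (0, y) = 0 := by
            by_contra h
            have := (sD1 (0, y) h).1
            simp at this; linarith
          rw [z, mul_zero]
          refine (hasDerivAt_const (0 : ℝ) (0 : ℂ)).congr_of_eventuallyEq ?_
          filter_upwards [Metric.ball_mem_nhds (0 : ℝ) hε] with t ht
          rw [mem_ball_zero_iff, Real.norm_eq_abs] at ht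
          have z1 : g (t, y) = 0 := by
            by_contra h; exact absurd (hsg (t, y) h).1 (not_le.2 ht)
          have z2 : gx (t, y) = 0 := by
            by_contra h; exact absurd (sgx (t, y) h).1 (not_le.2 ht)
          simp [hQ, z1, z2]
        · have d1 : HasDerivAt (fun t => conj (g (t, y))) (conj (gx (x, y))) x :=
            (hasDerivAt_fst (p := (x, y)) ((hsm.differentiable (by simp)) (x, y))).star
          have d2 : HasDerivAt (fun t => conj (gx (t, y))) (conj (gxx (x, y))) x :=
            (hasDerivAt_fst (p := (x, y)) ((cgx.differentiable (by simp)) (x, y))).star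
          refine ((hasDerivAt_abs_rpow_of_ne hx (-α)).mul
            ((d1.mul (h2 x hx)).sub (d2.mul (h1 x hx)))).congr_deriv ?_
          simp only [hD1, Pi.sub_apply, Pi.mul_apply, hw x hx, map_neg, map_sub, map_mul,
            Complex.conj_ofReal]
          push_cast
          ring
      refine integral_eq_zero_of_hasDerivAt_of_integrable hQd ?_ ?_
      · refine integrable_line_of_support (ε := ε) (R := R)
          ((cpow (-α)).mul (cD1.comp hslice fun x hx => hx)) hε ?_
        intro x hx
        exact sD1 (x, y) fun h => hx (by simp [h])
      · refine integrable_line_of_support (ε := ε) (R := R) (fun x hx =>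
          (hQd x).continuousAt.continuousWithinAt) hε ?_
        intro x hx
        by_contra hn
        have z1 : g (x, y) = 0 := by by_contra h; exact hn (hsg (x, y) h)
        have z2 : gx (x, y) = 0 := by by_contra h; exact hn (sgx (x, y) h)
        exact hx (by simp [hQ, z1, z2])
    simp [this]
  have hI2 : ∫ p, D2 p ∂(vol α) = 0 := by
    rw [vol_eq_prod] at iD2 ⊢
    rw [integral_prod _ iD2]
    have : ∀ x : ℝ, ∫ y in Ioc 0 (2 * Real.pi), D2 (x, y) = 0 := by
      intro x
      have hz : ∫ y in Ioc 0 (2 * Real.pi), gyy (x, y) = 0 := by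
        rw [← intervalIntegral.integral_of_le (by positivity),
          intervalIntegral.integral_eq_sub_of_hasDerivAt (f := fun y => gy (x, y))
          (fun y _ => hasDerivAt_snd (p := (x, y)) ((cgy.differentiable (by simp)) (x, y)))
          ((cgyy.continuous.comp (by fun_prop : Continuous fun y : ℝ => (x, y))).intervalIntegrable _ _)]
        have hd : Differentiable ℝ g := hsm.differentiable (by simp)
        have e1 := (hasDerivAt_snd (hd (x, 0 + 2 * Real.pi))).comp_add_const 0 (2 * Real.pi)
        have e2 := hasDerivAt_snd (hd (x, 0))
        have e3 : (fun s => g (x, s + 2 * Real.pi)) = fun s => g (x, s) := by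
          ext s; exact hper x s
        simp only [e3] at e1
        rw [sub_eq_zero]
        simpa [hgy] using e1.unique e2
      have e : ∀ y, D2 (x, y) = ((|x| ^ (2 * α) : ℝ) : ℂ) * u x * conj (gyy (x, y)) := by
        intro y; simp only [hD2]; ring
      simp only [e]
      rw [integral_const_mul, integral_conj, hz]; simp
    simp [this]
  have hsplit : ∀ p : ℝ × ℝ, conj (-laplaceBeltrami α φ p.1 p.2) * u p.1
      = (D1 p - D2 p) + conj (g p) * w p.1 := by
    intro p
    rw [hΔ]
    simp only [hD1, hD2, map_neg, map_sub, map_mul, map_add, Complex.conj_ofReal]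
    ring
  simp only [hsplit]
  have e := integral_add (iD1.sub iD2) iφw
  simp only [Pi.sub_apply] at e
  rw [e, integral_sub iD1 iD2, hI1, hI2]
  simp [hg]

/-! ### Radial scattering states -/

section Radial

variable {α E : ℝ} {F F1 : ℝ → ℂ}

lemma laplaceBeltrami_radial {u u1 : ℝ → ℂ} {u2 : ℂ} {x : ℝ} (hx : x ≠ 0)
    (h1 : ∀ x, x ≠ 0 → HasDerivAt u (u1 x) x) (h2 : HasDerivAt u1 u2 x) (y : ℝ) :
    laplaceBeltrami α (fun x _ => u x) x y = u2 - ((α / x : ℝ) : ℂ) * u1 x := by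
  have e : deriv (fun s => u s) =ᶠ[𝓝 x] u1 := by
    filter_upwards [isOpen_ne.mem_nhds hx] with s hs
    exact (h1 s hs).deriv
  simp only [laplaceBeltrami]
  rw [e.deriv_eq, h2.deriv, (h1 x hx).deriv]
  simp

lemma support_deriv_cutoff {χ : ℝ → ℝ} (hc : HasCompactSupport χ) (h1 : ∀ᶠ x in 𝓝 0, χ x = 1) :
    ∃ ε R : ℝ, 0 < ε ∧ (∀ x, R < |x| → χ x = 0) ∧
      (∀ x, deriv χ x ≠ 0 → ε ≤ |x| ∧ |x| ≤ R) ∧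
      (∀ x, deriv (deriv χ) x ≠ 0 → ε ≤ |x| ∧ |x| ≤ R) := by
  obtain ⟨R, hR⟩ := hc.isCompact.isBounded.exists_norm_le
  obtain ⟨ε, hε, hball⟩ := Metric.eventually_nhds_iff_ball.1 h1
  have hout : ∀ x, R < |x| → x ∉ tsupport χ := fun x hx h => absurd (hR x h) (not_le.2 hx)
  have hloc : ∀ x, |x| < ε → χ =ᶠ[𝓝 x] fun _ => 1 := by
    intro x hx
    filter_upwards [Metric.isOpen_ball.mem_nhds
      (show x ∈ Metric.ball (0 : ℝ) ε by simpa using hx)] with t ht using hball t ht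
  have hd0 : ∀ x, |x| < ε → deriv χ x = 0 := fun x hx => by rw [(hloc x hx).deriv_eq]; simp
  have hdd0 : ∀ x, |x| < ε → deriv (deriv χ) x = 0 := fun x hx => by
    rw [(hloc x hx).deriv.deriv_eq]; simp
  refine ⟨ε, R, hε, fun x hx => image_eq_zero_of_notMem_tsupport (hout x hx), fun x hx => ⟨?_, ?_⟩,
    fun x hx => ⟨?_, ?_⟩⟩
  · by_contra h; exact hx (hd0 x (not_le.1 h))
  · by_contra h
    exact hout x (not_le.1 h) (support_deriv_subset hx)
  · by_contra h; exact hx (hdd0 x (not_le.1 h))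
  · by_contra h
    refine hout x (not_le.1 h) ?_
    exact tsupport_deriv_subset (support_deriv_subset hx)

/-- A bounded radial solution, cut off near the singularity, lies in the domain of the adjoint. -/
lemma adjointGraph_radial (hα1 : α < 1) (h1 : ∀ x, x ≠ 0 → HasDerivAt F (F1 x) x)
    (h2 : ∀ x, x ≠ 0 → HasDerivAt F1 (((α / x : ℝ) : ℂ) * F1 x - E * F x) x)
    (hbd : ∀ R : ℝ, ∃ C, ∀ x, x ≠ 0 → |x| ≤ R → ‖F x‖ ≤ C)
    {χ : ℝ → ℝ} (hχ : ContDiff ℝ ∞ χ) (hc : HasCompactSupport χ) (hχ1 : ∀ᶠ x in 𝓝 0, χ x = 1) :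
    AdjointGraph α (fun x _ => χ x * F x)
      (fun x y => -laplaceBeltrami α (fun x' _ => χ x' * F x') x y) := by
  obtain ⟨ε, R, hε, s0, s1, s2⟩ := support_deriv_cutoff hc hχ1
  have hχd : Differentiable ℝ χ := hχ.differentiable (by simp)
  have hχ' : ContDiff ℝ ∞ (deriv χ) := (contDiff_infty_iff_deriv.1 hχ).2
  have hχ'd : Differentiable ℝ (deriv χ) := hχ'.differentiable (by simp)
  have hχ'' : Continuous (deriv (deriv χ)) := ((contDiff_infty_iff_deriv.1 hχ').2).continuous
  set u : ℝ → ℂ := fun x => χ x * F x with hu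
  set u1 : ℝ → ℂ := fun x => deriv χ x * F x + χ x * F1 x with hu1
  set u2 : ℝ → ℂ := fun x => deriv (deriv χ) x * F x + 2 * (deriv χ x * F1 x)
    + χ x * (((α / x : ℝ) : ℂ) * F1 x - E * F x) with hu2
  have d1 : ∀ x, x ≠ 0 → HasDerivAt u (u1 x) x := fun x hx =>
    (hχd x).hasDerivAt.ofReal_comp.mul (h1 x hx)
  have d2 : ∀ x, x ≠ 0 → HasDerivAt u1 (u2 x) x := fun x hx => by
    refine (((hχ'd x).hasDerivAt.ofReal_comp.mul (h1 x hx)).add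
      ((hχd x).hasDerivAt.ofReal_comp.mul (h2 x hx))).congr_deriv ?_
    simp only [hu2]; ring
  have cF : ContinuousOn F {0}ᶜ := fun x hx => (h1 x hx).continuousAt.continuousWithinAt
  have cF1 : ContinuousOn F1 {0}ᶜ := fun x hx => (h2 x hx).continuousAt.continuousWithinAt
  have cu : ContinuousOn u {0}ᶜ := fun x hx => (d1 x hx).continuousAt.continuousWithinAt
  have cdiv : ContinuousOn (fun x : ℝ => ((α / x : ℝ) : ℂ)) {0}ᶜ :=
    Complex.continuous_ofReal.comp_continuousOn (continuousOn_const.div continuousOn_id fun x hx => hx)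
  have cχ : ∀ {v : ℝ → ℝ}, Continuous v → ContinuousOn (fun x => ((v x : ℝ) : ℂ)) ({0}ᶜ : Set ℝ) :=
    fun hv => (Complex.continuous_ofReal.comp hv).continuousOn
  have cu2 : ContinuousOn u2 {0}ᶜ :=
    (((cχ hχ'').mul cF).add (continuousOn_const.mul ((cχ hχ'.continuous).mul cF1))).add
      ((cχ hχ.continuous).mul ((cdiv.mul cF1).sub (continuousOn_const.mul cF)))
  -- the terms of the image of `χ F` in which a derivative falls on the cutoff
  set rest : ℝ → ℂ := fun x => -(deriv (deriv χ) x * F x + 2 * (deriv χ x * F1 x))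
    + ((α / x : ℝ) : ℂ) * (deriv χ x * F x) with hrest
  have crest : ContinuousOn rest {0}ᶜ :=
    (((cχ hχ'').mul cF).add (continuousOn_const.mul ((cχ hχ'.continuous).mul cF1))).neg.add
      (cdiv.mul ((cχ hχ'.continuous).mul cF))
  have srest : ∀ x, rest x ≠ 0 → ε ≤ |x| ∧ |x| ≤ R := by
    intro x hx
    by_contra hn
    have z1 : deriv χ x = 0 := by by_contra h; exact hn (s1 x h)
    have z2 : deriv (deriv χ) x = 0 := by by_contra h; exact hn (s2 x h)
    exact hx (by simp [hrest, z1, z2])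
  set w : ℝ → ℂ := fun x => E * u x + rest x with hwdef
  have hw : ∀ x, x ≠ 0 → w x = -(u2 x - ((α / x : ℝ) : ℂ) * u1 x) := by
    intro x _
    simp only [hwdef, hrest, hu2, hu1, hu]; ring
  have hL : ∀ x y, x ≠ 0 → -laplaceBeltrami α (fun x' _ => u x') x y = w x := by
    intro x y hx
    rw [laplaceBeltrami_radial hx d1 (d2 x hx), hw x hx]
  obtain ⟨C, hC⟩ := hbd R
  obtain ⟨K, hK⟩ := hc.exists_bound_of_continuous hχ.continuous
  have hub : ∀ x, x ≠ 0 → ‖u x‖ ≤ max (K * C) 0 := by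
    intro x hx
    by_cases hxR : |x| ≤ R
    · refine le_trans ?_ (le_max_left _ _)
      simp only [hu]
      rw [norm_mul, Complex.norm_real]
      exact mul_le_mul (hK x) (hC x hx hxR) (norm_nonneg _) ((norm_nonneg _).trans (hK x))
    · simp [hu, s0 x (not_le.1 hxR)]
  obtain ⟨C2, hC2⟩ := (isCompact_annulus ε R).exists_bound_of_continuousOn
    (crest.mono fun x hx => abs_pos.1 (hε.trans_le hx.1))
  have hrb : ∀ x, ‖rest x‖ ≤ max C2 0 := by
    intro x
    by_cases h : rest x = 0
    · simp [h]
    · exact (hC2 x (srest x h)).trans (le_max_left _ _)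
  have toP : ∀ {v : ℝ → ℂ}, ContinuousOn v {0}ᶜ →
      ContinuousOn (fun p : ℝ × ℝ => v p.1) {p | p.1 ≠ 0} := fun hv =>
    hv.comp continuousOn_fst fun p hp => hp
  have cw : ContinuousOn w {0}ᶜ := (continuousOn_const.mul cu).add crest
  have uz : ∀ x, R < |x| → u x = 0 := fun x hx => by simp [hu, s0 x hx]
  have wz : ∀ x, R < |x| → w x = 0 := fun x hx => by
    have : rest x = 0 := by by_contra h; exact absurd (srest x h).2 (not_le.2 hx)
    simp [hwdef, uz x hx, this]
  have ae_w : (fun p : ℝ × ℝ => -laplaceBeltrami α (fun x' _ => u x') p.1 p.2)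
      =ᵐ[vol α] fun p => w p.1 := by
    filter_upwards [ae_vol α] with p hp using hL p.1 p.2 hp.1
  refine ⟨⟨fun x y => rfl, ?_⟩, ⟨fun x y => by simp [laplaceBeltrami], ?_⟩, fun φ hφ => ?_⟩
  · exact memLp_vol hα1 (toP cu) (R := R) (fun p hp _ => hub p.1 hp) (fun p hp => uz p.1 hp) 2
  · refine (memLp_congr_ae ae_w).2 ?_
    refine memLp_vol hα1 (toP cw) (R := R) (C := |E| * max (K * C) 0 + max C2 0)
      (fun p hp _ => ?_) (fun p hp => wz p.1 hp) 2
    refine (norm_add_le _ _).trans (add_le_add ?_ (hrb _))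
    rw [norm_mul, Complex.norm_real, Real.norm_eq_abs]
    exact mul_le_mul_of_nonneg_left (hub p.1 hp) (abs_nonneg _)
  · rw [integral_laplaceBeltrami_mul hα1 hφ d1 d2 cu2 hw]
    refine integral_congr_ae ?_
    filter_upwards [ae_w] with p hp
    rw [← hp]

end Radial

lemma integral_fourierMode {k : ℤ} (hk : k ≠ 0) :
    ∫ y in (0 : ℝ)..(2 * Real.pi), conj (Complex.exp (Complex.I * k * y)) = 0 := by
  have hc : -(Complex.I * k) ≠ 0 := by
    simp [hk]
  have e : ∀ y : ℝ, conj (Complex.exp (Complex.I * k * y)) = Complex.exp (-(Complex.I * k) * y) := by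
    intro y
    rw [← Complex.exp_conj]
    simp
  simp only [e]
  rw [integral_exp_mul_complex hc]
  have : -(Complex.I * k) * ((2 * Real.pi : ℝ) : ℂ) = (-k : ℤ) * (2 * Real.pi * Complex.I) := by
    push_cast; ring
  rw [this, Complex.exp_int_mul_two_pi_mul_I]
  simp

lemma fibre_radial_of_ne_zero (α : ℝ) {k : ℤ} (hk : k ≠ 0) (u : ℝ → ℂ) (x : ℝ) :
    fibre α k (fun x _ => u x) x = 0 := by
  simp only [fibre]
  rw [intervalIntegral.integral_mul_const]
  simp only [map_div₀]
  rw [intervalIntegral.integral_div, integral_fourierMode hk]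
  simp

/-- The radial function equal to `c h + d (conj h)` to the right of the singularity and to
`c' h + d' (conj h)` (at `|x|`) to its left. -/
noncomputable def glue (h : ℝ → ℂ) (c d c' d' : ℂ) (x : ℝ) : ℂ :=
  if 0 < x then c * h x + d * conj (h x) else c' * h (-x) + d' * conj (h (-x))

lemma glue_of_pos {h : ℝ → ℂ} {c d c' d' : ℂ} {x : ℝ} (hx : 0 < x) :
    glue h c d c' d' x = c * h x + d * conj (h x) := if_pos hx

lemma glue_of_neg {h : ℝ → ℂ} {c d c' d' : ℂ} {x : ℝ} (hx : x < 0) :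
    glue h c d c' d' x = c' * h (-x) + d' * conj (h (-x)) := if_neg hx.not_gt

section Glue

variable {α E : ℝ} {h h' : ℝ → ℂ} {N B : ℂ}

lemma IsOutgoing.glue_ode (H : IsOutgoing α E h h' N B) (c d c' d' : ℂ) :
    ∃ F1 : ℝ → ℂ, (∀ x, x ≠ 0 → HasDerivAt (glue h c d c' d') (F1 x) x) ∧
      ∀ x, x ≠ 0 → HasDerivAt F1 (((α / x : ℝ) : ℂ) * F1 x - E * glue h c d c' d' x) x := by
  have R1 := H.isRadialSolution.linear H.isRadialSolution.conj c d
  have R2 := H.isRadialSolution.linear H.isRadialSolution.conj c' d'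
  refine ⟨fun x => if 0 < x then c * h' x + d * conj (h' x)
    else -(c' * h' (-x) + d' * conj (h' (-x))), fun x hx => ?_, fun x hx => ?_⟩
  · rcases lt_or_gt_of_ne hx with h0 | h0
    · have e : glue h c d c' d' =ᶠ[𝓝 x] fun x => c' * h (-x) + d' * conj (h (-x)) := by
        filter_upwards [Iio_mem_nhds h0] with t ht using glue_of_neg ht
      beta_reduce
      rw [if_neg h0.not_gt]
      refine (((R2 (-x) (by linarith)).1.scomp x (hasDerivAt_neg x)).congr_deriv ?_).congr_of_eventuallyEq e
      simp [add_comm]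
    · have e : glue h c d c' d' =ᶠ[𝓝 x] fun x => c * h x + d * conj (h x) := by
        filter_upwards [Ioi_mem_nhds h0] with t ht using glue_of_pos ht
      beta_reduce
      rw [if_pos h0]
      exact (R1 x h0).1.congr_of_eventuallyEq e
  · rcases lt_or_gt_of_ne hx with h0 | h0
    · have e : (fun x : ℝ => if 0 < x then c * h' x + d * conj (h' x)
          else -(c' * h' (-x) + d' * conj (h' (-x))))
          =ᶠ[𝓝 x] fun x => -(c' * h' (-x) + d' * conj (h' (-x))) := by
        filter_upwards [Iio_mem_nhds h0] with t ht
        exact if_neg (not_lt.2 (le_of_lt ht))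
      beta_reduce
      rw [if_neg h0.not_gt, glue_of_neg h0]
      refine (((R2 (-x) (by linarith)).2.scomp x (hasDerivAt_neg x)).neg.congr_deriv
        ?_).congr_of_eventuallyEq e
      simp only [neg_smul, one_smul, Complex.ofReal_div, Complex.ofReal_neg, div_neg]
      ring
    · have e : (fun x : ℝ => if 0 < x then c * h' x + d * conj (h' x)
          else -(c' * h' (-x) + d' * conj (h' (-x))))
          =ᶠ[𝓝 x] fun x => c * h' x + d * conj (h' x) := by
        filter_upwards [Ioi_mem_nhds h0] with t ht
        exact if_pos ht
      beta_reduce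
      rw [if_pos h0, glue_of_pos h0]
      exact (R1 x h0).2.congr_of_eventuallyEq e

lemma IsOutgoing.bounded (H : IsOutgoing α E h h' N B) (R : ℝ) :
    ∃ C, ∀ s, 0 < s → s ≤ R → ‖h s‖ ≤ C := by
  have h1 : ∀ᶠ s in 𝓝[>] (0 : ℝ), ‖h s‖ < 2 :=
    H.zero.norm.eventually_lt_const (by simp)
  obtain ⟨δ, hδ, hsub⟩ := mem_nhdsGT_iff_exists_Ioo_subset.1 h1
  have hδ' : (0 : ℝ) < δ := hδ
  have hcont : ContinuousOn h (Icc δ R) := fun s hs =>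
    (H.deriv s (hδ'.trans_le hs.1)).continuousAt.continuousWithinAt
  obtain ⟨C, hC⟩ := isCompact_Icc.exists_bound_of_continuousOn hcont
  refine ⟨max 2 C, fun s hs hsR => ?_⟩
  by_cases hsδ : s < δ
  · exact (hsub ⟨hs, hsδ⟩).le.trans (le_max_left _ _)
  · exact (hC s ⟨not_lt.1 hsδ, hsR⟩).trans (le_max_right _ _)

lemma IsOutgoing.glue_bounded (H : IsOutgoing α E h h' N B) (c d c' d' : ℂ) (R : ℝ) :
    ∃ C, ∀ x, x ≠ 0 → |x| ≤ R → ‖glue h c d c' d' x‖ ≤ C := by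
  obtain ⟨C, hC⟩ := H.bounded R
  have key : ∀ (p q : ℂ) (s : ℝ), 0 < s → s ≤ R →
      ‖p * h s + q * conj (h s)‖ ≤ (‖p‖ + ‖q‖) * C := by
    intro p q s hs hsR
    refine (norm_add_le _ _).trans ?_
    rw [norm_mul, norm_mul, Complex.norm_conj, ← add_mul]
    exact mul_le_mul_of_nonneg_left (hC s hs hsR) (by positivity)
  refine ⟨max ((‖c‖ + ‖d‖) * C) ((‖c'‖ + ‖d'‖) * C), fun x hx hxR => ?_⟩
  rcases lt_or_gt_of_ne hx with h0 | h0
  · rw [glue_of_neg h0]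
    rw [abs_of_neg h0] at hxR
    exact (key c' d' (-x) (by linarith) hxR).trans (le_max_right _ _)
  · rw [glue_of_pos h0]
    rw [abs_of_pos h0] at hxR
    exact (key c d x h0 hxR).trans (le_max_left _ _)

lemma contDiffOn_of_ode {F F1 : ℝ → ℂ} (h1 : ∀ x, x ≠ 0 → HasDerivAt F (F1 x) x)
    (h2 : ∀ x, x ≠ 0 → HasDerivAt F1 (((α / x : ℝ) : ℂ) * F1 x - E * F x) x) :
    ContDiffOn ℝ 2 F {0}ᶜ := by
  have ho : IsOpen ({0}ᶜ : Set ℝ) := isOpen_compl_singleton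
  have step : ∀ {n : WithTop ℕ∞} {u v : ℝ → ℂ}, n ≠ ω → (∀ x, x ≠ 0 → HasDerivAt u (v x) x) →
      ContDiffOn ℝ n v {0}ᶜ → ContDiffOn ℝ (n + 1) u {0}ᶜ := by
    intro n u v hn hd hv
    rw [contDiffOn_succ_iff_deriv_of_isOpen ho]
    exact ⟨fun x hx => (hd x hx).differentiableAt.differentiableWithinAt, fun h => absurd h hn,
      hv.congr fun x hx => (hd x hx).deriv⟩
  have cF : ContinuousOn F {0}ᶜ := fun x hx => (h1 x hx).continuousAt.continuousWithinAt
  have cF1 : ContinuousOn F1 {0}ᶜ := fun x hx => (h2 x hx).continuousAt.continuousWithinAt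
  have cdiv : ContinuousOn (fun x : ℝ => ((α / x : ℝ) : ℂ)) {0}ᶜ :=
    Complex.continuous_ofReal.comp_continuousOn (continuousOn_const.div continuousOn_id fun x hx => hx)
  have c2 : ContDiffOn ℝ 0 (fun x => ((α / x : ℝ) : ℂ) * F1 x - E * F x) {0}ᶜ :=
    contDiffOn_zero.2 ((cdiv.mul cF1).sub (continuousOn_const.mul cF))
  have := step (n := 0 + 1) (by simp) h1 (step (by simp) h2 c2)
  rwa [zero_add, one_add_one_eq_two] at this

/-- If the coefficients satisfy the matching conditions, the glued function is a generalised
eigenfunction. -/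
lemma IsOutgoing.isGeneralisedEigenfunction (H : IsOutgoing α E h h' N B) (hα0 : 0 ≤ α)
    (hα1 : α < 1) {a : ℂ} {γ : ℝ} {c d c' d' : ℂ} (M : Matching a γ B c d c' d') :
    IsGeneralisedEigenfunction α a γ E (fun x _ => glue h c d c' d' x) := by
  obtain ⟨F1, h1, h2⟩ := H.glue_ode c d c' d'
  constructor
  · exact fun x y => rfl
  · exact (contDiffOn_of_ode h1 h2).comp contDiffOn_fst fun p hp => hp
  · intro x y hx
    rw [laplaceBeltrami_radial hx h1 (h2 x hx)]; ring
  · intro χ hχ hc hχ1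
    refine ⟨adjointGraph_radial hα1 h1 h2 (H.glue_bounded c d c' d') hχ hc hχ1, fun k => ?_⟩
    by_cases hk : k = 0
    · subst hk
      have hz : ∀ x, zeroMode (fun x _ => glue h c d c' d' x) x
          = 2 * Real.pi * glue h c d c' d' x := by
        intro x
        simp only [zeroMode, intervalIntegral.integral_const, Complex.real_smul]
        push_cast; ring
      have bp := H.hasBoundaryValues hα0 (l := 𝓝[>] 0 ⊓ ae volume) (c := c) (d := d)
        (κ := fourierConst * (2 * Real.pi))
        (g := fibre α 0 (fun x y => χ x * (fun x _ => glue h c d c' d' x) x y))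
        (tendsto_abs_nhdsGT.mono_left inf_le_left) (by
          refine Filter.Eventually.filter_mono inf_le_left ?_
          filter_upwards [self_mem_nhdsWithin, hχ1.filter_mono nhdsWithin_le_nhds] with x hx hx1
          have hx0 : 0 < x := hx
          rw [fibre_zero, hx1, hz, glue_of_pos hx0, abs_of_pos hx0]; push_cast; ring)
      have bm := H.hasBoundaryValues hα0 (l := 𝓝[<] 0 ⊓ ae volume) (c := c') (d := d')
        (κ := fourierConst * (2 * Real.pi))
        (g := fibre α 0 (fun x y => χ x * (fun x _ => glue h c d c' d' x) x y))
        (tendsto_abs_nhdsLT.mono_left inf_le_left) (by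
          refine Filter.Eventually.filter_mono inf_le_left ?_
          filter_upwards [self_mem_nhdsWithin, hχ1.filter_mono nhdsWithin_le_nhds] with x hx hx1
          have hx0 : x < 0 := hx
          rw [fibre_zero, hx1, hz, glue_of_neg hx0, abs_of_neg hx0]; push_cast; ring)
      refine ⟨_, _, _, _, bm, bp, ?_, ?_⟩
      · rw [M.value]; ring
      · linear_combination (fourierConst * (2 * Real.pi)) * M.flux
    · have hz : fibre α k (fun x y => χ x * (fun x _ => glue h c d c' d' x) x y) = fun _ => 0 :=
        funext fun x => fibre_radial_of_ne_zero α hk (fun x => χ x * glue h c d c' d' x) x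
      rw [hz]
      refine ⟨0, 0, 0, 0, ⟨by simp [tendsto_const_nhds], by simp [tendsto_const_nhds]⟩,
        ⟨by simp [tendsto_const_nhds], by simp [tendsto_const_nhds]⟩, by simp, by simp⟩

lemma IsOutgoing.tendsto_glue_right (H : IsOutgoing α E h h' N B) (c d c' d' : ℂ) :
    Tendsto (fun s : ℝ => ((s ^ (-(α / 2)) : ℝ) : ℂ) * glue h c d c' d' s
      - (d * conj N * planeWave (-√E) s + c * N * planeWave √E s)) atTop (𝓝 0) := by
  refine (H.tendsto_infty c d).congr' ?_
  filter_upwards [eventually_gt_atTop 0] with s hs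
  rw [glue_of_pos hs]

lemma IsOutgoing.tendsto_glue_left (H : IsOutgoing α E h h' N B) (c d c' d' : ℂ) :
    Tendsto (fun s : ℝ => ((s ^ (-(α / 2)) : ℝ) : ℂ) * glue h c d c' d' (-s)
      - (d' * conj N * planeWave (-√E) s + c' * N * planeWave √E s)) atTop (𝓝 0) := by
  refine (H.tendsto_infty c' d').congr' ?_
  filter_upwards [eventually_gt_atTop 0] with s hs
  rw [glue_of_neg (by linarith), neg_neg]

lemma IsOutgoing.exists_isScatteringState (H : IsOutgoing α E h h' N B) (hα0 : 0 ≤ α)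
    (hα1 : α < 1) {a : ℂ} {γ σ : ℝ} (hσ : σ = 1 ∨ σ = -1) (hD : matchDet a γ B ≠ 0) :
    ∃ f cin cref ctr, IsScatteringState α a γ E σ f cin cref ctr := by
  have hN : conj N ≠ 0 := by simpa using H.amplitude_ne
  rcases hσ with rfl | rfl
  · have M := matching_right hD
    refine ⟨_, 1 * conj N, ((γ - (‖a‖ : ℂ) ^ 2 * conj B - B) / matchDet a γ B) * N,
      (conj a * (B - conj B) / matchDet a γ B) * N, H.isGeneralisedEigenfunction hα0 hα1 M,
      mul_ne_zero one_ne_zero hN, ?_, ?_⟩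
    · simpa only [one_mul, Function.comp_def] using
        (H.tendsto_glue_right _ 1 _ 0).comp tendsto_fst
    · simpa only [one_mul, neg_mul, zero_mul, zero_add, Function.comp_def] using
        (H.tendsto_glue_left _ 1 _ 0).comp tendsto_fst
  · have M := matching_left hD
    refine ⟨_, 1 * conj N, ((γ - conj B - (‖a‖ : ℂ) ^ 2 * B) / matchDet a γ B) * N,
      (a * (B - conj B) / matchDet a γ B) * N, H.isGeneralisedEigenfunction hα0 hα1 M,
      mul_ne_zero one_ne_zero hN, ?_, ?_⟩
    · simpa only [one_mul, neg_mul, Function.comp_def] using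
        (H.tendsto_glue_left _ 0 _ 1).comp tendsto_fst
    · simpa only [one_mul, neg_mul, neg_neg, zero_mul, zero_add, Function.comp_def] using
        (H.tendsto_glue_right _ 0 _ 1).comp tendsto_fst

end Glue

/-! ### The scattering coefficients in closed form -/

section Coefficients

variable {α E : ℝ}

/-- The modulus of the connection coefficient `outCoeff α E`. -/
noncomputable def outModulus (α E : ℝ) : ℝ :=
  E ^ ((1 + α) / 2) * Real.Gamma ((1 - α) / 2) / (2 ^ (1 + α) * Real.Gamma ((3 + α) / 2))

lemma outModulus_pos (hα0 : 0 ≤ α) (hα1 : α < 1) (hE : 0 < E) : 0 < outModulus α E := by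
  have h1 : 0 < Real.Gamma ((1 - α) / 2) := Real.Gamma_pos_of_pos (by linarith)
  have h2 : 0 < Real.Gamma ((3 + α) / 2) := Real.Gamma_pos_of_pos (by linarith)
  have h3 : 0 < E ^ ((1 + α) / 2) := Real.rpow_pos_of_pos hE _
  unfold outModulus
  positivity

lemma outCoeff_eq (α E : ℝ) : outCoeff α E =
    ⟨outModulus α E * Real.sin (Real.pi / 2 * α), outModulus α E * Real.cos (Real.pi / 2 * α)⟩ := by
  have e : -(Complex.I * ((Real.pi / 2 * α : ℝ) : ℂ)) = ((-(Real.pi / 2 * α) : ℝ) : ℂ) * Complex.I := by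
    push_cast; ring
  unfold outCoeff
  rw [e, Complex.exp_mul_I, ← Complex.ofReal_cos, ← Complex.ofReal_sin, ← outModulus]
  generalize Real.pi / 2 * α = θ
  apply Complex.ext
  · simp [mul_comm, -Complex.ofReal_sin, -Complex.ofReal_cos]
  · simp [mul_comm, -Complex.ofReal_sin, -Complex.ofReal_cos]

lemma cos_half_pi_mul_pos (hα0 : 0 ≤ α) (hα1 : α < 1) : 0 < Real.cos (Real.pi / 2 * α) := by
  have := Real.pi_pos
  exact Real.cos_pos_of_mem_Ioo ⟨by nlinarith, by nlinarith⟩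

lemma sin_half_pi_mul_pos (hα0 : 0 < α) (hα1 : α < 1) : 0 < Real.sin (Real.pi / 2 * α) := by
  have := Real.pi_pos
  exact Real.sin_pos_of_pos_of_lt_pi (by positivity) (by nlinarith)

lemma one_sub_cos_pi_mul (α : ℝ) :
    1 - Real.cos (Real.pi * α) = 2 * Real.sin (Real.pi / 2 * α) ^ 2 := by
  rw [show Real.pi * α = 2 * (Real.pi / 2 * α) by ring, Real.cos_two_mul]
  linarith [Real.sin_sq_add_cos_sq (Real.pi / 2 * α)]

/-- The common denominator of the coefficients, for `‖a‖ = n` and connection coefficient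
`k (sin θ + i cos θ)`. -/
noncomputable def fluxDen (n γ k θ : ℝ) : ℝ :=
  ((1 + n ^ 2) * (k * Real.cos θ)) ^ 2 + (γ - (1 + n ^ 2) * (k * Real.sin θ)) ^ 2

/-- The transmission coefficient for `‖a‖ = n` and connection coefficient `k (sin θ + i cos θ)`. -/
noncomputable def fluxT (n γ k θ : ℝ) : ℝ := 4 * n ^ 2 * (k * Real.cos θ) ^ 2 / fluxDen n γ k θ

/-- The reflection coefficient for `‖a‖ = n` and connection coefficient `k (sin θ + i cos θ)`. -/
noncomputable def fluxR (n γ k θ : ℝ) : ℝ :=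
  (((1 - n ^ 2) * (k * Real.cos θ)) ^ 2 + (γ - (1 + n ^ 2) * (k * Real.sin θ)) ^ 2)
    / fluxDen n γ k θ

lemma fluxDen_pos (n γ : ℝ) {k θ : ℝ} (hk : 0 < k) (hθ : 0 < Real.cos θ) :
    0 < fluxDen n γ k θ := by
  unfold fluxDen; positivity

lemma fluxT_add_fluxR (n γ : ℝ) {k θ : ℝ} (hk : 0 < k) (hθ : 0 < Real.cos θ) :
    fluxT n γ k θ + fluxR n γ k θ = 1 := by
  have hD := (fluxDen_pos n γ hk hθ).ne'
  rw [fluxT, fluxR, ← add_div, div_eq_one_iff_eq hD, fluxDen]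
  ring

lemma fluxR_eq_zero_iff {n : ℝ} (γ : ℝ) {k θ : ℝ} (hn : 0 ≤ n) (hk : 0 < k)
    (hθ : 0 < Real.cos θ) : fluxR n γ k θ = 0 ↔ n = 1 ∧ γ = 2 * k * Real.sin θ := by
  have hD := (fluxDen_pos n γ hk hθ).ne'
  have hkθ : k * Real.cos θ ≠ 0 := (mul_pos hk hθ).ne'
  rw [fluxR, div_eq_zero_iff, or_iff_left hD]
  constructor
  · intro h
    have h1 : (1 - n ^ 2) * (k * Real.cos θ) = 0 := by
      refine pow_eq_zero_iff two_ne_zero |>.1 (le_antisymm ?_ (sq_nonneg _))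
      linarith [sq_nonneg (γ - (1 + n ^ 2) * (k * Real.sin θ))]
    have h2 : γ - (1 + n ^ 2) * (k * Real.sin θ) = 0 := by
      refine pow_eq_zero_iff two_ne_zero |>.1 (le_antisymm ?_ (sq_nonneg _))
      linarith [sq_nonneg ((1 - n ^ 2) * (k * Real.cos θ))]
    have h3 : n ^ 2 = 1 := by linarith [(mul_eq_zero.1 h1).resolve_right hkθ]
    rw [h3] at h2
    exact ⟨(pow_eq_one_iff_of_nonneg hn two_ne_zero).1 h3, by linarith⟩
  · rintro ⟨rfl, rfl⟩
    ring

lemma norm_sq_matchDet (a : ℂ) (γ k θ : ℝ) :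
    ‖matchDet a γ ⟨k * Real.sin θ, k * Real.cos θ⟩‖ ^ 2 = fluxDen ‖a‖ γ k θ := by
  have e : matchDet a γ ⟨k * Real.sin θ, k * Real.cos θ⟩
      = ⟨(1 + ‖a‖ ^ 2) * (k * Real.sin θ) - γ, (1 + ‖a‖ ^ 2) * (k * Real.cos θ)⟩ := by
    apply Complex.ext <;> simp [matchDet, ← Complex.ofReal_pow, mul_comm]
  rw [e, Complex.sq_norm, Complex.normSq_mk, fluxDen]
  ring

lemma norm_sq_transmitted (a : ℂ) (γ k θ : ℝ) {B : ℂ} (hB : B = ⟨k * Real.sin θ, k * Real.cos θ⟩) :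
    ‖conj a * (B - conj B) / matchDet a γ B‖ ^ 2 = fluxT ‖a‖ γ k θ := by
  have e : B - conj B = ⟨0, 2 * (k * Real.cos θ)⟩ := by
    subst hB
    apply Complex.ext
    · simp
    · simp; ring
  rw [norm_div, norm_mul, div_pow, mul_pow, Complex.norm_conj, e, Complex.sq_norm ⟨0, _⟩,
    Complex.normSq_mk, hB, norm_sq_matchDet, fluxT]
  ring

lemma norm_sq_reflected (a : ℂ) (γ k θ : ℝ) {B : ℂ} (hB : B = ⟨k * Real.sin θ, k * Real.cos θ⟩) :
    ‖(γ - (‖a‖ : ℂ) ^ 2 * conj B - B) / matchDet a γ B‖ ^ 2 = fluxR ‖a‖ γ k θ := by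
  have e : (γ - (‖a‖ : ℂ) ^ 2 * conj B - B : ℂ)
      = ⟨γ - (1 + ‖a‖ ^ 2) * (k * Real.sin θ), -((1 - ‖a‖ ^ 2) * (k * Real.cos θ))⟩ := by
    subst hB
    apply Complex.ext
    · simp [← Complex.ofReal_pow]; ring
    · simp [← Complex.ofReal_pow]; ring
  rw [norm_div, div_pow, e, Complex.sq_norm ⟨_, _⟩, Complex.normSq_mk, hB, norm_sq_matchDet, fluxR]
  ring

/-- The flux ratios are the same for all scattering states, from either end. -/
lemma isCoefficient (hα0 : 0 ≤ α) (hα1 : α < 1) (hE : 0 < E) (a : ℂ) (γ : ℝ) :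
    IsTransmissionCoefficient α a γ E (fluxT ‖a‖ γ (outModulus α E) (Real.pi / 2 * α)) ∧
      IsReflectionCoefficient α a γ E (fluxR ‖a‖ γ (outModulus α E) (Real.pi / 2 * α)) := by
  obtain ⟨h, h', N, H⟩ := exists_isOutgoing hα0 hα1 hE
  have hk := outModulus_pos hα0 hα1 hE
  have hc := cos_half_pi_mul_pos hα0 hα1
  have hB := outCoeff_eq α E
  have hB' : conj (outCoeff α E) ≠ outCoeff α E := by
    intro h0
    have := congrArg Complex.im h0
    rw [hB, Complex.conj_im] at this
    simp only at this
    linarith [mul_pos hk hc]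
  have hD : matchDet a γ (outCoeff α E) ≠ 0 := by
    intro h0
    have := fluxDen_pos ‖a‖ γ hk hc
    rw [← norm_sq_matchDet, ← hB, h0] at this
    simp at this
  refine ⟨fun σ hσ => ⟨H.exists_isScatteringState hα0 hα1 hσ hD, fun f cin cref ctr hs => ?_⟩,
    fun σ hσ => ⟨H.exists_isScatteringState hα0 hα1 hσ hD, fun f cin cref ctr hs => ?_⟩⟩
  · rw [(hs.flux_ratios hσ hα0 hE H hB' hD).1, norm_sq_transmitted a γ _ _ hB]
  · rw [(hs.flux_ratios hσ hα0 hE H hB' hD).2, norm_sq_reflected a γ _ _ hB]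

lemma transmission_eq (hα0 : 0 ≤ α) (hα1 : α < 1) (hE : 0 < E) (a : ℂ) (γ : ℝ) :
    transmission α a γ E = fluxT ‖a‖ γ (outModulus α E) (Real.pi / 2 * α) := by
  have h := (isCoefficient hα0 hα1 hE a γ).1
  have h' : IsTransmissionCoefficient α a γ E (transmission α a γ E) := Classical.epsilon_spec ⟨_, h⟩
  obtain ⟨⟨f, cin, cref, ctr, hs⟩, h1⟩ := h 1 (Or.inl rfl)
  rw [← h1 _ _ _ _ hs, ← (h' 1 (Or.inl rfl)).2 _ _ _ _ hs]

lemma reflection_eq (hα0 : 0 ≤ α) (hα1 : α < 1) (hE : 0 < E) (a : ℂ) (γ : ℝ) :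
    reflection α a γ E = fluxR ‖a‖ γ (outModulus α E) (Real.pi / 2 * α) := by
  have h := (isCoefficient hα0 hα1 hE a γ).2
  have h' : IsReflectionCoefficient α a γ E (reflection α a γ E) := Classical.epsilon_spec ⟨_, h⟩
  obtain ⟨⟨f, cin, cref, ctr, hs⟩, h1⟩ := h 1 (Or.inl rfl)
  rw [← h1 _ _ _ _ hs, ← (h' 1 (Or.inl rfl)).2 _ _ _ _ hs]

/-- Multiplied by `-i 2^(1+α) Γ((3+α)/2) e^(iπα/2)`, the matching determinant and the two amplitudes
become polynomials in `e^(iπα/2)`. -/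
lemma scaled_amplitudes (hα0 : 0 ≤ α) (a : ℂ) (γ : ℝ) :
    ∃ z : ℂ, z ≠ 0 ∧
      ((E ^ ((1 + α) / 2) : ℝ) : ℂ) * (Real.Gamma ((1 - α) / 2) : ℂ) * (1 + (‖a‖ : ℂ) ^ 2)
          + Complex.I * γ * (((2 : ℝ) ^ (1 + α) : ℝ) : ℂ)
            * Complex.exp (Complex.I * (Real.pi / 2) * α) * (Real.Gamma ((3 + α) / 2) : ℂ)
        = z * matchDet a γ (outCoeff α E) ∧
      ((E ^ ((1 + α) / 2) : ℝ) : ℂ) * (1 + Complex.exp (Complex.I * Real.pi * α))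
          * (Real.Gamma ((1 - α) / 2) : ℂ) * conj a
        = z * (conj a * (outCoeff α E - conj (outCoeff α E))) ∧
      ((E ^ ((1 + α) / 2) : ℝ) : ℂ) * (Real.Gamma ((1 - α) / 2) : ℂ)
          * (1 - (‖a‖ : ℂ) ^ 2 * Complex.exp (Complex.I * Real.pi * α))
          + Complex.I * γ * (((2 : ℝ) ^ (1 + α) : ℝ) : ℂ)
            * Complex.exp (Complex.I * (Real.pi / 2) * α) * (Real.Gamma ((3 + α) / 2) : ℂ)
        = -z * (γ - (‖a‖ : ℂ) ^ 2 * conj (outCoeff α E) - outCoeff α E) := by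
  have hG : (Real.Gamma ((3 + α) / 2) : ℂ) ≠ 0 :=
    Complex.ofReal_ne_zero.2 (Real.Gamma_pos_of_pos (by linarith)).ne'
  have h2 : (((2 : ℝ) ^ (1 + α) : ℝ) : ℂ) ≠ 0 :=
    Complex.ofReal_ne_zero.2 (Real.rpow_pos_of_pos two_pos _).ne'
  set e := Complex.exp (Complex.I * (Real.pi / 2) * α) with he
  have e0 : e ≠ 0 := Complex.exp_ne_zero _
  have esq : Complex.exp (Complex.I * Real.pi * α) = e ^ 2 := by
    rw [he, ← Complex.exp_nat_mul]; congr 1; push_cast; ring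
  have einv : Complex.exp (-(Complex.I * ((Real.pi / 2 * α : ℝ) : ℂ))) = e⁻¹ := by
    rw [he, ← Complex.exp_neg]; congr 1; push_cast; ring
  have econj : conj e⁻¹ = e := by
    rw [← einv, ← Complex.exp_conj, he]; congr 1
    simp only [map_neg, map_mul, Complex.conj_I, Complex.conj_ofReal]
    push_cast; ring
  have hB : outCoeff α E = Complex.I * e⁻¹ * (((E ^ ((1 + α) / 2) : ℝ) : ℂ)
      * (Real.Gamma ((1 - α) / 2) : ℂ)
      / ((((2 : ℝ) ^ (1 + α) : ℝ) : ℂ) * (Real.Gamma ((3 + α) / 2) : ℂ))) := by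
    rw [outCoeff, einv, Complex.ofReal_div, Complex.ofReal_mul, Complex.ofReal_mul]
  have hB' : conj (outCoeff α E) = -Complex.I * e * (((E ^ ((1 + α) / 2) : ℝ) : ℂ)
      * (Real.Gamma ((1 - α) / 2) : ℂ)
      / ((((2 : ℝ) ^ (1 + α) : ℝ) : ℂ) * (Real.Gamma ((3 + α) / 2) : ℂ))) := by
    rw [hB]
    simp only [map_mul, map_div₀, Complex.conj_ofReal, Complex.conj_I, econj]
  rw [esq, hB', hB]
  generalize (((2 : ℝ) ^ (1 + α) : ℝ) : ℂ) = t at *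
  generalize (Real.Gamma ((3 + α) / 2) : ℂ) = G at *
  generalize (Real.Gamma ((1 - α) / 2) : ℂ) = g at *
  generalize ((E ^ ((1 + α) / 2) : ℝ) : ℂ) = ε at *
  refine ⟨-Complex.I * t * G * e, by simp [h2, hG, e0], ?_, ?_, ?_⟩
  · rw [matchDet]
    field_simp
    linear_combination (ε * g * (1 + (‖a‖ : ℂ) ^ 2)) * Complex.I_sq
  · field_simp
    linear_combination (ε * g * (1 + e ^ 2) * conj a) * Complex.I_sq
  · field_simp
    linear_combination (ε * g * (1 - (‖a‖ : ℂ) ^ 2 * e ^ 2)) * Complex.I_sq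

lemma tendsto_outModulus_atTop (hα0 : 0 ≤ α) (hα1 : α < 1) :
    Tendsto (outModulus α) atTop atTop := by
  have h1 : 0 < Real.Gamma ((1 - α) / 2) := Real.Gamma_pos_of_pos (by linarith)
  have h2 : 0 < Real.Gamma ((3 + α) / 2) := Real.Gamma_pos_of_pos (by linarith)
  exact ((tendsto_rpow_atTop (by linarith)).atTop_mul_const h1).atTop_div_const (by positivity)

lemma tendsto_outModulus_zero (hα0 : 0 ≤ α) : Tendsto (outModulus α) (𝓝[>] 0) (𝓝 0) := by
  have h : Tendsto (fun E : ℝ => E ^ ((1 + α) / 2)) (𝓝[>] 0) (𝓝 0) := by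
    have := (Real.continuousAt_rpow_const (0 : ℝ) ((1 + α) / 2) (Or.inr (by linarith))).tendsto
    rw [Real.zero_rpow (by linarith)] at this
    exact this.mono_left nhdsWithin_le_nhds
  have := (h.mul_const (Real.Gamma ((1 - α) / 2))).div_const
    (2 ^ (1 + α) * Real.Gamma ((3 + α) / 2))
  rwa [zero_mul, zero_div] at this

lemma tendsto_fluxT_atTop (n γ : ℝ) {θ : ℝ} (hθ : 0 < Real.cos θ) :
    Tendsto (fun k => fluxT n γ k θ) atTop
      (𝓝 (2 * n ^ 2 * (1 + Real.cos (2 * θ)) / (1 + n ^ 2) ^ 2)) := by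
  have hinv : Tendsto (fun k : ℝ => γ / k) atTop (𝓝 0) := tendsto_const_nhds.div_atTop tendsto_id
  have hden : Tendsto (fun k : ℝ => ((1 + n ^ 2) * Real.cos θ) ^ 2
      + (γ / k - (1 + n ^ 2) * Real.sin θ) ^ 2) atTop (𝓝 (((1 + n ^ 2) * Real.cos θ) ^ 2
      + (0 - (1 + n ^ 2) * Real.sin θ) ^ 2)) :=
    ((hinv.sub_const _).pow 2).const_add _
  have e : ((1 + n ^ 2) * Real.cos θ) ^ 2 + (0 - (1 + n ^ 2) * Real.sin θ) ^ 2
      = (1 + n ^ 2) ^ 2 := by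
    linear_combination (1 + n ^ 2) ^ 2 * Real.sin_sq_add_cos_sq θ
  rw [e] at hden
  have h := (tendsto_const_nhds (x := 4 * n ^ 2 * Real.cos θ ^ 2)).div hden (by positivity)
  rw [Real.cos_two_mul, show 2 * n ^ 2 * (1 + (2 * Real.cos θ ^ 2 - 1)) = 4 * n ^ 2 * Real.cos θ ^ 2
    by ring]
  refine h.congr' ?_
  filter_upwards [eventually_gt_atTop 0] with k hk
  have hD := (fluxDen_pos n γ hk hθ).ne'
  have hD' : ((1 + n ^ 2) * Real.cos θ) ^ 2 + (γ / k - (1 + n ^ 2) * Real.sin θ) ^ 2 ≠ 0 := by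
    positivity
  simp only [Pi.div_apply]
  rw [fluxT, div_eq_div_iff hD' hD, fluxDen]
  field_simp

lemma tendsto_fluxT_zero (n θ : ℝ) {γ : ℝ} (hγ : γ ≠ 0) :
    Tendsto (fun k => fluxT n γ k θ) (𝓝 0) (𝓝 0) := by
  have h : ContinuousAt (fun k => fluxT n γ k θ) 0 := by
    unfold fluxT fluxDen
    refine ContinuousAt.div (by fun_prop) (by fun_prop) ?_
    simpa using hγ
  simpa [ContinuousAt, fluxT] using h

/-- For `α > 0`, the second condition of `fluxR_eq_zero_iff` determines the energy. -/
lemma eq_reflectionlessEnergy_iff (hα0 : 0 < α) (hα1 : α < 1) (hE : 0 < E) {γ : ℝ} (hγ : 0 < γ) :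
    E = reflectionlessEnergy α γ ↔ γ = 2 * outModulus α E * Real.sin (Real.pi / 2 * α) := by
  have h1 : 0 < Real.Gamma ((1 - α) / 2) := Real.Gamma_pos_of_pos (by linarith)
  have h2 : 0 < Real.Gamma ((3 + α) / 2) := Real.Gamma_pos_of_pos (by linarith)
  have h3 : (0 : ℝ) < 2 ^ (1 + α) := Real.rpow_pos_of_pos two_pos _
  have hs := sin_half_pi_mul_pos hα0 hα1
  rw [reflectionlessEnergy, one_sub_cos_pi_mul, show 2 / (1 + α) = ((1 + α) / 2)⁻¹ by rw [inv_div],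
    Real.eq_rpow_inv hE.le (by positivity) (by linarith), outModulus]
  generalize Real.sin (Real.pi / 2 * α) = S at *
  constructor
  · intro h
    rw [h]; field_simp
  · intro h
    rw [h]; field_simp

lemma reflectionlessEnergy_pos (hα0 : 0 < α) (hα1 : α < 1) {γ : ℝ} (hγ : 0 < γ) :
    0 < reflectionlessEnergy α γ := by
  have h1 : 0 < Real.Gamma ((1 - α) / 2) := Real.Gamma_pos_of_pos (by linarith)
  have h2 : 0 < Real.Gamma ((3 + α) / 2) := Real.Gamma_pos_of_pos (by linarith)
  have hs := sin_half_pi_mul_pos hα0 hα1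
  rw [reflectionlessEnergy, one_sub_cos_pi_mul]
  positivity

lemma reflection_eq_zero_iff (hα0 : 0 ≤ α) (hα1 : α < 1) (hE : 0 < E) (a : ℂ) (γ : ℝ) :
    reflection α a γ E = 0 ↔ (0 < α ∧ ‖a‖ = 1 ∧ 0 < γ ∧ E = reflectionlessEnergy α γ) ∨
      (α = 0 ∧ ‖a‖ = 1 ∧ γ = 0) := by
  have hk := outModulus_pos hα0 hα1 hE
  rw [reflection_eq hα0 hα1 hE,
    fluxR_eq_zero_iff γ (norm_nonneg a) hk (cos_half_pi_mul_pos hα0 hα1)]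
  rcases hα0.eq_or_lt with rfl | hα
  · simp
  · constructor
    · rintro ⟨hn, h⟩
      have hs := sin_half_pi_mul_pos hα hα1
      have hγ : 0 < γ := by rw [h]; positivity
      exact Or.inl ⟨hα, hn, hγ, (eq_reflectionlessEnergy_iff hα hα1 hE hγ).2 h⟩
    · rintro (⟨_, hn, hγ, h⟩ | ⟨h, _⟩)
      · exact ⟨hn, (eq_reflectionlessEnergy_iff hα hα1 hE hγ).1 h⟩
      · exact absurd h hα.ne'

end Coefficients

end Grushin

theorem mainTheorem5 (α : ℝ) (hα0 : 0 ≤ α) (hα1 : α < 1) (a : ℂ) (γ : ℝ) :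
    -- the coefficients are well defined
    (∀ E : ℝ, 0 < E →
      Grushin.IsTransmissionCoefficient α a γ E (Grushin.transmission α a γ E) ∧
      Grushin.IsReflectionCoefficient α a γ E (Grushin.reflection α a γ E)) ∧
    -- explicit formulas
    (∀ E : ℝ, 0 < E →
      Grushin.transmission α a γ E =
        ‖((E ^ ((1 + α) / 2) : ℝ) : ℂ) * (1 + Complex.exp (Complex.I * Real.pi * α))
              * (Real.Gamma ((1 - α) / 2) : ℂ) * conj a /
            (((E ^ ((1 + α) / 2) : ℝ) : ℂ) * (Real.Gamma ((1 - α) / 2) : ℂ)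
                * (1 + (‖a‖ : ℂ) ^ 2)
              + Complex.I * γ * (((2 : ℝ) ^ (1 + α) : ℝ) : ℂ)
                * Complex.exp (Complex.I * (Real.pi / 2) * α)
                * (Real.Gamma ((3 + α) / 2) : ℂ))‖ ^ 2 ∧
      Grushin.reflection α a γ E =
        ‖(((E ^ ((1 + α) / 2) : ℝ) : ℂ) * (Real.Gamma ((1 - α) / 2) : ℂ)
                * (1 - (‖a‖ : ℂ) ^ 2 * Complex.exp (Complex.I * Real.pi * α))
              + Complex.I * γ * (((2 : ℝ) ^ (1 + α) : ℝ) : ℂ)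
                * Complex.exp (Complex.I * (Real.pi / 2) * α)
                * (Real.Gamma ((3 + α) / 2) : ℂ)) /
            (((E ^ ((1 + α) / 2) : ℝ) : ℂ) * (Real.Gamma ((1 - α) / 2) : ℂ)
                * (1 + (‖a‖ : ℂ) ^ 2)
              + Complex.I * γ * (((2 : ℝ) ^ (1 + α) : ℝ) : ℂ)
                * Complex.exp (Complex.I * (Real.pi / 2) * α)
                * (Real.Gamma ((3 + α) / 2) : ℂ))‖ ^ 2) ∧
    -- conservation of the flux
    (∀ E : ℝ, 0 < E →
      Grushin.transmission α a γ E + Grushin.reflection α a γ E = 1) ∧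
    -- energy independence for `γ = 0`
    (γ = 0 → ∀ E E' : ℝ, 0 < E → 0 < E' →
      Grushin.transmission α a γ E = Grushin.transmission α a γ E' ∧
      Grushin.reflection α a γ E = Grushin.reflection α a γ E') ∧
    -- reflectionless scattering
    (0 < α → ‖a‖ = 1 → 0 < γ →
      0 < Grushin.reflectionlessEnergy α γ ∧
      Grushin.reflection α a γ (Grushin.reflectionlessEnergy α γ) = 0) ∧
    (∀ E : ℝ, 0 < E → (Grushin.reflection α a γ E = 0 ↔
      (0 < α ∧ ‖a‖ = 1 ∧ 0 < γ ∧ E = Grushin.reflectionlessEnergy α γ) ∨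
      (α = 0 ∧ ‖a‖ = 1 ∧ γ = 0))) ∧
    -- high energy limits
    Tendsto (fun E : ℝ => Grushin.transmission α a γ E) atTop
      (𝓝 (2 * ‖a‖ ^ 2 * (1 + Real.cos (Real.pi * α)) / (1 + ‖a‖ ^ 2) ^ 2)) ∧
    Tendsto (fun E : ℝ => Grushin.reflection α a γ E) atTop
      (𝓝 ((1 + ‖a‖ ^ 4 - 2 * ‖a‖ ^ 2 * Real.cos (Real.pi * α)) / (1 + ‖a‖ ^ 2) ^ 2)) ∧
    -- low energy limits
    (γ ≠ 0 →
      Tendsto (fun E : ℝ => Grushin.transmission α a γ E) (𝓝[>] 0) (𝓝 0) ∧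
      Tendsto (fun E : ℝ => Grushin.reflection α a γ E) (𝓝[>] 0) (𝓝 1)) := by
  have hc := Grushin.cos_half_pi_mul_pos hα0 hα1
  have hTR : ∀ E : ℝ, 0 < E →
      Grushin.transmission α a γ E + Grushin.reflection α a γ E = 1 := fun E hE => by
    rw [Grushin.transmission_eq hα0 hα1 hE, Grushin.reflection_eq hα0 hα1 hE,
      Grushin.fluxT_add_fluxR _ _ (Grushin.outModulus_pos hα0 hα1 hE) hc]
  have hR : ∀ {l : Filter ℝ} {t : ℝ}, (∀ᶠ E in l, 0 < E) →
      Tendsto (fun E => Grushin.transmission α a γ E) l (𝓝 t) →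
      Tendsto (fun E => Grushin.reflection α a γ E) l (𝓝 (1 - t)) := fun hl ht => by
    refine (ht.const_sub 1).congr' ?_
    filter_upwards [hl] with E hE
    linarith [hTR E hE]
  have hT : ∀ {l : Filter ℝ} {t : ℝ}, (∀ᶠ E in l, 0 < E) →
      Tendsto (fun E => Grushin.fluxT ‖a‖ γ (Grushin.outModulus α E) (Real.pi / 2 * α)) l (𝓝 t) →
      Tendsto (fun E => Grushin.transmission α a γ E) l (𝓝 t) := fun hl ht => by
    refine ht.congr' ?_
    filter_upwards [hl] with E hE
    rw [Grushin.transmission_eq hα0 hα1 hE]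
  have htop := hT (eventually_gt_atTop 0)
    ((Grushin.tendsto_fluxT_atTop ‖a‖ γ hc).comp (Grushin.tendsto_outModulus_atTop hα0 hα1))
  rw [show 2 * (Real.pi / 2 * α) = Real.pi * α by ring] at htop
  refine ⟨fun E hE => ?_, fun E hE => ?_, hTR, fun hγ E E' hE hE' => ?_, fun hα hn hγ => ?_,
    fun E hE => Grushin.reflection_eq_zero_iff hα0 hα1 hE a γ, htop, ?_, fun hγ => ?_⟩
  · rw [Grushin.transmission_eq hα0 hα1 hE, Grushin.reflection_eq hα0 hα1 hE]
    exact Grushin.isCoefficient hα0 hα1 hE a γ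
  · obtain ⟨z, hz, h1, h2, h3⟩ := Grushin.scaled_amplitudes (E := E) hα0 a γ
    rw [h1, h2, h3, mul_div_mul_left _ _ hz, neg_mul, neg_div, norm_neg, mul_div_mul_left _ _ hz,
      Grushin.norm_sq_transmitted a γ _ _ (Grushin.outCoeff_eq α E),
      Grushin.norm_sq_reflected a γ _ _ (Grushin.outCoeff_eq α E)]
    exact ⟨Grushin.transmission_eq hα0 hα1 hE a γ, Grushin.reflection_eq hα0 hα1 hE a γ⟩
  · subst hγ
    have h : Grushin.transmission α a 0 E = Grushin.transmission α a 0 E' := by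
      have hk := (Grushin.outModulus_pos hα0 hα1 hE)
      have hk' := (Grushin.outModulus_pos hα0 hα1 hE')
      rw [Grushin.transmission_eq hα0 hα1 hE, Grushin.transmission_eq hα0 hα1 hE',
        Grushin.fluxT, Grushin.fluxT, div_eq_div_iff (Grushin.fluxDen_pos _ _ hk hc).ne'
        (Grushin.fluxDen_pos _ _ hk' hc).ne', Grushin.fluxDen, Grushin.fluxDen]
      ring
    exact ⟨h, by linarith [hTR E hE, hTR E' hE']⟩
  · have hpos := Grushin.reflectionlessEnergy_pos hα hα1 hγ
    exact ⟨hpos, (Grushin.reflection_eq_zero_iff hα0 hα1 hpos a γ).2 (Or.inl ⟨hα, hn, hγ, rfl⟩)⟩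
  · convert hR (eventually_gt_atTop 0) htop using 2
    field_simp
    ring
  · have h0 := hT self_mem_nhdsWithin
      ((Grushin.tendsto_fluxT_zero ‖a‖ (Real.pi / 2 * α) hγ).comp
        (Grushin.tendsto_outModulus_zero hα0))
    have h1 := hR self_mem_nhdsWithin h0
    rw [sub_zero] at h1
    exact ⟨h0, h1⟩
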